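/- **Setting.** A *roadmap* on $n$ viewpoints is a connected undirected simple graph $G=(V,E)$, $|V|=n$, with real edge lengths $\ell(e)>0$ such that $\ell(uw)\le \ell(uv)+\ell(vw)$ whenever $u,v,w$ are pairwise adjacent; we regard $G$ also as a metric graph, each edge $e$ being a segment of length $\ell(e)$. Let $0<m<n$ be the number of robots and let $T>0$ be a time horizon. A *team trajectory* $X=(x_1,\dots,x_m)$ consists of continuous maps $x_i:[0,T]\to G$ that are differentiable with speed at most $1$ except at finitely many times. Its *refresh time* is $$\mathrm{RT}(X)=\max_{v\in V}\ \max\{\,t_2-t_1 : 0\le t_1\le t_2\le T,\ x_i(t)\ne v \text{ for all } i \text{ and all } t_1<t<t_2\,\}.$$ A *path* is a nonempty sequence of vertices, possibly with repetitions, in which consecutive vertices are adjacent; its cost is the sum of the lengths of its edges. A *path cover* of cardinality $m$ is a family of $m$ paths that together contain every vertex; its cost is the largest cost of one of its paths. **Lemma ($8$-approximation of the refresh time).** There is a polynomial-time algorithm which, given a roadmap $G$ on $n$ viewpoints and a number $0<m<n$ of robots, computes a path cover $p_1,\dots,p_m$ of $G$ with the following properties. 1. The cost of $p_1,\dots,p_m$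 is at most $4$ times the cost of every path cover of $G$ of cardinality $m$. 2. For every horizon $T>0$, let $X$ be given by letting robot $i$ sweep $p_i$ back and forth at unit speed, starting at its first vertex (and rest if $p_i$ has a single vertex). Then $X$ is a team trajectory, and $\mathrm{RT}(X)\le 8\,\mathrm{RT}(Y)$ for every team trajectory $Y$ of $m$ robots with horizon $T$. That is, the refresh time of $X$ is at most $8$ times the minimum. Here polynomial time means the following: the algorithm is one fixed program, independent of $G$ and $m$, for a random access machine with natural-number and real memory cells, whose operations (addition, subtraction, comparison, indexed reading and writing) have unit cost and which has no real constant but $0$; it halts after at most $q(n)$ operations, for a fixed polynomial $q$. -/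

import Mathlib

namespace Patrol

/-! ### Roadmaps and paths -/

/-- A roadmap on `n` viewpoints: a connected undirected graph with a positive length on each edge;
the lengths satisfy the triangle inequality. (`len u v` is meaningful only on edges.) -/
structure Roadmap (n : ℕ) where
  graph : SimpleGraph (Fin n)
  connected : graph.Connected
  len : Fin n → Fin n → ℝ
  len_symm : ∀ u v, graph.Adj u v → len u v = len v u
  len_pos : ∀ u v, graph.Adj u v → 0 < len u v
  triangle : ∀ u v w, graph.Adj u v → graph.Adj v w → graph.Adj u w →
    len u w ≤ len u v + len v w

variable {n m : ℕ}

/-- A vertex path: a nonempty sequence of vertices, consecutive ones being adjacent. -/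
def IsPath (R : Roadmap n) (p : List (Fin n)) : Prop :=
  p ≠ [] ∧ p.IsChain R.graph.Adj

/-- The cost of a path: the sum of the lengths of its edges. -/
def pathCost (R : Roadmap n) : List (Fin n) → ℝ
  | [] => 0
  | [_] => 0
  | u :: v :: r => R.len u v + pathCost R (v :: r)

/-- A path cover of cardinality `m`: every vertex lies on one of the `m` paths. -/
def IsPathCover (R : Roadmap n) (p : Fin m → List (Fin n)) : Prop :=
  (∀ i, IsPath R (p i)) ∧ ∀ v, ∃ i, v ∈ p i

/-- The cost of a path cover: the largest cost of one of its paths. -/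
noncomputable def coverCost (R : Roadmap n) (p : Fin m → List (Fin n)) : ℝ :=
  ⨆ i, pathCost R (p i)

/-! ### Motion on a roadmap

A position is a point of the geometric realization of the graph, in barycentric coordinates:
the point that divides the edge `uv` in the ratio `θ : 1 - θ` has the coordinates `1 - θ` at `u`
and `θ` at `v`; its distance from `u` along the edge is `θ * len u v`. -/

/-- The position of the viewpoint `v`. -/
def vertexPoint (v : Fin n) : Fin n → ℝ := Pi.single v 1

/-- The position at the fraction `θ` of the way from `u` to `v`. -/
def edgePoint (u v : Fin n) (θ : ℝ) : Fin n → ℝ :=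
  (1 - θ) • vertexPoint u + θ • vertexPoint v

/-- The set of all positions on the roadmap. -/
def Roadmap.carrier (R : Roadmap n) : Set (Fin n → ℝ) :=
  {x | ∃ u v, (u = v ∨ R.graph.Adj u v) ∧ ∃ θ ∈ Set.Icc (0 : ℝ) 1, x = edgePoint u v θ}

/-- A trajectory of one robot on `[0, T]`: it stays on the roadmap, it is continuous, and outside a
finite set of times it is differentiable with speed at most one. While the robot is on the edge `uv`
its speed is `len u v` times the absolute value of the derivative of its coordinate at `v`. -/
def IsTrajectory (R : Roadmap n) (T : ℝ) (x : ℝ → Fin n → ℝ) : Prop :=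
  (∀ t ∈ Set.Icc 0 T, x t ∈ R.carrier) ∧
  ContinuousOn x (Set.Icc 0 T) ∧
  ∃ B : Finset ℝ, ∀ t ∈ Set.Ioo 0 T, t ∉ B →
    DifferentiableAt ℝ x t ∧
    ∀ u v, R.graph.Adj u v → x t u + x t v = 1 →
      R.len u v * |deriv (fun s => x s v) t| ≤ 1

/-- A team trajectory of `m` robots with time horizon `T`. -/
def IsTeamTrajectory (R : Roadmap n) (T : ℝ) (X : Fin m → ℝ → Fin n → ℝ) : Prop :=
  ∀ i, IsTrajectory R T (X i)

/-- The refresh time of a team trajectory with horizon `T`: the largest length of a time interval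
in `[0, T]` in whose interior some viewpoint is not visited by any robot. -/
noncomputable def refreshTime (T : ℝ) (X : Fin m → ℝ → Fin n → ℝ) : ℝ :=
  sSup {d | ∃ (v : Fin n) (t₁ t₂ : ℝ), 0 ≤ t₁ ∧ t₁ ≤ t₂ ∧ t₂ ≤ T ∧
    (∀ (i : Fin m) (t : ℝ), t₁ < t → t < t₂ → X i t ≠ vertexPoint v) ∧ d = t₂ - t₁}

/-- The position on the path `p` at distance `s` from its start, for `0 ≤ s ≤ pathCost R p`. -/
noncomputable def pathPoint (R : Roadmap n) : List (Fin n) → ℝ → Fin n → ℝ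
  | [], _ => 0
  | [v], _ => vertexPoint v
  | u :: v :: r, s =>
    if s ≤ R.len u v then edgePoint u v (s / R.len u v)
    else pathPoint R (v :: r) (s - R.len u v)

/-- The triangle wave of slope `±1` that runs from `0` to `L` and back with period `2 * L`: the
distance from `t` to the nearest integer multiple of `2 * L`. -/
noncomputable def triangleWave (L t : ℝ) : ℝ := |t - 2 * L * round (t / (2 * L))|

/-- Robot `i` sweeps the path `p i` back and forth at unit speed, starting at its first vertex.
(On a path with a single vertex the robot rests there.) -/
noncomputable def sweep (R : Roadmap n) (p : Fin m → List (Fin n)) :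
    Fin m → ℝ → Fin n → ℝ :=
  fun i t => pathPoint R (p i) (triangleWave (pathCost R (p i)) t)

/-! ### The machine model

While programs over two kinds of two-dimensional arrays, one holding natural numbers and one
holding real numbers. Arithmetic consists of addition and subtraction only, the only real constant
is `0`, and reals influence the control flow only through comparisons. Every operation, array
access, comparison and assignment costs one unit. -/

/-- Expressions of natural number type. `get a i j` reads the cell `(i, j)` of the array `a`;
subtraction is truncated. -/
inductive IExp
  | lit (c : ℕ)
  | get (a : ℕ) (i j : IExp)
  | add (e f : IExp)
  | sub (e f : IExp)

/-- Expressions of real type. -/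
inductive DExp
  | zero
  | get (a : ℕ) (i j : IExp)
  | add (e f : DExp)
  | sub (e f : DExp)

/-- Tests: strict comparisons and their Boolean combinations. -/
inductive Test
  | ilt (e f : IExp)
  | dlt (e f : DExp)
  | neg (b : Test)
  | conj (b c : Test)

/-- Programs. `seti a i j e` and `setd a i j e` assign to the cell `(i, j)` of the array `a`. -/
inductive Prog
  | skip
  | seti (a : ℕ) (i j e : IExp)
  | setd (a : ℕ) (i j : IExp) (e : DExp)
  | seq (P Q : Prog)
  | ite (b : Test) (P Q : Prog)
  | loop (b : Test) (P : Prog)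

/-- The contents of the memory: `idx a i j` and `dat a i j` are the cells `(i, j)` of the arrays
numbered `a`. -/
structure Store where
  idx : ℕ → ℕ → ℕ → ℕ
  dat : ℕ → ℕ → ℕ → ℝ

/-- Overwrite one cell. -/
def setCell {α : Type} (f : ℕ → ℕ → ℕ → α) (a i j : ℕ) (x : α) : ℕ → ℕ → ℕ → α :=
  fun a' i' j' => if a' = a ∧ i' = i ∧ j' = j then x else f a' i' j'

def IExp.eval (s : Store) : IExp → ℕ
  | lit c => c
  | get a i j => s.idx a (i.eval s) (j.eval s)
  | add e f => e.eval s + f.eval s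
  | sub e f => e.eval s - f.eval s

noncomputable def DExp.eval (s : Store) : DExp → ℝ
  | zero => 0
  | get a i j => s.dat a (i.eval s) (j.eval s)
  | add e f => e.eval s + f.eval s
  | sub e f => e.eval s - f.eval s

def Test.holds (s : Store) : Test → Prop
  | ilt e f => e.eval s < f.eval s
  | dlt e f => e.eval s < f.eval s
  | neg b => ¬ b.holds s
  | conj b c => b.holds s ∧ c.holds s

/-- The cost of evaluating an expression; the constant `c` is charged `c + 1`. -/
def IExp.cost : IExp → ℕ
  | lit c => c + 1
  | get _ i j => i.cost + j.cost + 1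
  | add e f => e.cost + f.cost + 1
  | sub e f => e.cost + f.cost + 1

def DExp.cost : DExp → ℕ
  | zero => 1
  | get _ i j => i.cost + j.cost + 1
  | add e f => e.cost + f.cost + 1
  | sub e f => e.cost + f.cost + 1

def Test.cost : Test → ℕ
  | ilt e f => e.cost + f.cost + 1
  | dlt e f => e.cost + f.cost + 1
  | neg b => b.cost + 1
  | conj b c => b.cost + c.cost + 1

/-- `Exec P s s' c`: the program `P`, started with memory `s`, halts with memory `s'` after exactly
`c` units of time. -/
inductive Exec : Prog → Store → Store → ℕ → Prop
  | skip (s : Store) : Exec .skip s s 1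
  | seti (a : ℕ) (i j e : IExp) (s : Store) :
      Exec (.seti a i j e) s ⟨setCell s.idx a (i.eval s) (j.eval s) (e.eval s), s.dat⟩
        (i.cost + j.cost + e.cost + 1)
  | setd (a : ℕ) (i j : IExp) (e : DExp) (s : Store) :
      Exec (.setd a i j e) s ⟨s.idx, setCell s.dat a (i.eval s) (j.eval s) (e.eval s)⟩
        (i.cost + j.cost + e.cost + 1)
  | seq {P Q : Prog} {s s' s'' : Store} {c d : ℕ} :
      Exec P s s' c → Exec Q s' s'' d → Exec (.seq P Q) s s'' (c + d)
  | ite_true {b : Test} {P Q : Prog} {s s' : Store} {c : ℕ} :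
      b.holds s → Exec P s s' c → Exec (.ite b P Q) s s' (b.cost + c)
  | ite_false {b : Test} {P Q : Prog} {s s' : Store} {c : ℕ} :
      ¬ b.holds s → Exec Q s s' c → Exec (.ite b P Q) s s' (b.cost + c)
  | loop_done {b : Test} {P : Prog} {s : Store} :
      ¬ b.holds s → Exec (.loop b P) s s b.cost
  | loop_step {b : Test} {P : Prog} {s s' s'' : Store} {c d : ℕ} :
      b.holds s → Exec P s s' c → Exec (.loop b P) s' s'' d →
      Exec (.loop b P) s s'' (b.cost + c + d)

/-- Programs are deterministic. -/
theorem Exec.unique {P : Prog} {s s₁ s₂ : Store} {c₁ c₂ : ℕ}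
    (h₁ : Exec P s s₁ c₁) (h₂ : Exec P s s₂ c₂) : s₁ = s₂ ∧ c₁ = c₂ := by
  induction h₁ generalizing s₂ c₂ with
  | skip s => cases h₂; exact ⟨rfl, rfl⟩
  | seti a i j e s => cases h₂; exact ⟨rfl, rfl⟩
  | setd a i j e s => cases h₂; exact ⟨rfl, rfl⟩
  | seq _ _ ih₁ ih₂ =>
    cases h₂ with
    | seq k₁ k₂ =>
      obtain ⟨rfl, rfl⟩ := ih₁ k₁
      obtain ⟨rfl, rfl⟩ := ih₂ k₂
      exact ⟨rfl, rfl⟩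
  | ite_true hb _ ih =>
    cases h₂ with
    | ite_true _ k => obtain ⟨rfl, rfl⟩ := ih k; exact ⟨rfl, rfl⟩
    | ite_false hb' _ => exact absurd hb hb'
  | ite_false hb _ ih =>
    cases h₂ with
    | ite_true hb' _ => exact absurd hb' hb
    | ite_false _ k => obtain ⟨rfl, rfl⟩ := ih k; exact ⟨rfl, rfl⟩
  | loop_done hb =>
    cases h₂ with
    | loop_done _ => exact ⟨rfl, rfl⟩
    | loop_step hb' _ _ => exact absurd hb' hb
  | loop_step hb _ _ ih₁ ih₂ =>
    cases h₂ with
    | loop_done hb' => exact absurd hb hb'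
    | loop_step _ k₁ k₂ =>
      obtain ⟨rfl, rfl⟩ := ih₁ k₁
      obtain ⟨rfl, rfl⟩ := ih₂ k₂
      exact ⟨rfl, rfl⟩

theorem IExp.eval_le {s : Store} {M : ℕ} (hM : 1 ≤ M) (h : ∀ a i j, s.idx a i j ≤ M) :
    ∀ e : IExp, e.eval s ≤ 2 ^ e.cost * M
  | lit c => by
    have : c < 2 ^ (c + 1) := lt_trans (Nat.lt_succ_self c) Nat.lt_two_pow_self
    simp only [eval, cost]; nlinarith
  | get a i j => (h _ _ _).trans (Nat.le_mul_of_pos_left _ (by positivity))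
  | add e f => by
    have he := IExp.eval_le hM h e
    have hf := IExp.eval_le hM h f
    have h1 : 2 ^ e.cost * M ≤ 2 ^ (e.cost + f.cost) * M := by gcongr <;> omega
    have h2 : 2 ^ f.cost * M ≤ 2 ^ (e.cost + f.cost) * M := by gcongr <;> omega
    simp only [eval, cost]
    rw [pow_succ]
    linarith
  | sub e f => by
    have he := IExp.eval_le hM h e
    have h1 : 2 ^ e.cost * M ≤ 2 ^ (e.cost + f.cost + 1) * M := by gcongr <;> omega
    simp only [eval, cost]
    omega

theorem DExp.eval_bound {s : Store} {δ : ℝ} {B : ℕ}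
    (h : ∀ a i j, ∃ z : ℤ, s.dat a i j = z * δ ∧ |z| ≤ (B : ℤ)) :
    ∀ e : DExp, ∃ z : ℤ, e.eval s = z * δ ∧ |z| ≤ 2 ^ e.cost * (B : ℤ)
  | zero => ⟨0, by simp [eval], by simp⟩
  | get a i j => by
    obtain ⟨z, hz, hB⟩ := h a (i.eval s) (j.eval s)
    refine ⟨z, hz, hB.trans ?_⟩
    exact le_mul_of_one_le_left (by positivity) (one_le_pow₀ (by norm_num))
  | add e f => by
    obtain ⟨y, hy, hy'⟩ := DExp.eval_bound h e
    obtain ⟨z, hz, hz'⟩ := DExp.eval_bound h f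
    refine ⟨y + z, by simp only [eval, hy, hz]; push_cast; ring, (abs_add_le y z).trans ?_⟩
    have h1 : (2 : ℤ) ^ e.cost * B ≤ 2 ^ (e.cost + f.cost) * B := by gcongr <;> norm_num
    have h2 : (2 : ℤ) ^ f.cost * B ≤ 2 ^ (e.cost + f.cost) * B := by gcongr <;> norm_num
    simp only [cost]
    rw [pow_succ]
    linarith
  | sub e f => by
    obtain ⟨y, hy, hy'⟩ := DExp.eval_bound h e
    obtain ⟨z, hz, hz'⟩ := DExp.eval_bound h f
    refine ⟨y - z, by simp only [eval, hy, hz]; push_cast; ring, (abs_sub y z).trans ?_⟩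
    have h1 : (2 : ℤ) ^ e.cost * B ≤ 2 ^ (e.cost + f.cost) * B := by gcongr <;> norm_num
    have h2 : (2 : ℤ) ^ f.cost * B ≤ 2 ^ (e.cost + f.cost) * B := by gcongr <;> norm_num
    simp only [cost]
    rw [pow_succ]
    linarith

/-- Numbers grow by at most one bit per unit of time: the natural numbers in memory at most double,
and if the real inputs are integer multiples of `δ` (for instance rationals with common denominator
`1 / δ`), then so are all reals in memory, with integer factors that at most double. Hence a
polynomial bound on the running time in this model is one in the bit model as well. -/
theorem Exec.growth {P : Prog} {s s' : Store} {c : ℕ} (h : Exec P s s' c) {δ : ℝ} {M B : ℕ}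
    (hM : 1 ≤ M) (hi : ∀ a i j, s.idx a i j ≤ M)
    (hd : ∀ a i j, ∃ z : ℤ, s.dat a i j = z * δ ∧ |z| ≤ (B : ℤ)) :
    (∀ a i j, s'.idx a i j ≤ 2 ^ c * M) ∧
    ∀ a i j, ∃ z : ℤ, s'.dat a i j = z * δ ∧ |z| ≤ ((2 ^ c * B : ℕ) : ℤ) := by
  have mono : ∀ {x y k : ℕ}, x ≤ y → 2 ^ x * k ≤ 2 ^ y * k := fun h =>
    Nat.mul_le_mul_right _ (Nat.pow_le_pow_right (by norm_num) h)
  have one : ∀ (x k : ℕ), k ≤ 2 ^ x * k := fun x k => Nat.le_mul_of_pos_left _ (by positivity)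
  have one' : ∀ (x k : ℕ), (k : ℤ) ≤ ((2 ^ x * k : ℕ) : ℤ) := fun x k => by exact_mod_cast one x k
  induction h generalizing M B with
  | skip s => exact ⟨fun a i j => (hi a i j).trans (one _ _), fun a i j =>
      let ⟨z, hz, hB⟩ := hd a i j; ⟨z, hz, hB.trans (one' _ _)⟩⟩
  | seti a i j e s =>
    refine ⟨fun a' i' j' => ?_, fun a i j =>
      let ⟨z, hz, hB⟩ := hd a i j; ⟨z, hz, hB.trans (one' _ _)⟩⟩
    simp only [setCell]
    split_ifs
    · exact (e.eval_le hM hi).trans (mono (by omega))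
    · exact (hi _ _ _).trans (one _ _)
  | setd a i j e s =>
    refine ⟨fun a' i' j' => (hi _ _ _).trans (one _ _), fun a' i' j' => ?_⟩
    simp only [setCell]
    split_ifs
    · obtain ⟨z, hz, hB⟩ := e.eval_bound hd
      refine ⟨z, hz, hB.trans ?_⟩
      exact_mod_cast mono (show e.cost ≤ i.cost + j.cost + e.cost + 1 by omega)
    · obtain ⟨z, hz, hB⟩ := hd a' i' j'
      exact ⟨z, hz, hB.trans (one' _ _)⟩
  | @seq P Q s s₁ s₂ c d _ _ ih₁ ih₂ =>
    obtain ⟨h1, h2⟩ := ih₁ hM hi hd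
    obtain ⟨h3, h4⟩ := ih₂ (hM.trans (one c M)) h1 h2
    have e : ∀ k, 2 ^ d * (2 ^ c * k) = 2 ^ (c + d) * k := fun k => by rw [pow_add]; ring
    exact ⟨by simpa only [e] using h3, by simpa only [e] using h4⟩
  | @ite_true b _ _ _ _ c _ _ ih =>
    obtain ⟨h1, h2⟩ := ih hM hi hd
    have hc : c ≤ b.cost + c := by omega
    exact ⟨fun a i j => (h1 a i j).trans (mono hc), fun a i j =>
      let ⟨z, hz, hB⟩ := h2 a i j; ⟨z, hz, hB.trans (by exact_mod_cast mono hc)⟩⟩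
  | @ite_false b _ _ _ _ c _ _ ih =>
    obtain ⟨h1, h2⟩ := ih hM hi hd
    have hc : c ≤ b.cost + c := by omega
    exact ⟨fun a i j => (h1 a i j).trans (mono hc), fun a i j =>
      let ⟨z, hz, hB⟩ := h2 a i j; ⟨z, hz, hB.trans (by exact_mod_cast mono hc)⟩⟩
  | loop_done _ => exact ⟨fun a i j => (hi a i j).trans (one _ _), fun a i j =>
      let ⟨z, hz, hB⟩ := hd a i j; ⟨z, hz, hB.trans (one' _ _)⟩⟩
  | @loop_step b P s s₁ s₂ c d _ _ _ ih₁ ih₂ =>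
    obtain ⟨h1, h2⟩ := ih₁ hM hi hd
    obtain ⟨h3, h4⟩ := ih₂ (hM.trans (one c M)) h1 h2
    have e : ∀ k, 2 ^ d * (2 ^ c * k) ≤ 2 ^ (b.cost + c + d) * k := fun k => by
      have : 2 ^ d * (2 ^ c * k) = 2 ^ (c + d) * k := by rw [pow_add]; ring
      rw [this]; exact mono (by omega)
    exact ⟨fun a i j => (h3 a i j).trans (e M), fun a i j =>
      let ⟨z, hz, hB⟩ := h4 a i j; ⟨z, hz, hB.trans (by exact_mod_cast e B)⟩⟩

open Classical in
/-- The memory that presents a roadmap and a number `m` of robots to a program: the cell `(0, 0)` of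
the natural number array `0` holds `n`, that of array `1` holds `m`, array `2` is the adjacency
matrix, the real array `0` is the matrix of edge lengths, and everything else is `0`. -/
noncomputable def input (R : Roadmap n) (m : ℕ) : Store where
  idx a i j :=
    if a = 0 ∧ i = 0 ∧ j = 0 then n
    else if a = 1 ∧ i = 0 ∧ j = 0 then m
    else if h : i < n ∧ j < n then
      if a = 2 ∧ R.graph.Adj ⟨i, h.1⟩ ⟨j, h.2⟩ then 1 else 0
    else 0
  dat a i j :=
    if h : i < n ∧ j < n then
      if a = 0 ∧ R.graph.Adj ⟨i, h.1⟩ ⟨j, h.2⟩ then R.len ⟨i, h.1⟩ ⟨j, h.2⟩ else 0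
    else 0

/-- The memory `s` holds the vertex sequences `p`: the cell `(i, 0)` of array `3` is the number of
terms of `p i`, and row `i` of array `4` begins with these terms. -/
def Outputs (s : Store) (p : Fin m → List (Fin n)) : Prop :=
  ∀ i : Fin m, (p i).map Fin.val = (List.range (s.idx 3 i 0)).map (s.idx 4 i)

end Patrol

/-
Kruskal's algorithm passes, for every threshold `c`, through a minimum spanning forest of the graph
formed by the edges of length at most `c`. If `c` is the cost of a path cover, then every path of
the cover stays in one component of this graph. In a component that contains `k` of the paths, these
paths can be connected by `k - 1` edges, so that its minimum spanning tree weighs at most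
`(2 k - 1) c`, and the closed tour that traverses every edge of the tree twice has length at most
`(4 k - 2) c`. Cutting this tour greedily into segments of cost at most `4 c` yields at most `k`
segments, hence at most `m` over all components. The number `c` is not known, but only the costs of
parts of the tours matter as bounds for the segments, and the algorithm tries all of these at each
stage.

A robot that sweeps a path of cost `C` visits each of its vertices at least once in every period of
length `2 C`, whereas within a time window longer than its refresh time a team traces a path cover.
Hence the factor `8` is `2 * 4`.
-/

namespace Patrol

variable {n m : ℕ}

open Filter Topology

/-! ### The distance of viewpoints -/

theorem pathCost_nonneg (R : Roadmap n) :
    ∀ {p : List (Fin n)}, p.IsChain R.graph.Adj → 0 ≤ pathCost R p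
  | [], _ => le_rfl
  | [_], _ => le_rfl
  | u :: v :: r, h => by
    rw [List.isChain_cons_cons] at h
    exact add_nonneg (R.len_pos _ _ h.1).le (pathCost_nonneg R h.2)

/-- The length of a walk, with which the roadmap distance and path covers are compared. -/
def walkCost (R : Roadmap n) {u v : Fin n} (w : R.graph.Walk u v) : ℝ :=
  pathCost R w.support

theorem isPath_support (R : Roadmap n) {u v : Fin n} (w : R.graph.Walk u v) :
    IsPath R w.support :=
  ⟨w.support_ne_nil, w.isChain_adj_support⟩

theorem walkCost_nonneg (R : Roadmap n) {u v : Fin n} (w : R.graph.Walk u v) :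
    0 ≤ walkCost R w :=
  pathCost_nonneg R w.isChain_adj_support

theorem walkCost_cons (R : Roadmap n) {u v z : Fin n} (h : R.graph.Adj u v)
    (w : R.graph.Walk v z) : walkCost R (.cons h w) = R.len u v + walkCost R w := by
  rw [walkCost, walkCost, SimpleGraph.Walk.support_cons, ← w.cons_tail_support, pathCost]

theorem walkCost_append (R : Roadmap n) {u v z : Fin n} (w : R.graph.Walk u v)
    (w' : R.graph.Walk v z) : walkCost R (w.append w') = walkCost R w + walkCost R w' := by
  induction w with
  | nil => simp [walkCost, pathCost]
  | cons h w ih => rw [SimpleGraph.Walk.cons_append, walkCost_cons, walkCost_cons, ih, add_assoc]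

theorem walkCost_bypass_le (R : Roadmap n) {u v : Fin n} (w : R.graph.Walk u v) :
    walkCost R w.bypass ≤ walkCost R w := by
  induction w with
  | nil => rfl
  | cons h w ih =>
    rw [walkCost_cons, SimpleGraph.Walk.bypass]
    split_ifs with hu
    · have hsplit := congrArg (walkCost R) (w.bypass.take_spec hu)
      rw [walkCost_append] at hsplit
      linarith [walkCost_nonneg R (w.bypass.takeUntil _ hu), R.len_pos _ _ h]
    · rw [walkCost_cons]
      gcongr

/-- The distance of two viewpoints, as a minimum over the finitely many simple paths. -/
noncomputable def walkDist (R : Roadmap n) (u v : Fin n) : ℝ :=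
  ⨅ p : R.graph.Path u v, walkCost R p.1

theorem walkDist_le (R : Roadmap n) {u v : Fin n} (w : R.graph.Walk u v) :
    walkDist R u v ≤ walkCost R w := by
  classical
  exact (ciInf_le (Set.finite_range _).bddBelow w.toPath).trans (walkCost_bypass_le R w)

theorem exists_walkCost_eq_walkDist (R : Roadmap n) (u v : Fin n) :
    ∃ w : R.graph.Walk u v, walkCost R w = walkDist R u v := by
  classical
  have : Nonempty (R.graph.Path u v) := (R.connected.preconnected u v).elim fun w => ⟨w.toPath⟩
  obtain ⟨p, hp⟩ := exists_eq_ciInf_of_finite (f := fun p : R.graph.Path u v => walkCost R p.1)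
  exact ⟨p.1, hp⟩

theorem walkDist_self_le (R : Roadmap n) (u : Fin n) : walkDist R u u ≤ 0 :=
  walkDist_le R .nil

theorem walkDist_le_add (R : Roadmap n) (u : Fin n) {a b : Fin n} (hab : R.graph.Adj a b) :
    walkDist R u b ≤ walkDist R u a + R.len a b := by
  obtain ⟨w, hw⟩ := exists_walkCost_eq_walkDist R u a
  calc walkDist R u b ≤ walkCost R (w.append (.cons hab .nil)) := walkDist_le R _
    _ = walkDist R u a + R.len a b := by
      rw [walkCost_append, hw, walkCost_cons]
      simp [walkCost, pathCost]

theorem abs_walkDist_sub_le (R : Roadmap n) (u : Fin n) {a b : Fin n} (hab : R.graph.Adj a b) :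
    |walkDist R u b - walkDist R u a| ≤ R.len a b := by
  have h := walkDist_le_add R u hab
  have h' := walkDist_le_add R u hab.symm
  rw [R.len_symm b a hab.symm] at h'
  rw [abs_le]
  constructor <;> linarith

/-! ### Motion of one robot -/

theorem edgePoint_apply (u v w : Fin n) (θ : ℝ) :
    edgePoint u v θ w = (1 - θ) * (if w = u then 1 else 0) + θ * (if w = v then 1 else 0) := by
  simp [edgePoint, vertexPoint, Pi.single_apply]

theorem edgePoint_zero (u v : Fin n) : edgePoint u v 0 = vertexPoint u := by
  simp [edgePoint]

theorem edgePoint_one (u v : Fin n) : edgePoint u v 1 = vertexPoint v := by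
  simp [edgePoint]

theorem Roadmap.nonneg_of_mem_carrier {R : Roadmap n} {x : Fin n → ℝ} (hx : x ∈ R.carrier)
    (w : Fin n) : 0 ≤ x w := by
  obtain ⟨u, v, -, θ, hθ, rfl⟩ := hx
  have h : 0 ≤ 1 - θ := sub_nonneg.2 hθ.2
  have h' : 0 ≤ θ := hθ.1
  rw [edgePoint_apply]
  positivity

theorem Roadmap.sum_of_mem_carrier {R : Roadmap n} {x : Fin n → ℝ} (hx : x ∈ R.carrier) :
    ∑ w, x w = 1 := by
  obtain ⟨u, v, -, θ, -, rfl⟩ := hx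
  simp [edgePoint_apply, Finset.sum_add_distrib]

theorem sub_le_of_deriv_le_one_off_finset {f : ℝ → ℝ} (B : Finset ℝ) {s t : ℝ} (hst : s ≤ t)
    (hc : ContinuousOn f (Set.Icc s t))
    (hd : ∀ r ∈ Set.Ioo s t, r ∉ B → DifferentiableAt ℝ f r ∧ deriv f r ≤ 1) :
    f t - f s ≤ t - s := by
  induction B using Finset.induction_on generalizing s t with
  | empty =>
    rw [← interior_Icc] at hd
    simpa using (convex_Icc s t).image_sub_le_mul_sub_of_deriv_le hc
      (fun r hr => (hd r hr (by simp)).1.differentiableWithinAt)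
      (fun r hr => (hd r hr (by simp)).2) s ⟨le_rfl, hst⟩ t ⟨hst, le_rfl⟩ hst
  | insert b B _ ih =>
    by_cases hb : b ∈ Set.Ioo s t
    · have hleft := ih hb.1.le (hc.mono (Set.Icc_subset_Icc le_rfl hb.2.le))
        fun r hr hrB => hd r ⟨hr.1, hr.2.trans hb.2⟩ (by simp [hrB, hr.2.ne])
      have hright := ih hb.2.le (hc.mono (Set.Icc_subset_Icc hb.1.le le_rfl))
        fun r hr hrB => hd r ⟨hb.1.trans hr.1, hr.2⟩ (by simp [hrB, hr.1.ne'])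
      linarith
    · refine ih hst hc fun r hr hrB => hd r hr ?_
      rw [Finset.mem_insert, not_or]
      exact ⟨fun h => hb (h ▸ hr), hrB⟩

theorem deriv_coord_eq_zero {R : Roadmap n} {x : ℝ → Fin n → ℝ} {t : ℝ}
    (hx : ∀ᶠ s in 𝓝 t, x s ∈ R.carrier) {w : Fin n} (hw : x t w = 0) :
    deriv (fun s => x s w) t = 0 := by
  refine IsLocalMin.deriv_eq_zero ?_
  filter_upwards [hx] with s hs
  rw [hw]
  exact Roadmap.nonneg_of_mem_carrier hs w

theorem sum_deriv_coord_eq_zero {R : Roadmap n} {x : ℝ → Fin n → ℝ} {t : ℝ}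
    (hx : ∀ᶠ s in 𝓝 t, x s ∈ R.carrier) (hd : DifferentiableAt ℝ x t) :
    ∑ w, deriv (fun s => x s w) t = 0 := by
  have hone : (fun s => ∑ w, x s w) =ᶠ[𝓝 t] fun _ => 1 :=
    hx.mono fun s hs => Roadmap.sum_of_mem_carrier hs
  rw [← deriv_fun_sum fun w _ => differentiableAt_pi.1 hd w, hone.deriv_eq, deriv_const]

theorem sum_mul_deriv_coord_le_one {R : Roadmap n} {x : ℝ → Fin n → ℝ} {D : Fin n → ℝ} {t : ℝ}
    (hD : ∀ a b, R.graph.Adj a b → |D b - D a| ≤ R.len a b)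
    (hx : ∀ᶠ s in 𝓝 t, x s ∈ R.carrier) (hd : DifferentiableAt ℝ x t)
    (hspeed : ∀ u v, R.graph.Adj u v → x t u + x t v = 1 →
      R.len u v * |deriv (fun s => x s v) t| ≤ 1) :
    ∑ w, D w * deriv (fun s => x s w) t ≤ 1 := by
  let x' : Fin n → ℝ := fun w => deriv (fun s => x s w) t
  have hsum : ∑ w, x' w = 0 := sum_deriv_coord_eq_zero hx hd
  obtain ⟨u, v, huv, θ, -, hxt⟩ := hx.self_of_nhds
  have hoff : ∀ w, w ≠ u → w ≠ v → x' w = 0 := fun w hu hv =>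
    deriv_coord_eq_zero hx (by simp [hxt, edgePoint_apply, hu, hv])
  obtain rfl | huv' := eq_or_ne u v
  · have hu : x' u = 0 := by
      rw [← hsum, Finset.sum_eq_single u (fun w _ h => hoff w h h) (by simp)]
    have hx' : ∀ w, x' w = 0 := fun w => by
      obtain rfl | h := eq_or_ne w u
      exacts [hu, hoff w h h]
    exact (Finset.sum_eq_zero fun w _ => mul_eq_zero_of_right _ (hx' w)).trans_le zero_le_one
  · have hadj := huv.resolve_left huv'
    have hpair : ∀ f : Fin n → ℝ, (∀ w, w ≠ u → w ≠ v → f w = 0) → ∑ w, f w = f u + f v :=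
      fun f hf => Fintype.sum_eq_add u v huv' fun w hw => hf w hw.1 hw.2
    rw [hpair _ hoff] at hsum
    calc ∑ w, D w * x' w = D u * x' u + D v * x' v :=
          hpair _ fun w hu hv => by rw [hoff w hu hv, mul_zero]
      _ = (D v - D u) * x' v := by rw [eq_neg_of_add_eq_zero_left hsum]; ring
      _ ≤ |D v - D u| * |x' v| := by rw [← abs_mul]; exact le_abs_self _
      _ ≤ R.len u v * |x' v| := by gcongr; exact hD u v hadj
      _ ≤ 1 := hspeed u v hadj (by simp [hxt, edgePoint_apply, huv', huv'.symm])

-- The distance from `u`, interpolated linearly along the edges, has slope at most one.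
theorem walkDist_le_of_isTrajectory {R : Roadmap n} {T : ℝ} {x : ℝ → Fin n → ℝ}
    (hx : IsTrajectory R T x) {s t : ℝ} (hs : 0 ≤ s) (hst : s ≤ t) (ht : t ≤ T) {u v : Fin n}
    (hu : x s = vertexPoint u) (hv : x t = vertexPoint v) : walkDist R u v ≤ t - s := by
  obtain ⟨hcarrier, hcont, B, hdiff⟩ := hx
  have hslope : ∑ w, walkDist R u w * x t w - ∑ w, walkDist R u w * x s w ≤ t - s := by
    refine sub_le_of_deriv_le_one_off_finset (f := fun r => ∑ w, walkDist R u w * x r w) B hst ?_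
      fun r hr hrB => ?_
    · exact continuousOn_finsetSum _ fun w _ => continuousOn_const.mul
        ((continuous_apply w).comp_continuousOn (hcont.mono (Set.Icc_subset_Icc hs ht)))
    · have hr' : r ∈ Set.Ioo 0 T := ⟨hs.trans_lt hr.1, hr.2.trans_le ht⟩
      obtain ⟨hd, hspeed⟩ := hdiff r hr' hrB
      have hdw := differentiableAt_pi.1 hd
      refine ⟨DifferentiableAt.fun_sum fun w _ => (hdw w).const_mul _, ?_⟩
      rw [deriv_fun_sum fun w _ => (hdw w).const_mul _]
      simp only [deriv_const_mul _ (hdw _)]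
      refine sum_mul_deriv_coord_le_one (fun a b => abs_walkDist_sub_le R u) ?_ hd hspeed
      filter_upwards [Ioo_mem_nhds hr'.1 hr'.2] with q hq
      exact hcarrier q ⟨hq.1.le, hq.2.le⟩
  simp only [hu, hv, vertexPoint, Pi.single_apply, mul_ite, mul_one, mul_zero,
    Finset.sum_ite_eq', Finset.mem_univ, if_true] at hslope
  linarith [walkDist_self_le R u]

/-! ### Path covers from team trajectories -/

theorem exists_walk_through_visits {R : Roadmap n} {T : ℝ} {x : ℝ → Fin n → ℝ}
    (hx : IsTrajectory R T x) (time : Fin n → ℝ) {W : Finset (Fin n)} (hW : W.Nonempty)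
    (hvisit : ∀ v ∈ W, 0 ≤ time v ∧ time v ≤ T ∧ x (time v) = vertexPoint v) :
    ∃ u, ∃ z ∈ W, ∃ w : R.graph.Walk u z, (∀ v ∈ W, v ∈ w.support) ∧ walkCost R w ≤ time z := by
  suffices h : ∃ u, ∃ z ∈ W, ∃ w : R.graph.Walk u z, (∀ v ∈ W, v ∈ w.support ∧ time v ≤ time z) ∧
      walkCost R w ≤ time z by
    obtain ⟨u, z, hz, w, hw, hcost⟩ := h
    exact ⟨u, z, hz, w, fun v hv => (hw v hv).1, hcost⟩
  induction W using Finset.induction_on_max_value time with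
  | empty => simp at hW
  | insert a W _ hmax ih =>
    have ha := hvisit a (by simp)
    obtain rfl | hW := W.eq_empty_or_nonempty
    · exact ⟨a, a, by simp, .nil, by simp, ha.1⟩
    · obtain ⟨u, z, hz, w, hw, hcost⟩ := ih hW fun v hv => hvisit v (by simp [hv])
      obtain ⟨hz0, -, hxz⟩ := hvisit z (by simp [hz])
      obtain ⟨w', hw'⟩ := exists_walkCost_eq_walkDist R z a
      have hdist := walkDist_le_of_isTrajectory hx hz0 (hmax z hz) ha.2.1 hxz ha.2.2
      refine ⟨u, a, by simp, w.append w', fun v hv => ?_, ?_⟩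
      · obtain rfl | hv := Finset.mem_insert.1 hv
        · exact ⟨SimpleGraph.Walk.end_mem_support _, le_rfl⟩
        · exact ⟨SimpleGraph.Walk.support_subset_support_append_left _ _ (hw v hv).1, hmax v hv⟩
      · rw [walkCost_append]
        linarith

theorem le_coverCost (R : Roadmap n) (p : Fin m → List (Fin n)) (i : Fin m) :
    pathCost R (p i) ≤ coverCost R p :=
  le_ciSup (Set.finite_range fun i => pathCost R (p i)).bddAbove i

theorem coverCost_le (R : Roadmap n) {p : Fin m → List (Fin n)} (hm : 0 < m) {c : ℝ}
    (h : ∀ i, pathCost R (p i) ≤ c) : coverCost R p ≤ c :=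
  haveI : Nonempty (Fin m) := ⟨⟨0, hm⟩⟩
  ciSup_le h

theorem exists_isPathCover_of_forall_visited {R : Roadmap n} {T τ : ℝ} (hτ0 : 0 ≤ τ) (hτ : τ ≤ T)
    (hm : 0 < m) {Y : Fin m → ℝ → Fin n → ℝ} (hY : IsTeamTrajectory R T Y)
    (hvisit : ∀ v, ∃ i, ∃ t ∈ Set.Icc 0 τ, Y i t = vertexPoint v) :
    ∃ p : Fin m → List (Fin n), IsPathCover R p ∧ coverCost R p ≤ τ := by
  choose robot time htime hpos using hvisit
  have hrobot : ∀ i, ∃ p, IsPath R p ∧ (∀ v, robot v = i → v ∈ p) ∧ pathCost R p ≤ τ := by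
    intro i
    obtain hW | hW := (Finset.univ.filter (robot · = i)).eq_empty_or_nonempty
    · obtain ⟨u⟩ := R.connected.nonempty
      refine ⟨[u], isPath_support R (.nil : R.graph.Walk u u), fun v hv => ?_, hτ0⟩
      exact absurd hv (Finset.filter_eq_empty_iff.1 hW (Finset.mem_univ v))
    · obtain ⟨u, z, -, w, hw, hcost⟩ := exists_walk_through_visits (hY i) time hW fun v hv => by
        obtain rfl : robot v = i := by simpa using hv
        exact ⟨(htime v).1, (htime v).2.trans hτ, hpos v⟩
      exact ⟨w.support, isPath_support R w, fun v hv => hw v (by simp [hv]),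
        hcost.trans (htime z).2⟩
  choose p hpath hmem hcost using hrobot
  exact ⟨p, ⟨hpath, fun v => ⟨robot v, hmem _ v rfl⟩⟩, coverCost_le R hm hcost⟩

theorem refreshTime_bddAbove (T : ℝ) (X : Fin m → ℝ → Fin n → ℝ) :
    BddAbove {d | ∃ (v : Fin n) (t₁ t₂ : ℝ), 0 ≤ t₁ ∧ t₁ ≤ t₂ ∧ t₂ ≤ T ∧
      (∀ (i : Fin m) (t : ℝ), t₁ < t → t < t₂ → X i t ≠ vertexPoint v) ∧ d = t₂ - t₁} :=
  ⟨T, by rintro _ ⟨v, t₁, t₂, h0, -, hT, -, rfl⟩; linarith⟩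

theorem refreshTime_nonneg {T : ℝ} (hT : 0 ≤ T) (v : Fin n) (X : Fin m → ℝ → Fin n → ℝ) :
    0 ≤ refreshTime T X :=
  le_csSup (refreshTime_bddAbove T X)
    ⟨v, 0, 0, le_rfl, le_rfl, hT, fun i t h h' => by linarith, by simp⟩

theorem refreshTime_le {T : ℝ} {X : Fin m → ℝ → Fin n → ℝ} {c : ℝ} (hc : 0 ≤ c)
    (h : ∀ (v : Fin n) (t₁ t₂ : ℝ), 0 ≤ t₁ → t₁ ≤ t₂ → t₂ ≤ T →
      (∀ (i : Fin m) (t : ℝ), t₁ < t → t < t₂ → X i t ≠ vertexPoint v) → t₂ - t₁ ≤ c) :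
    refreshTime T X ≤ c := by
  refine Real.sSup_le ?_ hc
  rintro _ ⟨v, t₁, t₂, h0, h12, hT, hfree, rfl⟩
  exact h v t₁ t₂ h0 h12 hT hfree

theorem exists_isPathCover_of_refreshTime_lt {R : Roadmap n} {T τ : ℝ} (hm : 0 < m)
    {Y : Fin m → ℝ → Fin n → ℝ} (hY : IsTeamTrajectory R T Y) (hτ0 : 0 ≤ τ)
    (hlt : refreshTime T Y < τ) (hτ : τ ≤ T) :
    ∃ p : Fin m → List (Fin n), IsPathCover R p ∧ coverCost R p ≤ τ := by
  refine exists_isPathCover_of_forall_visited hτ0 hτ hm hY fun v => ?_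
  by_contra! hv
  refine hlt.not_ge (le_csSup (refreshTime_bddAbove T Y)
    ⟨v, 0, τ, le_rfl, hτ0, hτ, fun i t h h' => hv i t ⟨h.le, h'.le⟩, by simp⟩)

/-! ### Sweeping a path -/

theorem pathPoint_zero (R : Roadmap n) (u : Fin n) :
    ∀ {l : List (Fin n)}, (u :: l).IsChain R.graph.Adj → pathPoint R (u :: l) 0 = vertexPoint u
  | [], _ => rfl
  | v :: l, h => by
    rw [List.isChain_cons_cons] at h
    rw [pathPoint, if_pos (R.len_pos _ _ h.1).le, zero_div, edgePoint_zero]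

theorem continuous_edgePoint (u v : Fin n) : Continuous (edgePoint u v) := by
  unfold edgePoint
  fun_prop

theorem continuous_pathPoint (R : Roadmap n) :
    ∀ {p : List (Fin n)}, p.IsChain R.graph.Adj → Continuous (pathPoint R p)
  | [], _ => continuous_const
  | [_], _ => continuous_const
  | u :: v :: r, h => by
    rw [List.isChain_cons_cons] at h
    change Continuous fun s => if s ≤ R.len u v then edgePoint u v (s / R.len u v)
      else pathPoint R (v :: r) (s - R.len u v)
    refine Continuous.if_le ((continuous_edgePoint u v).comp (by fun_prop))
      ((continuous_pathPoint R h.2).comp (by fun_prop)) continuous_id continuous_const ?_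
    rintro s rfl
    rw [div_self (R.len_pos _ _ h.1).ne', edgePoint_one, sub_self, pathPoint_zero R v h.2]

theorem pathPoint_mem_carrier (R : Roadmap n) :
    ∀ {p : List (Fin n)}, IsPath R p → ∀ {s : ℝ}, 0 ≤ s → pathPoint R p s ∈ R.carrier
  | [], h, _, _ => absurd rfl h.1
  | [v], _, _, _ => ⟨v, v, Or.inl rfl, 0, by simp, (edgePoint_zero v v).symm⟩
  | u :: v :: r, h, s, hs => by
    have h' := List.isChain_cons_cons.1 h.2
    have hpos := R.len_pos _ _ h'.1
    rw [pathPoint]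
    split_ifs with hle
    · exact ⟨u, v, Or.inr h'.1, _, ⟨by positivity, (div_le_one hpos).2 hle⟩, rfl⟩
    · exact pathPoint_mem_carrier R ⟨by simp, h'.2⟩ (by linarith)

theorem exists_pathPoint_eq_vertexPoint (R : Roadmap n) :
    ∀ {p : List (Fin n)}, p.IsChain R.graph.Adj → ∀ {v : Fin n}, v ∈ p →
      ∃ s ∈ Set.Icc 0 (pathCost R p), pathPoint R p s = vertexPoint v
  | [], _, _, hv => by simp at hv
  | [w], _, v, hv => by
    obtain rfl : v = w := by simpa using hv
    exact ⟨0, by simp [pathCost], rfl⟩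
  | u :: w :: r, h, v, hv => by
    have h' := List.isChain_cons_cons.1 h
    have hpos := R.len_pos _ _ h'.1
    obtain rfl | hv := List.mem_cons.1 hv
    · exact ⟨0, ⟨le_rfl, pathCost_nonneg R h⟩, pathPoint_zero R v h⟩
    · obtain ⟨s, ⟨hs0, hs1⟩, hs⟩ := exists_pathPoint_eq_vertexPoint R h'.2 hv
      refine ⟨s + R.len u w, ⟨by linarith, by rw [pathCost]; linarith⟩, ?_⟩
      obtain rfl | hs0 := hs0.eq_or_lt
      · rw [pathPoint, zero_add, if_pos le_rfl, div_self hpos.ne', edgePoint_one, ← hs,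
          pathPoint_zero R w h'.2]
      · rw [pathPoint, if_neg (by linarith), add_sub_cancel_right, hs]

theorem IsPath.eq_singleton_or_cost_pos {R : Roadmap n} :
    ∀ {p : List (Fin n)}, IsPath R p → (∃ v, p = [v]) ∨ 0 < pathCost R p
  | [], h => absurd rfl h.1
  | [v], _ => Or.inl ⟨v, rfl⟩
  | u :: v :: r, h => by
    have hchain := List.isChain_cons_cons.1 h.2
    exact Or.inr (add_pos_of_pos_of_nonneg (R.len_pos _ _ hchain.1) (pathCost_nonneg R hchain.2))

/-! ### Speed -/

/-- The condition that `IsTrajectory` imposes at the time `s`, outside the exceptional set: the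
motion `x` is differentiable and its speed is at most one. -/
def SlowAt (R : Roadmap n) (x : ℝ → Fin n → ℝ) (s : ℝ) : Prop :=
  DifferentiableAt ℝ x s ∧ ∀ u v, R.graph.Adj u v → x s u + x s v = 1 →
    R.len u v * |deriv (fun r => x r v) s| ≤ 1

theorem SlowAt.congr {R : Roadmap n} {x y : ℝ → Fin n → ℝ} {s : ℝ} (h : SlowAt R x s)
    (hxy : y =ᶠ[nhds s] x) : SlowAt R y s := by
  refine ⟨h.1.congr_of_eventuallyEq hxy, fun u v huv hsum => ?_⟩
  have hv : (fun r => y r v) =ᶠ[nhds s] fun r => x r v := hxy.mono fun r hr => congrFun hr v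
  rw [hv.deriv_eq]
  exact h.2 u v huv (by rwa [← hxy.eq_of_nhds])

theorem SlowAt.comp {R : Roadmap n} {x : ℝ → Fin n → ℝ} {f : ℝ → ℝ} {f' t : ℝ}
    (h : SlowAt R x (f t)) (hf : HasDerivAt f f' t) (hf' : |f'| ≤ 1) :
    SlowAt R (fun t => x (f t)) t := by
  refine ⟨h.1.comp t hf.differentiableAt, fun u v huv hsum => ?_⟩
  have hderiv : deriv (fun r => x (f r) v) t = deriv (fun r => x r v) (f t) * f' :=
    ((differentiableAt_pi.1 h.1 v).hasDerivAt.comp t hf).deriv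
  calc R.len u v * |deriv (fun r => x (f r) v) t|
      = R.len u v * |deriv (fun r => x r v) (f t)| * |f'| := by rw [hderiv, abs_mul, mul_assoc]
    _ ≤ 1 := mul_le_one₀ (h.2 u v huv hsum) (abs_nonneg _) hf'

theorem slowAt_const (R : Roadmap n) (x : Fin n → ℝ) (s : ℝ) : SlowAt R (fun _ => x) s :=
  ⟨differentiableAt_const _, fun u v _ _ => by simp⟩

theorem eq_or_eq_of_edgePoint_add_eq_one {u v a b : Fin n} {θ : ℝ} (hθ : θ ∈ Set.Ioo (0 : ℝ) 1)
    (huv : u ≠ v) (hab : a ≠ b) (h : edgePoint u v θ a + edgePoint u v θ b = 1) :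
    a = u ∧ b = v ∨ a = v ∧ b = u := by
  have hθ0 := hθ.1
  have hθ1 := hθ.2
  simp only [edgePoint_apply] at h
  grind

theorem slowAt_edge (R : Roadmap n) {u v : Fin n} (huv : R.graph.Adj u v) {s : ℝ}
    (hs : s ∈ Set.Ioo 0 (R.len u v)) :
    SlowAt R (fun s => edgePoint u v (s / R.len u v)) s := by
  have hpos := R.len_pos u v huv
  have hder : ∀ w, HasDerivAt (fun r => edgePoint u v (r / R.len u v) w)
      (-(1 / R.len u v) * (if w = u then 1 else 0) + 1 / R.len u v * (if w = v then 1 else 0))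
      s := fun w => by
    simp only [edgePoint_apply]
    have h := (hasDerivAt_id s).div_const (R.len u v)
    exact ((h.const_sub 1).mul_const _).add (h.mul_const _)
  have hθ : s / R.len u v ∈ Set.Ioo (0 : ℝ) 1 := ⟨div_pos hs.1 hpos, (div_lt_one hpos).2 hs.2⟩
  refine ⟨differentiableAt_pi.2 fun w => (hder w).differentiableAt, fun a b hab hsum => ?_⟩
  rw [(hder b).deriv]
  obtain ⟨rfl, rfl⟩ | ⟨rfl, rfl⟩ := eq_or_eq_of_edgePoint_add_eq_one hθ huv.ne hab.ne hsum
  · simp [huv.ne', abs_of_pos hpos, hpos.ne']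
  · simp [huv.ne, abs_of_pos hpos, hpos.ne', R.len_symm a b hab]

theorem exists_finset_slowAt_pathPoint (R : Roadmap n) :
    ∀ {p : List (Fin n)}, p.IsChain R.graph.Adj →
      ∃ B : Finset ℝ, ∀ s, 0 < s → s ∉ B → SlowAt R (pathPoint R p) s
  | [], _ => ⟨∅, fun s _ _ => slowAt_const R 0 s⟩
  | [v], _ => ⟨∅, fun s _ _ => slowAt_const R (vertexPoint v) s⟩
  | u :: v :: r, h => by
    have h' := List.isChain_cons_cons.1 h
    obtain ⟨B, hB⟩ := exists_finset_slowAt_pathPoint R h'.2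
    refine ⟨insert (R.len u v) (B.image (· + R.len u v)), fun s hs hsB => ?_⟩
    simp only [Finset.mem_insert, Finset.mem_image, not_or, not_exists, not_and] at hsB
    obtain hlt | hlt := lt_or_gt_of_ne hsB.1
    · refine (slowAt_edge R h'.1 ⟨hs, hlt⟩).congr ?_
      filter_upwards [Iio_mem_nhds hlt] with t ht
      rw [pathPoint, if_pos (le_of_lt ht)]
    · have hslow := hB (s - R.len u v) (by linarith) fun hm => hsB.2 _ hm (by ring)
      refine (hslow.comp (f := (· - R.len u v)) ((hasDerivAt_id s).sub_const _)
        (by simp)).congr ?_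
      filter_upwards [Ioi_mem_nhds hlt] with t ht
      rw [pathPoint, if_neg (not_le.2 ht)]

/-! ### The triangle wave -/

theorem triangleWave_nonneg (L t : ℝ) : 0 ≤ triangleWave L t := abs_nonneg _

theorem abs_sub_two_mul_mul {L : ℝ} (hL : 0 < L) (t k : ℝ) :
    |t - 2 * L * k| = 2 * L * |t / (2 * L) - k| := by
  rw [← abs_of_pos (show 0 < 2 * L by positivity), ← abs_mul,
    abs_of_pos (show 0 < 2 * L by positivity), mul_sub, mul_div_cancel₀ _ (by positivity)]

theorem triangleWave_le_abs {L : ℝ} (hL : 0 < L) (t : ℝ) (k : ℤ) :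
    triangleWave L t ≤ |t - 2 * L * k| := by
  rw [triangleWave, abs_sub_two_mul_mul hL, abs_sub_two_mul_mul hL]
  exact mul_le_mul_of_nonneg_left (round_le _ k) (by positivity)

theorem triangleWave_le {L : ℝ} (hL : 0 < L) (t : ℝ) : triangleWave L t ≤ L := by
  rw [triangleWave, abs_sub_two_mul_mul hL]
  nlinarith [abs_sub_round (t / (2 * L))]

theorem triangleWave_eq_abs {L : ℝ} (hL : 0 < L) {t : ℝ} {k : ℤ} (h : |t - 2 * L * k| ≤ L) :
    triangleWave L t = |t - 2 * L * k| := by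
  refine le_antisymm (triangleWave_le_abs hL t k) ?_
  obtain hk | hk := eq_or_ne (round (t / (2 * L))) k
  · rw [triangleWave, hk]
  · have hk1 : (1 : ℝ) ≤ |(k : ℝ) - round (t / (2 * L))| := by
      exact_mod_cast Int.one_le_abs (sub_ne_zero.2 hk.symm)
    have hfar : 2 * L ≤ triangleWave L t + |t - 2 * L * k| := by
      calc 2 * L ≤ 2 * L * |(k : ℝ) - round (t / (2 * L))| :=
            le_mul_of_one_le_right (by positivity) hk1
        _ = |(t - 2 * L * round (t / (2 * L))) - (t - 2 * L * k)| := by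
          rw [← abs_of_pos (show 0 < 2 * L by positivity), ← abs_mul,
            abs_of_pos (show 0 < 2 * L by positivity)]
          congr 1
          ring
        _ ≤ triangleWave L t + |t - 2 * L * k| := abs_sub _ _
    linarith

theorem continuous_triangleWave {L : ℝ} (hL : 0 < L) : Continuous (triangleWave L) := by
  refine LipschitzWith.continuous (K := 1) (LipschitzWith.of_le_add fun t t' => ?_)
  calc triangleWave L t ≤ |t - 2 * L * round (t' / (2 * L))| := triangleWave_le_abs hL t _
    _ ≤ |t - t'| + |t' - 2 * L * round (t' / (2 * L))| := abs_sub_le _ _ _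
    _ = triangleWave L t' + dist t t' := by rw [add_comm, Real.dist_eq, triangleWave]

theorem exists_hasDerivAt_triangleWave {L t : ℝ} (hL : 0 < L) (h0 : triangleWave L t ≠ 0)
    (h1 : triangleWave L t ≠ L) : ∃ f', HasDerivAt (triangleWave L) f' t ∧ |f'| ≤ 1 := by
  set c : ℝ := 2 * L * round (t / (2 * L))
  have hlt : |t - c| < L := (triangleWave_le hL t).lt_of_ne h1
  have hlocal : triangleWave L =ᶠ[nhds t] fun r => |r - c| := by
    filter_upwards [(show Continuous fun r : ℝ => |r - c| by fun_prop).continuousAt.eventually_lt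
      continuousAt_const hlt] with r hr
    exact triangleWave_eq_abs hL hr.le
  have hd : HasDerivAt (fun r : ℝ => r - c) 1 t := (hasDerivAt_id t).sub_const _
  obtain h | h := lt_or_gt_of_ne (abs_ne_zero.1 h0)
  · have hd' := HasDerivAt.comp (h₂ := abs) t (hasDerivAt_abs_neg h) hd
    exact ⟨_, hd'.congr_of_eventuallyEq hlocal, by simp⟩
  · have hd' := HasDerivAt.comp (h₂ := abs) t (hasDerivAt_abs_pos h) hd
    exact ⟨_, hd'.congr_of_eventuallyEq hlocal, by simp⟩

theorem finite_triangleWave_mem {L : ℝ} (hL : 0 < L) (T : ℝ) (B : Finset ℝ) :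
    {t ∈ Set.Ioo 0 T | triangleWave L t ∈ B}.Finite := by
  have hround : ∀ t ∈ Set.Ioo 0 T,
      round (t / (2 * L)) ∈ Set.Icc (round (0 : ℝ)) (round (T / (2 * L))) := fun t ht => by
    have hmono : Monotone (round : ℝ → ℤ) := fun x y hxy => by
      rw [round_eq, round_eq]
      gcongr
    exact ⟨hmono (div_nonneg ht.1.le (by positivity)), hmono (by gcongr; exact ht.2.le)⟩
  refine ((Set.finite_Icc (round (0 : ℝ)) (round (T / (2 * L)))).image2
    (fun (k : ℤ) b => 2 * L * k + b) (B.finite_toSet.preimage' (f := abs) fun b _ => ?_)).subset ?_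
  · exact (Set.toFinite {b, -b}).subset fun x hx => eq_or_eq_neg_of_abs_eq hx
  · rintro t ⟨ht, hB⟩
    exact ⟨_, hround t ht, t - 2 * L * round (t / (2 * L)), hB, by ring⟩

theorem exists_triangleWave_eq {L s : ℝ} (hL : 0 < L) (hs : s ∈ Set.Icc 0 L) {t₁ t₂ : ℝ}
    (h : 2 * L < t₂ - t₁) : ∃ t ∈ Set.Ioo t₁ t₂, triangleWave L t = s := by
  set k : ℤ := ⌊(t₁ - s) / (2 * L)⌋
  have hk : (k : ℝ) * (2 * L) ≤ t₁ - s := (le_div_iff₀ (by positivity)).1 (Int.floor_le _)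
  have hk' : t₁ - s < (k + 1) * (2 * L) :=
    (div_lt_iff₀ (by positivity)).1 (Int.lt_floor_add_one _)
  have habs : |2 * L * ((k + 1 : ℤ) : ℝ) + s - 2 * L * ((k + 1 : ℤ) : ℝ)| = s := by
    rw [add_sub_cancel_left, abs_of_nonneg hs.1]
  refine ⟨2 * L * ((k + 1 : ℤ) : ℝ) + s, ⟨?_, ?_⟩, ?_⟩
  · push_cast
    linarith
  · push_cast
    linarith
  · rw [triangleWave_eq_abs hL (habs.trans_le hs.2), habs]

/-! ### The refresh time of sweeping -/

theorem isTeamTrajectory_sweep {R : Roadmap n} {p : Fin m → List (Fin n)}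
    (hp : ∀ i, IsPath R (p i)) (T : ℝ) : IsTeamTrajectory R T (sweep R p) := by
  intro i
  refine ⟨fun t _ => pathPoint_mem_carrier R (hp i) (triangleWave_nonneg _ _), ?_⟩
  obtain ⟨v, hv⟩ | hL := (hp i).eq_singleton_or_cost_pos
  · have hrest : sweep R p i = fun _ => vertexPoint v := by
      funext t
      simp only [sweep, hv, pathPoint]
    rw [hrest]
    exact ⟨continuousOn_const, ∅, fun t _ _ => slowAt_const R (vertexPoint v) t⟩
  · refine ⟨((continuous_pathPoint R (hp i).2).comp (continuous_triangleWave hL)).continuousOn, ?_⟩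
    obtain ⟨B, hB⟩ := exists_finset_slowAt_pathPoint R (hp i).2
    have hfin := finite_triangleWave_mem hL T (insert 0 (insert (pathCost R (p i)) B))
    refine ⟨hfin.toFinset, fun t ht htE => ?_⟩
    simp only [Set.Finite.mem_toFinset, Set.mem_ofPred_eq, ht, true_and, Finset.mem_insert,
      not_or] at htE
    obtain ⟨h0, hcost, htB⟩ := htE
    obtain ⟨f', hf, hf'⟩ := exists_hasDerivAt_triangleWave hL h0 hcost
    exact (hB _ ((triangleWave_nonneg _ _).lt_of_ne' h0) htB).comp hf hf'

theorem refreshTime_sweep_le {R : Roadmap n} {p : Fin m → List (Fin n)} (hp : IsPathCover R p)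
    (T : ℝ) : refreshTime T (sweep R p) ≤ 2 * coverCost R p := by
  have hnonneg : 0 ≤ coverCost R p := Real.iSup_nonneg fun i => pathCost_nonneg R (hp.1 i).2
  refine refreshTime_le (by positivity) fun v t₁ t₂ _ _ _ hfree => ?_
  obtain ⟨i, hi⟩ := hp.2 v
  by_contra! hlt
  have hlt' : 2 * pathCost R (p i) < t₂ - t₁ := by linarith [le_coverCost R p i]
  obtain ⟨w, hw⟩ | hL := (hp.1 i).eq_singleton_or_cost_pos
  · obtain rfl : v = w := by simpa [hw] using hi
    exact hfree i ((t₁ + t₂) / 2) (by linarith) (by linarith) (by simp only [sweep, hw, pathPoint])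
  · obtain ⟨s, hs, hsv⟩ := exists_pathPoint_eq_vertexPoint R (hp.1 i).2 hi
    obtain ⟨t, ht, hts⟩ := exists_triangleWave_eq hL hs hlt'
    exact hfree i t ht.1 ht.2 (by simp only [sweep, hts, hsv])

theorem refreshTime_sweep_le_mul {R : Roadmap n} {p : Fin m → List (Fin n)} (hm : 0 < m)
    (hp : IsPathCover R p) {c : ℝ} (hc : 1 ≤ c)
    (happrox : ∀ p' : Fin m → List (Fin n), IsPathCover R p' → coverCost R p ≤ c * coverCost R p')
    {T : ℝ} (hT : 0 ≤ T) {Y : Fin m → ℝ → Fin n → ℝ} (hY : IsTeamTrajectory R T Y) :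
    refreshTime T (sweep R p) ≤ 2 * c * refreshTime T Y := by
  obtain ⟨v⟩ := R.connected.nonempty
  have hY0 := refreshTime_nonneg hT v Y
  rw [← div_le_iff₀' (by positivity)]
  refine le_of_forall_gt_imp_ge_of_dense fun τ hτ => ?_
  rw [div_le_iff₀' (by positivity)]
  obtain hτT | hτT := le_total τ T
  · obtain ⟨p', hp', hcost⟩ := exists_isPathCover_of_refreshTime_lt hm hY (hY0.trans hτ.le) hτ hτT
    calc refreshTime T (sweep R p) ≤ 2 * coverCost R p := refreshTime_sweep_le hp T
      _ ≤ 2 * (c * coverCost R p') := by gcongr; exact happrox p' hp'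
      _ ≤ 2 * (c * τ) := by gcongr
      _ = 2 * c * τ := by ring
  · have hsweep : refreshTime T (sweep R p) ≤ T :=
      refreshTime_le hT fun v t₁ t₂ h0 _ hT' _ => by linarith
    nlinarith

/-! ### Components and Kruskal's algorithm -/

section Glue

variable {α : Type*} {σ τ : Setoid α} {a b x y : α} {H H' : List (α × α)}

/-- The equivalence relation generated by `σ` and the pair `(x, y)`. -/
def glue (σ : Setoid α) (x y : α) : Setoid α where
  r u v := σ u v ∨ (σ u x ∧ σ y v) ∨ (σ u y ∧ σ x v)
  iseqv :=
    { refl u := Or.inl (σ.refl u)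
      symm h := by
        rcases h with h | ⟨h, h'⟩ | ⟨h, h'⟩
        exacts [Or.inl (σ.symm h), Or.inr (Or.inr ⟨σ.symm h', σ.symm h⟩),
          Or.inr (Or.inl ⟨σ.symm h', σ.symm h⟩)]
      trans h h' := by
        rcases h with h | ⟨h₁, h₂⟩ | ⟨h₁, h₂⟩ <;> rcases h' with k | ⟨k₁, k₂⟩ | ⟨k₁, k₂⟩
        exacts [Or.inl (σ.trans h k), Or.inr (Or.inl ⟨σ.trans h k₁, k₂⟩),
          Or.inr (Or.inr ⟨σ.trans h k₁, k₂⟩), Or.inr (Or.inl ⟨h₁, σ.trans h₂ k⟩),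
          Or.inr (Or.inl ⟨h₁, k₂⟩), Or.inl (σ.trans h₁ k₂),
          Or.inr (Or.inr ⟨h₁, σ.trans h₂ k⟩), Or.inl (σ.trans h₁ k₂), Or.inr (Or.inr ⟨h₁, k₂⟩)] }

theorem glue_apply {u v : α} :
    glue σ x y u v ↔ σ u v ∨ (σ u x ∧ σ y v) ∨ (σ u y ∧ σ x v) :=
  Iff.rfl

theorem le_glue (σ : Setoid α) (x y : α) : σ ≤ glue σ x y := fun _ _ => Or.inl

theorem glue_self (σ : Setoid α) (x y : α) : glue σ x y x y :=
  Or.inr (Or.inl ⟨σ.refl x, σ.refl y⟩)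

theorem glue_le_iff : glue σ x y ≤ τ ↔ σ ≤ τ ∧ τ x y := by
  refine ⟨fun h => ⟨(le_glue σ x y).trans h, h (glue_self σ x y)⟩, fun ⟨h, hxy⟩ u v huv => ?_⟩
  rcases huv with huv | ⟨hu, hv⟩ | ⟨hu, hv⟩
  exacts [h huv, τ.trans (τ.trans (h hu) hxy) (h hv), τ.trans (τ.trans (h hu) (τ.symm hxy)) (h hv)]

/-- The equivalence relation generated by `σ` and the pairs in `H`: when the classes of `σ` are the
components of a graph, the components after the edges `H` have been added. -/
def glueAll (σ : Setoid α) (H : List (α × α)) : Setoid α :=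
  H.foldr (fun e τ => glue τ e.1 e.2) σ

theorem glueAll_cons (σ : Setoid α) (e : α × α) (H : List (α × α)) :
    glueAll σ (e :: H) = glue (glueAll σ H) e.1 e.2 :=
  rfl

theorem glueAll_le_iff : glueAll σ H ≤ τ ↔ σ ≤ τ ∧ ∀ e ∈ H, τ e.1 e.2 := by
  induction H with
  | nil => simp [glueAll]
  | cons e H ih => rw [glueAll_cons, glue_le_iff, ih, List.forall_mem_cons]; tauto

theorem le_glueAll (σ : Setoid α) (H : List (α × α)) : σ ≤ glueAll σ H :=
  (glueAll_le_iff.1 le_rfl).1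

theorem glueAll_of_mem (σ : Setoid α) {e : α × α} (he : e ∈ H) : glueAll σ H e.1 e.2 :=
  (glueAll_le_iff.1 le_rfl).2 e he

theorem glueAll_mono (hσ : σ ≤ τ) (hH : H ⊆ H') : glueAll σ H ≤ glueAll τ H' :=
  glueAll_le_iff.2 ⟨hσ.trans (le_glueAll τ H'), fun _ he => glueAll_of_mem τ (hH he)⟩

theorem glue_le_glue_of_glue (hab : ¬ σ a b) (h : glue σ x y a b) :
    glue σ x y ≤ glue σ a b := by
  refine glue_le_iff.2 ⟨le_glue σ a b, ?_⟩
  rcases h.resolve_left hab with ⟨h, h'⟩ | ⟨h, h'⟩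
  exacts [Or.inr (Or.inl ⟨σ.symm h, σ.symm h'⟩), Or.inr (Or.inr ⟨h', h⟩)]

theorem exists_perm_cons_glueAll_le (hab : ¬ σ a b) (h : glueAll σ H a b) :
    ∃ e H', H.Perm (e :: H') ∧ ¬ σ e.1 e.2 ∧ glueAll σ H ≤ glueAll (glue σ a b) H' := by
  induction H with
  | nil => exact absurd h hab
  | cons e H ih =>
    by_cases hH : glueAll σ H a b
    · obtain ⟨e', H', hperm, he', hle⟩ := ih hH
      refine ⟨e', e :: H', (hperm.cons e).trans (.swap e' e H'), he', glue_le_iff.2 ⟨?_, ?_⟩⟩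
      · exact hle.trans (le_glue _ _ _)
      · exact glue_self _ _ _
    · refine ⟨e, H, .refl _, fun he => hH ?_, (glue_le_glue_of_glue hH h).trans ?_⟩
      · exact glue_le_iff.2 ⟨le_rfl, le_glueAll σ H he⟩ h
      · exact glue_le_iff.2 ⟨glueAll_mono (le_glue σ a b) (List.Subset.refl H),
          le_glueAll _ H (glue_self σ a b)⟩

/-- The components generated by `σ` and `H` that meet `S` are represented by elements of `reps`. -/
def Spans (σ : Setoid α) (H : List (α × α)) (reps : Finset α) (S : Set α) : Prop :=
  ∀ v ∈ S, ∃ r ∈ reps, glueAll σ H v r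

theorem Spans.mono {reps : Finset α} {S : Set α} (h : Spans σ H reps S)
    (hle : glueAll σ H ≤ glueAll τ H') : Spans τ H' reps S :=
  fun v hv => (h v hv).imp fun _ hr => ⟨hr.1, hle hr.2⟩

theorem Spans.erase [DecidableEq α] {reps : Finset α} {S : Set α} (h : Spans σ H reps S)
    (hx : x ∈ reps) (hxy : x ≠ y) (hle : glueAll σ H ≤ τ) (hτ : τ x y) :
    ∀ v ∈ S, ∃ r ∈ reps.erase y, τ v r := by
  intro v hv
  obtain ⟨r, hr, hvr⟩ := h v hv
  obtain rfl | hry := eq_or_ne r y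
  · exact ⟨x, Finset.mem_erase.2 ⟨hxy, hx⟩, τ.trans (hle hvr) (τ.symm hτ)⟩
  · exact ⟨r, Finset.mem_erase.2 ⟨hry, hr⟩, hle hvr⟩

/-- Adding an edge `ab` that is no longer than the edges of `H` between different classes makes an
edge of `H` superfluous, or else a representative. -/
theorem Spans.exists_glue {reps : Finset α} {S : Set α} {w : α × α → ℝ} {c : ℝ}
    (h : Spans σ H reps S) (ha : a ∈ S) (hb : b ∈ S) (hab : ¬ σ a b) (hc : w (a, b) ≤ c)
    (hw : ∀ e ∈ H, ¬ σ e.1 e.2 → w (a, b) ≤ w e) :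
    ∃ H' ⊆ H, ∃ reps', Spans (glue σ a b) H' reps' S ∧
      w (a, b) + (H'.map w).sum + reps'.card * c ≤ (H.map w).sum + reps.card * c := by
  classical
  have hmono : glueAll σ H ≤ glueAll (glue σ a b) H :=
    glueAll_mono (le_glue σ a b) (List.Subset.refl H)
  by_cases hHab : glueAll σ H a b
  · obtain ⟨e, H', hperm, he, hle⟩ := exists_perm_cons_glueAll_le hab hHab
    refine ⟨H', fun e' he' => hperm.mem_iff.2 (List.mem_cons_of_mem e he'), reps, h.mono hle, ?_⟩
    rw [(hperm.map w).sum_eq, List.map_cons, List.sum_cons]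
    linarith [hw e (hperm.mem_iff.2 List.mem_cons_self) he]
  · obtain ⟨r, hr, har⟩ := h a ha
    obtain ⟨r', hr', hbr⟩ := h b hb
    have hrr : r ≠ r' := by
      rintro rfl
      exact hHab ((glueAll σ H).trans har ((glueAll σ H).symm hbr))
    let τ := glueAll (glue σ a b) H
    have hτ : τ r r' := τ.trans (τ.symm (hmono har))
      (τ.trans (le_glueAll _ H (glue_self σ a b)) (hmono hbr))
    refine ⟨H, List.Subset.refl H, reps.erase r', h.erase hr hrr hmono hτ, ?_⟩
    rw [Finset.cast_card_erase_of_mem hr']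
    linarith

/-- Merge the label of `b` into that of `a`. -/
def mergeLabel [DecidableEq α] (comp : α → α) (a b : α) : α → α :=
  fun v => if comp v = comp b then comp a else comp v

theorem ker_mergeLabel [DecidableEq α] (comp : α → α) (a b : α) :
    Setoid.ker (mergeLabel comp a b) = glue (Setoid.ker comp) a b := by
  ext u v
  simp only [glue_apply, Setoid.ker_def, mergeLabel]
  grind

theorem mergeLabel_idem [DecidableEq α] {comp : α → α} (h : ∀ v, comp (comp v) = comp v)
    (a b v : α) : mergeLabel comp a b (mergeLabel comp a b v) = mergeLabel comp a b v := by
  grind [mergeLabel]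

end Glue

/-- The states of a greedy forest construction that always adds a shortest edge between different
components: `F` lists the edges, and `comp` maps each vertex to the root of its component. -/
inductive Kruskal (R : Roadmap n) : List (Fin n × Fin n) → (Fin n → Fin n) → Prop
  | nil : Kruskal R [] id
  | cons {F : List (Fin n × Fin n)} {comp : Fin n → Fin n} {a b : Fin n} :
      Kruskal R F comp → R.graph.Adj a b → comp a ≠ comp b →
      (∀ u v, R.graph.Adj u v → comp u ≠ comp v → R.len a b ≤ R.len u v) →
      Kruskal R ((a, b) :: F) (mergeLabel comp a b)

namespace Kruskal

variable {R : Roadmap n} {F : List (Fin n × Fin n)} {comp : Fin n → Fin n}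

theorem comp_comp (h : Kruskal R F comp) (v : Fin n) : comp (comp v) = comp v := by
  induction h generalizing v with
  | nil => rfl
  | cons _ _ _ _ ih => exact mergeLabel_idem ih _ _ v

theorem adj_of_mem (h : Kruskal R F comp) : ∀ e ∈ F, R.graph.Adj e.1 e.2 := by
  induction h with
  | nil => simp
  | cons _ hadj _ _ ih => exact List.forall_mem_cons.2 ⟨hadj, ih⟩

theorem comp_eq_of_mem (h : Kruskal R F comp) : ∀ e ∈ F, comp e.1 = comp e.2 := by
  induction h with
  | nil => simp
  | cons => grind [mergeLabel]

theorem card_image_add_length_le (h : Kruskal R F comp) :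
    (Finset.univ.image comp).card + F.length ≤ n := by
  induction h with
  | nil => simp
  | @cons F comp a b _ _ hne _ ih =>
    have hsub : Finset.univ.image (mergeLabel comp a b) ⊆
        (Finset.univ.image comp).erase (comp b) := by
      intro c hc
      obtain ⟨v, -, rfl⟩ := Finset.mem_image.1 hc
      simp only [mergeLabel]
      split_ifs with hv <;> simp [*]
    have hcard := Finset.card_le_card hsub
    have hpos : 0 < (Finset.univ.image comp).card := Finset.card_pos.2 ⟨comp a, by simp⟩
    rw [Finset.card_erase_of_mem (by simp)] at hcard
    rw [List.length_cons]
    omega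

theorem length_lt (h : Kruskal R F comp) (hn : 0 < n) : F.length < n := by
  have hpos : 0 < (Finset.univ.image comp).card := Finset.card_pos.2 ⟨comp ⟨0, hn⟩, by simp⟩
  have := h.card_image_add_length_le
  omega

end Kruskal

section PathEdges

variable {R : Roadmap n} {p : Fin m → List (Fin n)}

theorem adj_of_mem_zip_tail : ∀ {p : List (Fin n)}, p.IsChain R.graph.Adj →
    ∀ e ∈ p.zip p.tail, R.graph.Adj e.1 e.2
  | [], _, _, he | [_], _, _, he => by simp at he
  | u :: v :: p, h, e, he => by
    obtain ⟨huv, h⟩ := List.isChain_cons_cons.1 h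
    obtain rfl | he := List.mem_cons.1 he
    exacts [huv, adj_of_mem_zip_tail h e he]

theorem sum_len_zip_tail (R : Roadmap n) : ∀ p : List (Fin n),
    ((p.zip p.tail).map fun e => R.len e.1 e.2).sum = pathCost R p
  | [] | [_] => rfl
  | u :: v :: p => by
    rw [pathCost, ← sum_len_zip_tail R (v :: p)]
    rfl

theorem glueAll_zip_tail (σ : Setoid (Fin n)) : ∀ (p : List (Fin n)) (h : p ≠ []),
    ∀ v ∈ p, glueAll σ (p.zip p.tail) v (p.head h)
  | [u], _, v, hv => by rw [List.mem_singleton.1 hv]; exact (glueAll σ _).refl _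
  | u :: x :: p, _, v, hv => by
    obtain rfl | hv := List.mem_cons.1 hv
    · exact (glueAll σ _).refl _
    · exact (glueAll σ _).trans (le_glue _ _ _ (glueAll_zip_tail σ (x :: p) (by simp) v hv))
        ((glueAll σ _).symm (glue_self _ u x))

theorem exists_spans_of_paths (σ : Setoid (Fin n)) (hp : ∀ i, IsPath R (p i)) {c : ℝ}
    (hc : ∀ i, pathCost R (p i) ≤ c) (I : Finset (Fin m)) :
    ∃ (H : List (Fin n × Fin n)) (reps : Finset (Fin n)), (∀ e ∈ H, R.graph.Adj e.1 e.2) ∧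
      Spans σ H reps {v | ∃ i ∈ I, v ∈ p i} ∧
      (H.map fun e => R.len e.1 e.2).sum ≤ I.card * c ∧ reps.card ≤ I.card := by
  let edges i := (p i).zip (p i).tail
  refine ⟨I.toList.flatMap edges, I.image fun i => (p i).head (hp i).1, ?_, ?_, ?_,
    Finset.card_image_le⟩
  · intro e he
    obtain ⟨i, -, he⟩ := List.mem_flatMap.1 he
    exact adj_of_mem_zip_tail (hp i).2 e he
  · rintro v ⟨i, hi, hv⟩
    refine ⟨_, Finset.mem_image_of_mem _ hi, glueAll_mono le_rfl ?_ (glueAll_zip_tail σ _ _ v hv)⟩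
    exact fun e he => List.mem_flatMap.2 ⟨i, Finset.mem_toList.2 hi, he⟩
  · have hsum : ((I.toList.flatMap edges).map fun e => R.len e.1 e.2).sum =
        ∑ i ∈ I, pathCost R (p i) := by
      simp only [← sum_len_zip_tail R, List.flatMap, List.map_flatten, List.sum_flatten,
        List.map_map, ← Finset.sum_map_toList]
      rfl
    rw [hsum, ← nsmul_eq_mul]
    exact Finset.sum_le_card_nsmul _ _ _ fun i _ => hc i

theorem mem_iff_of_path {c : ℝ} {S : Set (Fin n)}
    (hS : ∀ u v, R.graph.Adj u v → R.len u v ≤ c → (u ∈ S ↔ v ∈ S)) :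
    ∀ {u : Fin n} {l : List (Fin n)}, (u :: l).IsChain R.graph.Adj → pathCost R (u :: l) ≤ c →
      ∀ v ∈ u :: l, (v ∈ S ↔ u ∈ S)
  | u, [], _, _, v, hv => by rw [List.mem_singleton.1 hv]
  | u, x :: l, h, hc, v, hv => by
    obtain ⟨hux, h⟩ := List.isChain_cons_cons.1 h
    rw [pathCost] at hc
    obtain rfl | hv := List.mem_cons.1 hv
    · rfl
    · rw [mem_iff_of_path hS h (by linarith [R.len_pos _ _ hux]) v hv]
      exact (hS u x hux (by linarith [pathCost_nonneg R h])).symm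

end PathEdges

open Classical in
/-- The total length of the edges of `F` that start in `S`. -/
noncomputable def weightIn (R : Roadmap n) (S : Set (Fin n)) (F : List (Fin n × Fin n)) : ℝ :=
  (F.map fun e => if e.1 ∈ S then R.len e.1 e.2 else 0).sum

namespace Kruskal

variable {R : Roadmap n} {F : List (Fin n × Fin n)} {comp : Fin n → Fin n}
  {p : Fin m → List (Fin n)} {c : ℝ}

/-- The potential in the last line starts at most at `2 * I.card * c`, and no step of the
construction increases it. -/
theorem exists_spans (h : Kruskal R F comp) (hF : ∀ e ∈ F, R.len e.1 e.2 ≤ c)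
    (hp : IsPathCover R p) (hc : ∀ i, pathCost R (p i) ≤ c) {S : Set (Fin n)}
    (hS : ∀ u v, R.graph.Adj u v → R.len u v ≤ c → (u ∈ S ↔ v ∈ S))
    {I : Finset (Fin m)} (hI : ∀ i, ∀ v ∈ p i, v ∈ S → i ∈ I) :
    ∃ (H : List (Fin n × Fin n)) (reps : Finset (Fin n)), (∀ e ∈ H, R.graph.Adj e.1 e.2) ∧
      Spans (Setoid.ker comp) H reps S ∧
      weightIn R S F + (H.map fun e => R.len e.1 e.2).sum + reps.card * c ≤ 2 * I.card * c := by
  induction h with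
  | nil =>
    obtain ⟨H, reps, hadj, hspan, hsum, hcard⟩ := exists_spans_of_paths (Setoid.ker id) hp.1 hc I
    refine ⟨H, reps, hadj, fun v hv => ?_, ?_⟩
    · obtain ⟨i, hi⟩ := hp.2 v
      exact hspan v ⟨i, hI i v hi hv, hi⟩
    · have hreps : reps.card * c ≤ I.card * c := by
        obtain rfl | ⟨i, -⟩ := I.eq_empty_or_nonempty
        · simp_all
        · have := (pathCost_nonneg R (hp.1 i).2).trans (hc i)
          gcongr
      simp only [weightIn, List.map_nil, List.sum_nil]
      linarith
  | @cons F comp a b _ hadj hne hmin ih =>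
    obtain ⟨hab, hF⟩ := List.forall_mem_cons.1 hF
    obtain ⟨H, reps, hH, hspan, hsum⟩ := ih hF
    rw [ker_mergeLabel]
    simp only [weightIn, List.map_cons, List.sum_cons]
    by_cases ha : a ∈ S
    · obtain ⟨H', hsub, reps', hspan', hle⟩ := hspan.exists_glue (w := fun e => R.len e.1 e.2)
        ha ((hS a b hadj hab).1 ha) hne hab fun e he hne => hmin _ _ (hH e he) hne
      refine ⟨H', reps', fun e he => hH e (hsub he), hspan', ?_⟩
      rw [if_pos ha]
      rw [weightIn] at hsum
      linarith
    · refine ⟨H, reps, hH, hspan.mono (glueAll_mono (le_glue _ a b) (List.Subset.refl H)), ?_⟩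
      rwa [if_neg ha, zero_add]

theorem weightIn_add_le (h : Kruskal R F comp) (hF : ∀ e ∈ F, R.len e.1 e.2 ≤ c)
    (hcross : ∀ u v, R.graph.Adj u v → comp u ≠ comp v → c < R.len u v)
    (hp : IsPathCover R p) (hc : ∀ i, pathCost R (p i) ≤ c) (r : Fin n) :
    weightIn R {v | comp v = comp r} F + c ≤
      2 * (Finset.univ.filter fun i => comp ((p i).head (hp.1 i).1) = comp r).card * c := by
  have hS : ∀ u v, R.graph.Adj u v → R.len u v ≤ c →
      (u ∈ {v | comp v = comp r} ↔ v ∈ {v | comp v = comp r}) := by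
    intro u v huv hle
    have : comp u = comp v := by
      by_contra hne
      exact (hcross u v huv hne).not_ge hle
    rw [Set.mem_ofPred_eq, Set.mem_ofPred_eq, this]
  have hI : ∀ i, ∀ v ∈ p i, v ∈ {v | comp v = comp r} →
      i ∈ Finset.univ.filter fun i => comp ((p i).head (hp.1 i).1) = comp r := by
    intro i v hv hvr
    have hcons := List.cons_head_tail (hp.1 i).1
    exact Finset.mem_filter.2 ⟨Finset.mem_univ i, (mem_iff_of_path hS
      (hcons.symm ▸ (hp.1 i).2) (hcons.symm ▸ hc i) v (hcons.symm ▸ hv)).1 hvr⟩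
  obtain ⟨H, reps, hadj, hspan, hsum⟩ := h.exists_spans hF hp hc hS hI
  obtain ⟨x, hx, -⟩ := hspan r rfl
  obtain ⟨i, -⟩ := hp.2 r
  have hc0 : 0 ≤ c := (pathCost_nonneg R (hp.1 i).2).trans (hc i)
  have hreps : (1 : ℝ) ≤ reps.card := by exact_mod_cast Finset.card_pos.2 ⟨x, hx⟩
  have hH : 0 ≤ (H.map fun e => R.len e.1 e.2).sum :=
    List.sum_nonneg (List.forall_mem_map.2 fun e he => (R.len_pos _ _ (hadj e he)).le)
  nlinarith

end Kruskal

/-! ### Running programs -/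

/-- A bound for the running time of a program in which every loop is run through at most `X`
times. -/
noncomputable def Prog.costPoly : Prog → Polynomial ℕ
  | skip => 1
  | seti _ i j e => (i.cost + j.cost + e.cost + 1 : ℕ)
  | setd _ i j e => (i.cost + j.cost + e.cost + 1 : ℕ)
  | seq P Q => P.costPoly + Q.costPoly
  | ite b P Q => (b.cost : Polynomial ℕ) + (P.costPoly + Q.costPoly)
  | loop b P => (Polynomial.X + 1) * ((b.cost : Polynomial ℕ) + P.costPoly)

/-- The natural number arrays that a program may change. -/
def Prog.iwrites : Prog → List ℕ
  | skip => []
  | seti a _ _ _ => [a]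
  | setd _ _ _ _ => []
  | seq P Q => P.iwrites ++ Q.iwrites
  | ite _ P Q => P.iwrites ++ Q.iwrites
  | loop _ P => P.iwrites

/-- The real arrays that a program may change. -/
def Prog.dwrites : Prog → List ℕ
  | skip => []
  | seti _ _ _ _ => []
  | setd a _ _ _ => [a]
  | seq P Q => P.dwrites ++ Q.dwrites
  | ite _ P Q => P.dwrites ++ Q.dwrites
  | loop _ P => P.dwrites

theorem Exec.idx_eq {P : Prog} {s s' : Store} {c a : ℕ} (h : Exec P s s' c)
    (ha : a ∉ P.iwrites) : s'.idx a = s.idx a := by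
  induction h with
  | seti => funext i j; simp_all [Prog.iwrites, setCell]
  | skip | setd | loop_done => rfl
  | loop_step _ _ _ ih ih' => exact (ih' ha).trans (ih ha)
  | _ => simp_all [Prog.iwrites]

theorem Exec.dat_eq {P : Prog} {s s' : Store} {c a : ℕ} (h : Exec P s s' c)
    (ha : a ∉ P.dwrites) : s'.dat a = s.dat a := by
  induction h with
  | setd => funext i j; simp_all [Prog.dwrites, setCell]
  | skip | seti | loop_done => rfl
  | loop_step _ _ _ ih ih' => exact (ih' ha).trans (ih ha)
  | _ => simp_all [Prog.dwrites]

/-- Overwrite one natural number in memory. -/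
def Store.seti (s : Store) (a i j x : ℕ) : Store := ⟨setCell s.idx a i j x, s.dat⟩

/-- Overwrite one real number in memory. -/
def Store.setd (s : Store) (a i j : ℕ) (x : ℝ) : Store := ⟨s.idx, setCell s.dat a i j x⟩

@[simp, grind =]
theorem Store.idx_seti (s : Store) (a i j x b i' j' : ℕ) :
    (s.seti a i j x).idx b i' j' = if b = a ∧ i' = i ∧ j' = j then x else s.idx b i' j' :=
  rfl

@[simp, grind =]
theorem Store.dat_setd (s : Store) (a i j : ℕ) (x : ℝ) (b i' j' : ℕ) :
    (s.setd a i j x).dat b i' j' = if b = a ∧ i' = i ∧ j' = j then x else s.dat b i' j' :=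
  rfl

@[simp, grind =]
theorem Store.dat_seti (s : Store) (a i j x : ℕ) : (s.seti a i j x).dat = s.dat := rfl

@[simp, grind =]
theorem Store.idx_setd (s : Store) (a i j : ℕ) (x : ℝ) : (s.setd a i j x).idx = s.idx := rfl

theorem Store.idx_seti_of_ne (s : Store) {a b : ℕ} (h : b ≠ a) (i j x : ℕ) :
    (s.seti a i j x).idx b = s.idx b := by
  funext k l; simp [h]

theorem Store.dat_setd_of_ne (s : Store) {a b : ℕ} (h : b ≠ a) (i j : ℕ) (x : ℝ) :
    (s.setd a i j x).dat b = s.dat b := by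
  funext k l; simp [h]

/-- Started in `s`, the program `P` halts in a state that satisfies `Q`, within the time that is
due if every loop is run through at most `N` times. -/
def Runs (N : ℕ) (P : Prog) (s : Store) (Q : Store → Prop) : Prop :=
  ∃ s' c, Exec P s s' c ∧ c ≤ P.costPoly.eval N ∧ Q s'

section Runs

variable {N : ℕ} {P P' : Prog} {s : Store} {Q Q' : Store → Prop}

theorem Runs.mono (h : Runs N P s Q) (hQ : ∀ s', Q s' → Q' s') : Runs N P s Q' :=
  let ⟨s', c, hexec, hc, hs'⟩ := h
  ⟨s', c, hexec, hc, hQ s' hs'⟩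

theorem Runs.frame (h : Runs N P s Q) :
    Runs N P s fun s' => Q s' ∧ (∀ a ∉ P.iwrites, s'.idx a = s.idx a) ∧
      ∀ a ∉ P.dwrites, s'.dat a = s.dat a :=
  let ⟨s', c, hexec, hc, hs'⟩ := h
  ⟨s', c, hexec, hc, hs', fun _ => hexec.idx_eq, fun _ => hexec.dat_eq⟩

@[simp]
theorem runs_skip : Runs N .skip s Q ↔ Q s := by
  refine ⟨?_, fun h => ⟨s, 1, .skip s, by simp [Prog.costPoly], h⟩⟩
  rintro ⟨s', c, ⟨⟩, -, h⟩
  exact h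

@[simp]
theorem runs_seti {a : ℕ} {i j e : IExp} :
    Runs N (.seti a i j e) s Q ↔ Q (s.seti a (i.eval s) (j.eval s) (e.eval s)) := by
  refine ⟨?_, fun h => ⟨_, _, .seti a i j e s, by simp [Prog.costPoly], h⟩⟩
  rintro ⟨s', c, ⟨⟩, -, h⟩
  exact h

@[simp]
theorem runs_setd {a : ℕ} {i j : IExp} {e : DExp} :
    Runs N (.setd a i j e) s Q ↔ Q (s.setd a (i.eval s) (j.eval s) (e.eval s)) := by
  refine ⟨?_, fun h => ⟨_, _, .setd a i j e s, by simp [Prog.costPoly], h⟩⟩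
  rintro ⟨s', c, ⟨⟩, -, h⟩
  exact h

theorem Runs.seq (h : Runs N P s fun s' => Runs N P' s' Q) : Runs N (.seq P P') s Q := by
  obtain ⟨s', c, hP, hc, s'', d, hP', hd, hs''⟩ := h
  exact ⟨s'', c + d, .seq hP hP', by simp only [Prog.costPoly, Polynomial.eval_add]; omega, hs''⟩

@[simp]
theorem runs_seti_seq {a : ℕ} {i j e : IExp} :
    Runs N (.seq (.seti a i j e) P) s Q ↔
      Runs N P (s.seti a (i.eval s) (j.eval s) (e.eval s)) Q := by
  refine ⟨?_, fun h => Runs.seq (runs_seti.2 h)⟩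
  rintro ⟨s', c, hexec, hc, h⟩
  obtain _ | _ | _ | ⟨⟨⟩, hP⟩ := hexec
  simp only [Prog.costPoly, Polynomial.eval_add, Polynomial.eval_natCast, Nat.cast_id] at hc
  exact ⟨s', _, hP, by omega, h⟩

@[simp]
theorem runs_setd_seq {a : ℕ} {i j : IExp} {e : DExp} :
    Runs N (.seq (.setd a i j e) P) s Q ↔
      Runs N P (s.setd a (i.eval s) (j.eval s) (e.eval s)) Q := by
  refine ⟨?_, fun h => Runs.seq (runs_setd.2 h)⟩
  rintro ⟨s', c, hexec, hc, h⟩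
  obtain _ | _ | _ | ⟨⟨⟩, hP⟩ := hexec
  simp only [Prog.costPoly, Polynomial.eval_add, Polynomial.eval_natCast, Nat.cast_id] at hc
  exact ⟨s', _, hP, by omega, h⟩

theorem Runs.ite {b : Test} (h : b.holds s → Runs N P s Q) (h' : ¬ b.holds s → Runs N P' s Q) :
    Runs N (.ite b P P') s Q := by
  by_cases hb : b.holds s
  · obtain ⟨s', c, hexec, hc, hs'⟩ := h hb
    refine ⟨s', _, .ite_true hb hexec, ?_, hs'⟩
    simp only [Prog.costPoly, Polynomial.eval_add, Polynomial.eval_natCast, Nat.cast_id]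
    omega
  · obtain ⟨s', c, hexec, hc, hs'⟩ := h' hb
    refine ⟨s', _, .ite_false hb hexec, ?_, hs'⟩
    simp only [Prog.costPoly, Polynomial.eval_add, Polynomial.eval_natCast, Nat.cast_id]
    omega

theorem exec_loop_le {b : Test} (I : ℕ → Store → Prop)
    (hstep : ∀ k s, I k s → b.holds s → 0 < k ∧ Runs N P s (I (k - 1)))
    (hdone : ∀ k s, I k s → ¬ b.holds s → Q s) : ∀ k s, I k s → ∃ s' c, Exec (.loop b P) s s' c ∧
      c ≤ k * (b.cost + P.costPoly.eval N) + b.cost ∧ Q s' := by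
  intro k
  induction k with
  | zero =>
    intro s hs
    have hb : ¬ b.holds s := fun hb => absurd (hstep 0 s hs hb).1 (lt_irrefl 0)
    exact ⟨s, b.cost, .loop_done hb, by omega, hdone 0 s hs hb⟩
  | succ k ih =>
    intro s hs
    by_cases hb : b.holds s
    · obtain ⟨-, s', c, hexec, hc, hs'⟩ := hstep _ s hs hb
      obtain ⟨s'', d, hexec', hd, hs''⟩ := ih s' hs'
      exact ⟨s'', _, .loop_step hb hexec hexec', by rw [add_mul, one_mul]; omega, hs''⟩
    · exact ⟨s, b.cost, .loop_done hb, by omega, hdone _ s hs hb⟩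

/-- The invariant `I k` includes that at most `k` iterations remain. -/
theorem Runs.loop {b : Test} (I : ℕ → Store → Prop) {k : ℕ} (hk : k ≤ N) (h : I k s)
    (hstep : ∀ k s, I k s → b.holds s → 0 < k ∧ Runs N P s (I (k - 1)))
    (hdone : ∀ k s, I k s → ¬ b.holds s → Q s) : Runs N (.loop b P) s Q := by
  obtain ⟨s', c, hexec, hc, hs'⟩ := exec_loop_le I hstep hdone k s h
  refine ⟨s', c, hexec, hc.trans ?_, hs'⟩
  simp only [Prog.costPoly, Polynomial.eval_mul, Polynomial.eval_add, Polynomial.eval_X,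
    Polynomial.eval_one, Polynomial.eval_natCast, Nat.cast_id]
  rw [add_mul, one_mul]
  gcongr
  omega

end Runs

/-- The scalar variable that is kept in the first cell of the array `a`. -/
abbrev reg (a : ℕ) : IExp := .get a (.lit 0) (.lit 0)

/-- The entry `e` of the first row of the array `a`. -/
abbrev entry (a : ℕ) (e : IExp) : IExp := .get a (.lit 0) e

/-- The scalar variable that is kept in the first cell of the real array `a`. -/
abbrev dreg (a : ℕ) : DExp := .get a (.lit 0) (.lit 0)

/-- Assignment to the variable `reg a`. -/
abbrev setReg (a : ℕ) (e : IExp) : Prog := .seti a (.lit 0) (.lit 0) e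

/-- Assignment to `entry a i`. -/
abbrev setEntry (a : ℕ) (i e : IExp) : Prog := .seti a (.lit 0) i e

/-- Assignment to the variable `dreg a`. -/
abbrev setDReg (a : ℕ) (e : DExp) : Prog := .setd a (.lit 0) (.lit 0) e

/-- The test whether two natural numbers are equal. -/
def Test.eq (e f : IExp) : Test := .conj (.neg (.ilt e f)) (.neg (.ilt f e))

/-- Disjunction of tests. -/
def Test.or (b c : Test) : Test := .neg (.conj (.neg b) (.neg c))

/-- Sequential composition of a list of programs. -/
def block : List Prog → Prog
  | [] => .skip
  | [P] => P
  | P :: Ps => .seq P (block Ps)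

/-- `for v = 0, 1, …, e - 1 do P` -/
def forUpTo (v : ℕ) (e : IExp) (P : Prog) : Prog :=
  block [setReg v (.lit 0),
    .loop (.ilt (reg v) e) (block [P, setReg v (.add (reg v) (.lit 1))])]

@[simp, grind =]
theorem Test.holds_eq (e f : IExp) (s : Store) : (Test.eq e f).holds s ↔ e.eval s = f.eval s := by
  simp only [Test.eq, holds]
  omega

@[simp, grind =]
theorem Test.holds_or (b c : Test) (s : Store) :
    (Test.or b c).holds s ↔ b.holds s ∨ c.holds s := by
  simp only [Test.or, holds]
  tauto

theorem Runs.forUpTo {N v K : ℕ} {e : IExp} {P : Prog} {s : Store} {Q : Store → Prop}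
    (I : ℕ → Store → Prop) (hK : K ≤ N) (hv : v ∉ P.iwrites) (h : I 0 s)
    (hI : ∀ i s x, I i s → I i (s.seti v 0 0 x)) (he : ∀ i s, I i s → e.eval s = K)
    (hstep : ∀ i s, i < K → s.idx v 0 0 = i → I i s → Runs N P s (I (i + 1)))
    (hdone : ∀ s, I K s → Q s) : Runs N (forUpTo v e P) s Q := by
  refine runs_seti_seq.2 (Runs.loop (fun k s => ∃ i, i + k = K ∧ s.idx v 0 0 = i ∧ I i s) hK
    ⟨0, by simp, by simp [IExp.eval], hI _ _ _ h⟩ ?_ ?_)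
  · rintro k s ⟨i, hik, hsi, hIs⟩ hb
    simp only [Test.holds, IExp.eval, hsi, he _ _ hIs] at hb
    refine ⟨by omega, Runs.seq ((hstep i s hb hsi hIs).frame.mono ?_)⟩
    rintro s' ⟨hIs', hframe, -⟩
    exact runs_seti.2 ⟨i + 1, by omega, by simp [IExp.eval, hframe v hv, hsi], hI _ _ _ hIs'⟩
  · rintro k s ⟨i, hik, hsi, hIs⟩ hb
    simp only [Test.holds, IExp.eval, hsi, he _ _ hIs] at hb
    obtain rfl : i = K := by omega
    exact hdone s hIs

/-! ### Joining closed tours -/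

section Splice

open Equiv

variable {α : Type*} [DecidableEq α] {σ : Equiv.Perm α} {a b p q u v : α}

theorem sameCycle_mul_swap [Finite α] (h : ¬ σ.SameCycle a b) :
    (σ * swap a b).SameCycle a b := by
  have hpow : ∀ i < Function.minimalPeriod σ b, ((σ * swap a b) ^ (i + 1)) a = σ^[i + 1] b := by
    intro i hi
    induction i with
    | zero => simp
    | succ i ih =>
      have hb : σ^[i + 1] b ≠ b :=
        Function.not_isPeriodicPt_of_pos_of_lt_minimalPeriod i.succ_ne_zero hi
      have ha : σ^[i + 1] b ≠ a := fun ha => h (Perm.SameCycle.symm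
        ⟨(i + 1 : ℕ), by rw [zpow_natCast, ← Perm.iterate_eq_pow, ha]⟩)
      rw [pow_succ', Perm.mul_apply, ih (by omega), Perm.mul_apply, swap_apply_of_ne_of_ne ha hb,
        Function.iterate_succ_apply' σ (i + 1)]
  have hpos : 0 < Function.minimalPeriod σ b :=
    Function.minimalPeriod_pos_of_mem_periodicPts (σ.injective.mem_periodicPts b)
  refine ⟨(Function.minimalPeriod σ b : ℕ), ?_⟩
  have := hpow (Function.minimalPeriod σ b - 1) (by omega)
  rwa [Nat.sub_add_cancel hpos, Function.iterate_minimalPeriod] at this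

theorem sameCycle_mul_swap_of_sameCycle [Finite α] (h : ¬ σ.SameCycle a b)
    (huv : σ.SameCycle u v) : (σ * swap a b).SameCycle u v := by
  let τ := σ * swap a b
  have hswap (x : α) : τ.SameCycle x (swap a b x) := by
    rw [swap_apply_def]
    split_ifs with hxa hxb
    exacts [hxa ▸ sameCycle_mul_swap h, hxb ▸ (sameCycle_mul_swap h).symm, .refl _ _]
  have hstep (x : α) : τ.SameCycle x (σ x) :=
    (hswap x).trans ⟨1, by simp [τ]⟩
  obtain ⟨k, rfl⟩ := huv.exists_nat_pow_eq
  clear huv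
  induction k with
  | zero => exact .refl _ _
  | succ k ih => rw [pow_succ', Perm.mul_apply]; exact ih.trans (hstep _)

/-- Join the cycles of `a` and `b`, with the two fixed points `p` and `q` of `σ` inserted behind
`a` and `b`. -/
def splice (σ : Equiv.Perm α) (a b p q : α) : Equiv.Perm α :=
  σ * swap a b * swap a p * swap b q

variable (hnd : [a, b, p, q].Nodup) (hp : σ p = p) (hq : σ q = q)

include hnd hp hq

theorem splice_apply (x : α) : splice σ a b p q x =
    if x = a then p else if x = b then q else if x = p then σ b else if x = q then σ a
    else σ x := by
  simp only [List.nodup_cons, List.mem_cons, not_or] at hnd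
  simp only [splice, Perm.mul_apply, swap_apply_def]
  grind

theorem splice_sameCycle_of_mul_swap [Finite α] (h : (σ * swap a b).SameCycle u v) :
    (splice σ a b p q).SameCycle u v := by
  simp only [List.nodup_cons, List.mem_cons, not_or] at hnd
  refine sameCycle_mul_swap_of_sameCycle (fun hbq => ?_)
    (sameCycle_mul_swap_of_sameCycle (fun hap => ?_) h)
  · exact hnd.2.1.2.1 (hbq.eq_of_right (by simp [Function.IsFixedPt, swap_apply_def]; grind))
  · exact hnd.1.2.1 (hap.eq_of_right (by simp [Function.IsFixedPt, swap_apply_def]; grind))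

end Splice

open Classical in
/-- The length of the edge `uv`, and `0` if `u` and `v` are not adjacent: the entries of the matrix
that the program is given. -/
noncomputable def Roadmap.edgeLen (R : Roadmap n) (u v : Fin n) : ℝ :=
  if R.graph.Adj u v then R.len u v else 0

/-- The cost of the first `j` steps of a sequence of vertices in which consecutive vertices are
equal or adjacent. -/
noncomputable def seqCost (R : Roadmap n) (u : ℕ → Fin n) (j : ℕ) : ℝ :=
  ∑ t ∈ Finset.range j, R.edgeLen (u t) (u (t + 1))

theorem Roadmap.edgeLen_of_adj (R : Roadmap n) {u v : Fin n} (h : R.graph.Adj u v) :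
    R.edgeLen u v = R.len u v :=
  if_pos h

@[simp]
theorem Roadmap.edgeLen_self (R : Roadmap n) (v : Fin n) : R.edgeLen v v = 0 :=
  if_neg (R.graph.irrefl)

theorem Roadmap.edgeLen_nonneg (R : Roadmap n) (u v : Fin n) : 0 ≤ R.edgeLen u v := by
  unfold edgeLen
  split_ifs with h
  exacts [(R.len_pos u v h).le, le_rfl]

section Tours

/-- The nodes of the tours. The node `(0, v)` always lies on a tour; the nodes `(1, r)` and `(2, r)`
are put into use when the component with the root `r` is absorbed by another one. -/
abbrev Node (n : ℕ) := Fin 3 × Fin n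

/-- Closed tours around the components of the forest `F`, as the cycles of the permutation `nxt`;
the node `x` is a visit to the vertex `vert x`, and every edge of `F` is traversed once in each
direction, which is expressed by sums over all steps of the tours. -/
structure Tours (F : List (Fin n × Fin n)) (comp : Fin n → Fin n) (nxt : Equiv.Perm (Node n))
    (vert : Node n → Fin n) : Prop where
  vert_base : ∀ v, vert (0, v) = v
  fresh : ∀ r, comp r = r → ∀ k ≠ 0, nxt (k, r) = (k, r)
  edge : ∀ x, vert (nxt x) = vert x ∨ (vert x, vert (nxt x)) ∈ F ∨ (vert (nxt x), vert x) ∈ F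
  sameCycle : ∀ u v, comp u = comp v → nxt.SameCycle (0, u) (0, v)
  sum : ∀ φ : Fin n → Fin n → ℝ, (∀ v, φ v v = 0) →
    ∑ x, φ (vert x) (vert (nxt x)) = (F.map fun e => φ e.1 e.2 + φ e.2 e.1).sum

theorem Tours.one : Tours [] (id : Fin n → Fin n) 1 Prod.snd where
  vert_base _ := rfl
  fresh _ _ _ _ := rfl
  edge _ := Or.inl rfl
  sameCycle u v h := by rw [show u = v from h]
  sum φ hφ := by simp [hφ]

/-- The vertices of the nodes after the tours through `a` and `b` have been joined. -/
def mergeVert (comp : Fin n → Fin n) (vert : Node n → Fin n) (a b : Fin n) : Node n → Fin n :=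
  Function.update (Function.update vert (1, comp b) b) (2, comp b) a

/-- The tours after those through `a` and `b` have been joined along the edge `ab`. -/
def mergeNxt (comp : Fin n → Fin n) (nxt : Equiv.Perm (Node n)) (a b : Fin n) :
    Equiv.Perm (Node n) :=
  splice nxt (0, a) (0, b) (1, comp b) (2, comp b)

/-- The sequence of vertices that is visited along a tour, starting from the node `x`. -/
def visits (nxt : Equiv.Perm (Node n)) (vert : Node n → Fin n) (x : Node n) (t : ℕ) : Fin n :=
  vert (nxt^[t] x)

theorem visits_add (nxt : Equiv.Perm (Node n)) (vert : Node n → Fin n) (x : Node n) (i t : ℕ) :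
    visits nxt vert x (i + t) = visits nxt vert (nxt^[i] x) t := by
  rw [visits, visits, ← Function.iterate_add_apply, add_comm]

theorem minimalPeriod_le (nxt : Equiv.Perm (Node n)) (x : Node n) :
    Function.minimalPeriod nxt x ≤ 3 * n := by
  simpa using Function.minimalPeriod_le_card (f := nxt) (x := x)

theorem minimalPeriod_pos (nxt : Equiv.Perm (Node n)) (x : Node n) :
    0 < Function.minimalPeriod nxt x :=
  Function.minimalPeriod_pos_of_mem_periodicPts (nxt.injective.mem_periodicPts x)

namespace Tours

variable {F : List (Fin n × Fin n)} {comp : Fin n → Fin n} {nxt : Equiv.Perm (Node n)}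
  {vert : Node n → Fin n} {a b : Fin n}

theorem comp_vert_nxt (h : Tours F comp nxt vert) (hF : ∀ e ∈ F, comp e.1 = comp e.2)
    (x : Node n) : comp (vert (nxt x)) = comp (vert x) := by
  obtain h | h | h := h.edge x
  exacts [congrArg comp h, (hF _ h).symm, hF _ h]

theorem comp_vert_iterate (h : Tours F comp nxt vert) (hF : ∀ e ∈ F, comp e.1 = comp e.2)
    (x : Node n) (t : ℕ) : comp (vert (nxt^[t] x)) = comp (vert x) := by
  induction t with
  | zero => rfl
  | succ t ih => rw [Function.iterate_succ_apply', h.comp_vert_nxt hF, ih]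

theorem comp_vert_eq_of_sameCycle (h : Tours F comp nxt vert)
    (hF : ∀ e ∈ F, comp e.1 = comp e.2) {x y : Node n} (hxy : nxt.SameCycle x y) :
    comp (vert x) = comp (vert y) := by
  obtain ⟨t, rfl⟩ := hxy.exists_nat_pow_eq
  rw [← Equiv.Perm.iterate_eq_pow, h.comp_vert_iterate hF]

theorem nodup_of_ne (hab : a ≠ b) (r : Fin n) :
    [((0 : Fin 3), a), (0, b), (1, r), (2, r)].Nodup := by
  simp [hab]

theorem mergeNxt_apply (h : Tours F comp nxt vert) (hcomp : ∀ v, comp (comp v) = comp v)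
    (hab : a ≠ b) (x : Node n) : mergeNxt comp nxt a b x =
      if x = (0, a) then (1, comp b) else if x = (0, b) then (2, comp b)
      else if x = (1, comp b) then nxt (0, b) else if x = (2, comp b) then nxt (0, a)
      else nxt x :=
  splice_apply (nodup_of_ne hab _) (h.fresh _ (hcomp b) 1 (by simp))
    (h.fresh _ (hcomp b) 2 (by simp)) x

theorem merge_step (h : Tours F comp nxt vert) (hcomp : ∀ v, comp (comp v) = comp v)
    (hab : a ≠ b) (x : Node n) :
    (mergeVert comp vert a b x, mergeVert comp vert a b (mergeNxt comp nxt a b x)) =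
      if x = (0, a) then (a, b) else if x = (0, b) then (b, a)
      else if x = (1, comp b) then (vert (0, b), vert (nxt (0, b)))
      else if x = (2, comp b) then (vert (0, a), vert (nxt (0, a)))
      else (vert x, vert (nxt x)) := by
  have hp : nxt (1, comp b) = (1, comp b) := h.fresh _ (hcomp b) 1 (by simp)
  have hq : nxt (2, comp b) = (2, comp b) := h.fresh _ (hcomp b) 2 (by simp)
  have hp' (y : Node n) (hy : nxt y = (1, comp b)) : y = (1, comp b) :=
    nxt.injective (hy.trans hp.symm)
  have hq' (y : Node n) (hy : nxt y = (2, comp b)) : y = (2, comp b) :=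
    nxt.injective (hy.trans hq.symm)
  have hva := h.vert_base a
  have hvb := h.vert_base b
  rw [h.mergeNxt_apply hcomp hab]
  simp only [mergeVert, Function.update_apply]
  grind

theorem merge_fresh (h : Tours F comp nxt vert) (hcomp : ∀ v, comp (comp v) = comp v)
    (hab : comp a ≠ comp b) {r : Fin n} (hr : mergeLabel comp a b r = r) {k : Fin 3}
    (hk : k ≠ 0) : mergeNxt comp nxt a b (k, r) = (k, r) := by
  have hr' : comp r = r ∧ r ≠ comp b := by grind [mergeLabel]
  rw [h.mergeNxt_apply hcomp (ne_of_apply_ne comp hab)]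
  simp [hk, hr'.2, h.fresh r hr'.1 k hk]

theorem merge_sameCycle (h : Tours F comp nxt vert) (hF : ∀ e ∈ F, comp e.1 = comp e.2)
    (hcomp : ∀ v, comp (comp v) = comp v) (hab : comp a ≠ comp b) {u v : Fin n}
    (huv : mergeLabel comp a b u = mergeLabel comp a b v) :
    (mergeNxt comp nxt a b).SameCycle (0, u) (0, v) := by
  have hne : ¬ nxt.SameCycle (0, a) (0, b) := fun hc =>
    hab (by simpa only [h.vert_base] using h.comp_vert_eq_of_sameCycle hF hc)
  have hle : ∀ {x y}, (nxt * Equiv.swap (0, a) (0, b)).SameCycle x y →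
      (mergeNxt comp nxt a b).SameCycle x y :=
    splice_sameCycle_of_mul_swap (nodup_of_ne (ne_of_apply_ne comp hab) _)
      (h.fresh _ (hcomp b) 1 (by simp)) (h.fresh _ (hcomp b) 2 (by simp))
  have hold : ∀ {u v}, comp u = comp v → (mergeNxt comp nxt a b).SameCycle (0, u) (0, v) :=
    fun huv => hle (sameCycle_mul_swap_of_sameCycle hne (h.sameCycle _ _ huv))
  have hnew := hle (sameCycle_mul_swap hne)
  rw [← Setoid.ker_def, ker_mergeLabel] at huv
  obtain huv | ⟨hua, hbv⟩ | ⟨hub, hav⟩ := huv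
  exacts [hold huv, ((hold hua).trans hnew).trans (hold hbv),
    ((hold hub).trans hnew.symm).trans (hold hav)]

theorem merge_sum (h : Tours F comp nxt vert) (hcomp : ∀ v, comp (comp v) = comp v)
    (hab : a ≠ b) {φ : Fin n → Fin n → ℝ} (hφ : ∀ v, φ v v = 0) :
    ∑ x, φ (mergeVert comp vert a b x) (mergeVert comp vert a b (mergeNxt comp nxt a b x)) =
      φ a b + φ b a + (F.map fun e => φ e.1 e.2 + φ e.2 e.1).sum := by
  let p : Node n := (1, comp b)
  let q : Node n := (2, comp b)
  have hp : φ (vert p) (vert (nxt p)) = 0 := by rw [h.fresh _ (hcomp b) 1 (by simp), hφ]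
  have hq : φ (vert q) (vert (nxt q)) = 0 := by rw [h.fresh _ (hcomp b) 2 (by simp), hφ]
  let e := Equiv.swap (0, a) q * Equiv.swap (0, b) p
  have hstep (x : Node n) : φ (mergeVert comp vert a b (e x))
      (mergeVert comp vert a b (mergeNxt comp nxt a b (e x))) =
      φ (vert x) (vert (nxt x)) + (if x = q then φ a b else 0) + if x = p then φ b a else 0 := by
    have := congrArg (Function.uncurry φ) (h.merge_step hcomp hab (e x))
    simp only [Function.uncurry_apply_pair] at this
    rw [this]
    simp only [e, Equiv.Perm.mul_apply, Equiv.swap_apply_def]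
    grind
  rw [← Equiv.sum_comp e, Finset.sum_congr rfl fun x _ => hstep x, Finset.sum_add_distrib,
    Finset.sum_add_distrib, h.sum φ hφ]
  simp only [Finset.sum_ite_eq', Finset.mem_univ, if_true]
  ring

theorem merge (h : Tours F comp nxt vert) (hF : ∀ e ∈ F, comp e.1 = comp e.2)
    (hcomp : ∀ v, comp (comp v) = comp v) (hab : comp a ≠ comp b) :
    Tours ((a, b) :: F) (mergeLabel comp a b) (mergeNxt comp nxt a b)
      (mergeVert comp vert a b) where
  vert_base v := by simp [mergeVert, h.vert_base]
  fresh _ hr _ hk := h.merge_fresh hcomp hab hr hk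
  edge x := by
    have hstep := h.merge_step hcomp (ne_of_apply_ne comp hab) x
    have hedge := h.edge
    simp only [List.mem_cons]
    grind
  sameCycle _ _ huv := h.merge_sameCycle hF hcomp hab huv
  sum φ hφ := h.merge_sum hcomp (ne_of_apply_ne comp hab) hφ

theorem visits_eq_or_adj {R : Roadmap n} (h : Tours F comp nxt vert)
    (hF : ∀ e ∈ F, R.graph.Adj e.1 e.2) (x : Node n) (t : ℕ) :
    visits nxt vert x t = visits nxt vert x (t + 1) ∨
      R.graph.Adj (visits nxt vert x t) (visits nxt vert x (t + 1)) := by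
  simp only [visits, Function.iterate_succ_apply']
  obtain h | h | h := h.edge (nxt^[t] x)
  exacts [.inl h.symm, .inr (hF _ h), .inr (hF _ h).symm]

theorem exists_visits_eq (h : Tours F comp nxt vert) {r v : Fin n} (hv : comp v = comp r) :
    ∃ t < Function.minimalPeriod nxt (0, r), visits nxt vert (0, r) t = v := by
  obtain ⟨t, ht⟩ := (h.sameCycle r v hv.symm).exists_nat_pow_eq
  refine ⟨t % Function.minimalPeriod nxt (0, r), Nat.mod_lt _ (minimalPeriod_pos _ _), ?_⟩
  rw [visits, Function.iterate_mod_minimalPeriod_eq, Equiv.Perm.iterate_eq_pow, ht, h.vert_base]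

theorem sum_edgeLen_eq_weightIn {R : Roadmap n} (h : Tours F comp nxt vert)
    (hadj : ∀ e ∈ F, R.graph.Adj e.1 e.2) (hF : ∀ e ∈ F, comp e.1 = comp e.2) (r : Fin n) :
    (∑ x, if comp (vert x) = comp r then R.edgeLen (vert x) (vert (nxt x)) else 0) =
      2 * weightIn R {v | comp v = comp r} F := by
  rw [h.sum (fun u v => if comp u = comp r then R.edgeLen u v else 0) (by simp), weightIn,
    ← List.sum_map_mul_left]
  refine congrArg List.sum (List.map_congr_left fun e he => ?_)
  rw [R.edgeLen_of_adj (hadj e he), R.edgeLen_of_adj (hadj e he).symm,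
    ← R.len_symm _ _ (hadj e he), ← hF e he]
  simp only [Set.mem_ofPred_eq]
  split_ifs <;> ring

theorem seqCost_visits_le_weightIn {R : Roadmap n} (h : Tours F comp nxt vert)
    (hadj : ∀ e ∈ F, R.graph.Adj e.1 e.2) (hF : ∀ e ∈ F, comp e.1 = comp e.2) (r : Fin n) {j : ℕ}
    (hj : j ≤ Function.minimalPeriod nxt (0, r)) :
    seqCost R (visits nxt vert (0, r)) j ≤ 2 * weightIn R {v | comp v = comp r} F := by
  have hinj : Set.InjOn (fun t => nxt^[t] (0, r)) (Finset.range j : Set ℕ) :=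
    Function.iterate_injOn_Iio_minimalPeriod.mono fun t ht =>
      (Finset.mem_range.1 ht).trans_le hj
  have hcomp (t : ℕ) : comp (vert (nxt^[t] (0, r))) = comp r := by
    rw [h.comp_vert_iterate hF, h.vert_base]
  calc seqCost R (visits nxt vert (0, r)) j
      = ∑ x ∈ (Finset.range j).image fun t => nxt^[t] (0, r),
          if comp (vert x) = comp r then R.edgeLen (vert x) (vert (nxt x)) else 0 := by
        rw [Finset.sum_image hinj]
        simp [seqCost, visits, hcomp, Function.iterate_succ_apply']
    _ ≤ ∑ x, if comp (vert x) = comp r then R.edgeLen (vert x) (vert (nxt x)) else 0 :=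
        Finset.sum_le_univ_sum_of_nonneg fun x => by
          split_ifs
          exacts [R.edgeLen_nonneg _ _, le_rfl]
    _ = 2 * weightIn R {v | comp v = comp r} F := h.sum_edgeLen_eq_weightIn hadj hF r

end Tours

end Tours

/-! ### Cutting tours -/

section Cut

variable {R : Roadmap n} {B : ℝ} {u : ℕ → Fin n} {j : ℕ}

/-- The state of the greedy cutting of a tour into segments: the finished segments, the current
segment, and the cost of the latter. -/
structure CutState (n : ℕ) where
  done : List (List (Fin n))
  last : List (Fin n)
  cost : ℝ

/-- All segments. -/
def CutState.segs (c : CutState n) : List (List (Fin n)) := c.done ++ [c.last]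

open Classical in
/-- Go on from the vertex `u` to the vertex `v`, starting a new segment when the cost of the current
one would exceed `B`. -/
noncomputable def CutState.step (R : Roadmap n) (B : ℝ) (c : CutState n) (u v : Fin n) :
    CutState n :=
  if B < c.cost + R.edgeLen u v then ⟨c.segs, [v], 0⟩
  else ⟨c.done, if u = v then c.last else c.last ++ [v], c.cost + R.edgeLen u v⟩

/-- Cut the first `j` steps of the tour `u` greedily into segments of cost at most `B`. -/
noncomputable def cut (R : Roadmap n) (B : ℝ) (u : ℕ → Fin n) : ℕ → CutState n
  | 0 => ⟨[], [u 0], 0⟩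
  | j + 1 => (cut R B u j).step R B (u j) (u (j + 1))

theorem pathCost_append_singleton {p : List (Fin n)} {v : Fin n} (w : Fin n)
    (hv : v ∈ p.getLast?) : pathCost R (p ++ [w]) = pathCost R p + R.len v w := by
  induction p with
  | nil => simp at hv
  | cons a q ih =>
    cases q with
    | nil => simp_all [pathCost]
    | cons b q =>
      simp only [List.cons_append, pathCost] at ih ⊢
      rw [ih (by simpa using hv), add_assoc]

theorem cut_last (hB : 0 ≤ B) (hu : ∀ t, u t = u (t + 1) ∨ R.graph.Adj (u t) (u (t + 1))) :
    IsPath R (cut R B u j).last ∧ u j ∈ (cut R B u j).last.getLast? ∧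
      pathCost R (cut R B u j).last = (cut R B u j).cost ∧ (cut R B u j).cost ≤ B := by
  induction j with
  | zero => simpa [cut, IsPath, pathCost] using hB
  | succ j ih =>
    obtain ⟨hpath, hend, hcost, hle⟩ := ih
    simp only [cut, CutState.step]
    split_ifs with hlt heq
    · simpa [IsPath, pathCost] using hB
    · rw [← heq, R.edgeLen_self, add_zero]
      exact ⟨hpath, hend, hcost, hle⟩
    · have hadj := (hu j).resolve_left heq
      refine ⟨⟨by simp, ?_⟩, by simp, ?_, not_lt.1 hlt⟩
      · exact hpath.2.append (.singleton _) (by simp_all)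
      · rw [pathCost_append_singleton _ hend, hcost, R.edgeLen_of_adj hadj]

theorem isPath_and_pathCost_le_of_mem_cut (hB : 0 ≤ B)
    (hu : ∀ t, u t = u (t + 1) ∨ R.graph.Adj (u t) (u (t + 1))) {g : List (Fin n)}
    (hg : g ∈ (cut R B u j).segs) : IsPath R g ∧ pathCost R g ≤ B := by
  have hlast (j : ℕ) : IsPath R (cut R B u j).last ∧ pathCost R (cut R B u j).last ≤ B :=
    have h := cut_last hB hu (j := j)
    ⟨h.1, h.2.2.1.trans_le h.2.2.2⟩
  suffices hdone : ∀ g ∈ (cut R B u j).done, IsPath R g ∧ pathCost R g ≤ B by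
    obtain hg | hg := List.mem_append.1 hg
    exacts [hdone g hg, List.mem_singleton.1 hg ▸ hlast j]
  clear hg g
  induction j with
  | zero => simp [cut]
  | succ j ih =>
    simp only [cut, CutState.step, CutState.segs]
    split_ifs
    · simpa [or_imp, forall_and, hlast j] using fun g hg => ih g hg
    all_goals exact ih

theorem mem_cut_last : u j ∈ (cut R B u j).last := by
  induction j with
  | zero => simp [cut]
  | succ j ih =>
    simp only [cut, CutState.step]
    split_ifs with hlt heq
    exacts [List.mem_singleton_self _, heq ▸ ih, by simp]

theorem exists_mem_cut {i : ℕ} (hi : i ≤ j) : ∃ g ∈ (cut R B u j).segs, u i ∈ g := by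
  induction j, hi using Nat.le_induction with
  | base => exact ⟨_, List.mem_append_right _ (List.mem_singleton_self _), mem_cut_last⟩
  | succ j _ ih =>
    obtain ⟨g, hg, hi⟩ := ih
    simp only [cut, CutState.step]
    split_ifs
    · exact ⟨g, List.mem_append_left _ hg, hi⟩
    · exact ⟨g, hg, hi⟩
    · obtain hg | hg := List.mem_append.1 hg
      · exact ⟨g, List.mem_append_left _ hg, hi⟩
      · rw [List.mem_singleton.1 hg] at hi
        exact ⟨_, List.mem_append_right _ (List.mem_singleton_self _), List.mem_append_left _ hi⟩

theorem length_le_of_mem_cut {g : List (Fin n)} (hg : g ∈ (cut R B u j).segs) :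
    g.length ≤ j + 1 := by
  suffices h : (∀ g ∈ (cut R B u j).done, g.length ≤ j + 1) ∧ (cut R B u j).last.length ≤ j + 1 by
    obtain hg | hg := List.mem_append.1 hg
    exacts [h.1 g hg, List.mem_singleton.1 hg ▸ h.2]
  clear hg g
  induction j with
  | zero => simp [cut]
  | succ j ih =>
    simp only [cut, CutState.step, CutState.segs]
    grind

theorem seqCost_succ (R : Roadmap n) (u : ℕ → Fin n) (j : ℕ) :
    seqCost R u (j + 1) = seqCost R u j + R.edgeLen (u j) (u (j + 1)) :=
  Finset.sum_range_succ _ _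

theorem seqCost_add (R : Roadmap n) (u : ℕ → Fin n) (i k : ℕ) :
    seqCost R u (i + k) = seqCost R u i + seqCost R (fun t => u (i + t)) k :=
  Finset.sum_range_add _ _ _

theorem seqCost_nonneg (R : Roadmap n) (u : ℕ → Fin n) (j : ℕ) : 0 ≤ seqCost R u j :=
  Finset.sum_nonneg fun _ _ => R.edgeLen_nonneg _ _

theorem length_cut_done_mul_le {C : ℝ}
    (hC : ∀ i k, i + k ≤ j → seqCost R (fun t => u (i + t)) k ≤ C →
      seqCost R (fun t => u (i + t)) k ≤ B) :
    (cut R B u j).done.length * C ≤ seqCost R u j := by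
  suffices h : ∃ i k, i + k = j ∧ (cut R B u j).cost = seqCost R (fun t => u (i + t)) k ∧
      (cut R B u j).done.length * C ≤ seqCost R u i by
    obtain ⟨i, k, rfl, -, hlen⟩ := h
    rw [seqCost_add]
    linarith [seqCost_nonneg R (fun t => u (i + t)) k]
  induction j with
  | zero => exact ⟨0, 0, rfl, by simp [cut, seqCost], by simp [cut, seqCost]⟩
  | succ j ih =>
    obtain ⟨i, k, rfl, hcost, hlen⟩ := ih fun i k hik => hC i k (by omega)
    have hsucc : (cut R B u (i + k)).cost + R.edgeLen (u (i + k)) (u (i + k + 1)) =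
        seqCost R (fun t => u (i + t)) (k + 1) := by rw [seqCost_succ, hcost, add_assoc]
    simp only [cut, CutState.step]
    split_ifs with hlt
    · have hlong : C < seqCost R (fun t => u (i + t)) (k + 1) := by
        by_contra! hle
        exact (hC i (k + 1) le_rfl hle).not_gt (hsucc ▸ hlt)
      refine ⟨i + k + 1, 0, rfl, by simp [seqCost], ?_⟩
      rw [add_assoc, seqCost_add]
      simp only [CutState.segs, List.length_append, List.length_singleton, Nat.cast_add,
        Nat.cast_one]
      linarith
    all_goals exact ⟨i, k + 1, rfl, hsucc, hlen⟩

end Cut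

section Segments

variable {R : Roadmap n} {B : ℝ} {F : List (Fin n × Fin n)} {comp : Fin n → Fin n}
  {nxt : Equiv.Perm (Node n)} {vert : Node n → Fin n}

/-- The segments into which the tour around the component with the root `r` is cut. The step back
to the start of the tour is not needed. -/
noncomputable def tourSegments (R : Roadmap n) (B : ℝ) (nxt : Equiv.Perm (Node n))
    (vert : Node n → Fin n) (r : Fin n) : List (List (Fin n)) :=
  (cut R B (visits nxt vert (0, r)) (Function.minimalPeriod nxt (0, r) - 1)).segs

/-- The segments into which the tours around all components are cut. -/
noncomputable def segments (R : Roadmap n) (B : ℝ) (comp : Fin n → Fin n)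
    (nxt : Equiv.Perm (Node n)) (vert : Node n → Fin n) : List (List (Fin n)) :=
  (List.finRange n).flatMap fun r => if comp r = r then tourSegments R B nxt vert r else []

theorem isPath_and_pathCost_le_of_mem_segments (hB : 0 ≤ B) (hT : Tours F comp nxt vert)
    (hadj : ∀ e ∈ F, R.graph.Adj e.1 e.2) {g : List (Fin n)}
    (hg : g ∈ segments R B comp nxt vert) : IsPath R g ∧ pathCost R g ≤ B := by
  obtain ⟨r, -, hg⟩ := List.mem_flatMap.1 hg
  split_ifs at hg
  · exact isPath_and_pathCost_le_of_mem_cut hB (hT.visits_eq_or_adj hadj _) hg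
  · simp at hg

theorem exists_mem_segments (hT : Tours F comp nxt vert) (hcomp : ∀ v, comp (comp v) = comp v)
    (v : Fin n) : ∃ g ∈ segments R B comp nxt vert, v ∈ g := by
  obtain ⟨t, ht, htv⟩ := hT.exists_visits_eq (hcomp v).symm
  obtain ⟨g, hg, htg⟩ := exists_mem_cut (R := R) (B := B)
    (u := visits nxt vert (0, comp v)) (Nat.le_sub_one_of_lt ht)
  refine ⟨g, List.mem_flatMap.2 ⟨comp v, List.mem_finRange _, ?_⟩, htv ▸ htg⟩
  rwa [if_pos (hcomp v)]

theorem length_le_of_mem_segments {g : List (Fin n)} (hg : g ∈ segments R B comp nxt vert) :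
    g.length ≤ 3 * n := by
  obtain ⟨r, -, hg⟩ := List.mem_flatMap.1 hg
  split_ifs at hg
  · have := minimalPeriod_le nxt (0, r)
    have := minimalPeriod_pos nxt (0, r)
    have := length_le_of_mem_cut hg
    omega
  · simp at hg

/-- All contiguous parts of tours whose cost is at most `C` have in fact a cost at most `B`. -/
def PartsLE (R : Roadmap n) (nxt : Equiv.Perm (Node n)) (vert : Node n → Fin n) (C B : ℝ) : Prop :=
  ∀ x, ∀ j < 3 * n, seqCost R (visits nxt vert x) j ≤ C → seqCost R (visits nxt vert x) j ≤ B

theorem exists_partsLE (R : Roadmap n) (hn : 0 < n) (nxt : Equiv.Perm (Node n))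
    (vert : Node n → Fin n) {C : ℝ} (hC : 0 ≤ C) :
    ∃ x, ∃ j < 3 * n, seqCost R (visits nxt vert x) j ≤ C ∧
      PartsLE R nxt vert C (seqCost R (visits nxt vert x) j) := by
  classical
  let cost (i : Node n × ℕ) := seqCost R (visits nxt vert i.1) i.2
  let parts := (Finset.univ ×ˢ Finset.range (3 * n)).filter fun i => cost i ≤ C
  have hparts : parts.Nonempty :=
    ⟨((0, ⟨0, hn⟩), 0), Finset.mem_filter.2 ⟨by simp [hn], by simpa [cost, seqCost] using hC⟩⟩
  obtain ⟨⟨x, j⟩, hxj, hmax⟩ := parts.exists_max_image cost hparts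
  simp only [parts, Finset.mem_filter, Finset.mem_product, Finset.mem_univ, Finset.mem_range,
    true_and] at hxj hmax
  exact ⟨x, j, hxj.1, hxj.2, fun y k hk hyk => hmax (y, k) ⟨hk, hyk⟩⟩

theorem length_tourSegments_le {p : Fin m → List (Fin n)} {c : ℝ} (hK : Kruskal R F comp)
    (hT : Tours F comp nxt vert) (hF : ∀ e ∈ F, R.len e.1 e.2 ≤ c)
    (hcross : ∀ u v, R.graph.Adj u v → comp u ≠ comp v → c < R.len u v)
    (hp : IsPathCover R p) (hc : ∀ i, pathCost R (p i) ≤ c) (hc0 : 0 < c)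
    (hB : PartsLE R nxt vert (4 * c) B) (r : Fin n) :
    (tourSegments R B nxt vert r).length ≤
      (Finset.univ.filter fun i => comp ((p i).head (hp.1 i).1) = comp r).card := by
  have hweight := hK.weightIn_add_le hF hcross hp hc r
  have hperiod : Function.minimalPeriod nxt (0, r) - 1 < 3 * n :=
    (Nat.sub_lt (minimalPeriod_pos _ _) one_pos).trans_le (minimalPeriod_le _ _)
  have hcost := hT.seqCost_visits_le_weightIn hK.adj_of_mem hK.comp_eq_of_mem r
    (Nat.sub_le (Function.minimalPeriod nxt (0, r)) 1)
  have hdone := length_cut_done_mul_le (R := R) (B := B) (C := 4 * c)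
    (u := visits nxt vert (0, r)) (j := Function.minimalPeriod nxt (0, r) - 1)
    fun i k hik => by
      simp only [visits_add]
      exact hB _ k (by omega)
  rw [tourSegments, CutState.segs, List.length_append, List.length_singleton, Nat.succ_le_iff]
  rify
  nlinarith

theorem length_segments_le {p : Fin m → List (Fin n)} {c : ℝ} (hK : Kruskal R F comp)
    (hT : Tours F comp nxt vert) (hF : ∀ e ∈ F, R.len e.1 e.2 ≤ c)
    (hcross : ∀ u v, R.graph.Adj u v → comp u ≠ comp v → c < R.len u v)
    (hp : IsPathCover R p) (hc : ∀ i, pathCost R (p i) ≤ c) (hc0 : 0 < c)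
    (hB : PartsLE R nxt vert (4 * c) B) : (segments R B comp nxt vert).length ≤ m := by
  let root (i : Fin m) := comp ((p i).head (hp.1 i).1)
  calc (segments R B comp nxt vert).length
      = ∑ r, (if comp r = r then tourSegments R B nxt vert r else []).length := by
        rw [segments, List.length_flatMap, Fin.sum_univ_def]
    _ ≤ ∑ r, (Finset.univ.filter fun i => root i = r).card := by
        refine Finset.sum_le_sum fun r _ => ?_
        split_ifs with hr
        · exact (length_tourSegments_le hK hT hF hcross hp hc hc0 hB r).trans_eq (by rw [hr])
        · exact Nat.zero_le _
    _ = m := by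
        rw [← Finset.card_eq_sum_card_fiberwise fun i _ => Finset.mem_univ (root i),
          Finset.card_univ, Fintype.card_fin]

end Segments

/-! ### The program -/

/-! The natural number arrays of the program are used as follows.
* `0`, `1`, `2`: the input; `3`, `4`: the output;
* `5`: the labels of the components; `6`, `7`: the successors and the vertices of the nodes of the
  tours, where the node `(k, v)` has number `v + n * k`;
* `9`, `10`, `11`, `13`, `20`, `21`: loop counters; `12`, `14`, `15`: nodes;
* `16`, `17`, `18`: the number of segments into which the tours are cut, their lengths and vertices;
* `19`: whether there is any output;
* `22`, `23`, `24`: the ends of a shortest edge between two components, and whether there is one;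
  `25`, `26`: the labels of these components.

The real arrays are: `0`: the input; `1`: the bound for the cost of a segment; `2`: the cost of the
current segment; `3`: the bound for the cost of the output. -/

/-- Begin a new segment with the vertex `e`. -/
def newSeg (e : IExp) : Prog :=
  block [.seti 18 (reg 16) (.lit 0) e, .seti 17 (reg 16) (.lit 0) (.lit 1),
    setReg 16 (.add (reg 16) (.lit 1)), setDReg 2 .zero]

/-- Append the vertex `e` to the current segment. -/
def appendSeg (e : IExp) : Prog :=
  block [.seti 18 (.sub (reg 16) (.lit 1)) (.get 17 (.sub (reg 16) (.lit 1)) (.lit 0)) e,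
    .seti 17 (.sub (reg 16) (.lit 1)) (.lit 0)
      (.add (.get 17 (.sub (reg 16) (.lit 1)) (.lit 0)) (.lit 1))]

/-- The vertex of the current node. -/
def curVertex : IExp := entry 7 (reg 15)

/-- The vertex of the node after the current one. -/
def nextVertex : IExp := entry 7 (reg 14)

/-- The cost of the step from the current node to the next one. -/
def stepCost : DExp := .get 0 curVertex nextVertex

/-- Extend the current segment to the next node, or begin a new segment there if the current one
would become too long. -/
def extendSeg : Prog :=
  .ite (.dlt (dreg 1) (.add (dreg 2) stepCost))
    (newSeg nextVertex)
    (block [setDReg 2 (.add (dreg 2) stepCost),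
      .ite (.eq curVertex nextVertex) .skip (appendSeg nextVertex)])

/-- Go on to the next node of a tour. -/
def cutStep : Prog :=
  block [setReg 14 (entry 6 (reg 15)), extendSeg, setReg 15 (reg 14)]

/-- Cut the tour through the root `reg 13` into segments. -/
def cutTour : Prog :=
  block [newSeg (reg 13), setReg 15 (reg 13),
    .loop (.neg (.eq (entry 6 (reg 15)) (reg 13))) cutStep]

/-- Cut all tours into segments. -/
def cutAll : Prog :=
  block [setReg 16 (.lit 0),
    forUpTo 13 (reg 0) (.ite (.eq (entry 5 (reg 13)) (reg 13)) cutTour .skip)]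

/-- Copy the segment `reg 20` to the output. -/
def copySeg : Prog :=
  block [.seti 3 (reg 20) (.lit 0) (.get 17 (reg 20) (.lit 0)),
    forUpTo 21 (.get 17 (reg 20) (.lit 0))
      (.seti 4 (reg 20) (reg 21) (.get 18 (reg 20) (reg 21)))]

/-- Copy the segments to the output; the remaining robots stay at the vertex `0`. -/
def save : Prog :=
  block [setReg 19 (.lit 1), setDReg 3 (dreg 1),
    forUpTo 20 (reg 1)
      (.ite (.ilt (reg 20) (reg 16)) copySeg
        (block [.seti 3 (reg 20) (.lit 0) (.lit 1), .seti 4 (reg 20) (.lit 0) (.lit 0)]))]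

/-- Try the bound `dreg 1` for the cost of the segments. -/
def tryBound : Prog :=
  block [cutAll,
    .ite (.conj (.neg (.ilt (reg 1) (reg 16)))
        (.or (.eq (reg 19) (.lit 0)) (.dlt (dreg 1) (dreg 3))))
      save .skip]

/-- The number of nodes. -/
def nodeCount : IExp := .add (.add (reg 0) (reg 0)) (reg 0)

/-- Try the cost of the part between `reg 10` and `reg 12` of a tour, and extend this part. -/
def tryPart : Prog :=
  block [tryBound,
    setDReg 1 (.add (dreg 1) (.get 0 (entry 7 (reg 12)) (entry 7 (entry 6 (reg 12))))),
    setReg 12 (entry 6 (reg 12))]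

/-- Try all bounds that are costs of parts of tours. -/
def tryBounds : Prog :=
  forUpTo 10 nodeCount
    (block [setReg 12 (reg 10), setDReg 1 .zero, forUpTo 11 nodeCount tryPart])

/-- Replace the edge that has been found by the one from `reg 20` to `reg 21` if the latter is
shorter. -/
def compareEdge : Prog :=
  .ite (.conj (.conj (.ilt (.lit 0) (.get 2 (reg 20) (reg 21)))
        (.neg (.eq (entry 5 (reg 20)) (entry 5 (reg 21)))))
      (.or (.eq (reg 24) (.lit 0)) (.dlt (.get 0 (reg 20) (reg 21)) (.get 0 (reg 22) (reg 23)))))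
    (block [setReg 22 (reg 20), setReg 23 (reg 21), setReg 24 (.lit 1)]) .skip

/-- Find a shortest edge between two components. -/
def findEdge : Prog :=
  block [setReg 24 (.lit 0), forUpTo 20 (reg 0) (forUpTo 21 (reg 0) compareEdge)]

/-- Relabel the vertices of the component `reg 26` by `reg 25`. -/
def relabel : Prog :=
  forUpTo 20 (reg 0)
    (.ite (.eq (entry 5 (reg 20)) (reg 26)) (setEntry 5 (reg 20) (reg 25)) .skip)

/-- The address of the node `(1, v)`, where `v` is in `reg r`. -/
def nodeOne (r : ℕ) : IExp := .add (reg 0) (reg r)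

/-- The address of the node `(2, v)`, where `v` is in `reg r`. -/
def nodeTwo (r : ℕ) : IExp := .add (.add (reg 0) (reg 0)) (reg r)

/-- Splice two tours along the edge that has been found. -/
def spliceTours : Prog :=
  block [setEntry 7 (nodeOne 26) (reg 23),
    setEntry 7 (nodeTwo 26) (reg 22),
    setEntry 6 (nodeOne 26) (entry 6 (reg 23)),
    setEntry 6 (nodeTwo 26) (entry 6 (reg 22)),
    setEntry 6 (reg 22) (nodeOne 26),
    setEntry 6 (reg 23) (nodeTwo 26)]

/-- Join two components along the edge that has been found. -/
def mergeTours : Prog :=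
  block [setReg 25 (entry 5 (reg 22)), setReg 26 (entry 5 (reg 23)), relabel, spliceTours]

/-- Build the trivial tours, each of which consists of one node. -/
def initTours : Prog :=
  forUpTo 20 (reg 0)
    (block [setEntry 5 (reg 20) (reg 20),
      setEntry 6 (reg 20) (reg 20), setEntry 7 (reg 20) (reg 20),
      setEntry 6 (nodeOne 20) (nodeOne 20), setEntry 7 (nodeOne 20) (reg 20),
      setEntry 6 (nodeTwo 20) (nodeTwo 20), setEntry 7 (nodeTwo 20) (reg 20)])

/-- The algorithm: Kruskal's algorithm, with an attempt at every stage to cut the tours around the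
components into at most `m` paths. -/
def pathCoverProg : Prog :=
  block [initTours,
    forUpTo 9 (reg 0)
      (block [tryBounds, findEdge, .ite (.ilt (.lit 0) (reg 24)) mergeTours .skip])]

/-! ### Running the cutting of tours -/

/-- The memory holds the roadmap `R`, the number `m` of robots, and the tours that are given by
`comp`, `nxt` and `vert`. -/
structure Holds (R : Roadmap n) (m : ℕ) (comp : Fin n → Fin n) (nxt : Equiv.Perm (Node n))
    (vert : Node n → Fin n) (s : Store) : Prop where
  count : s.idx 0 0 0 = n
  robots : s.idx 1 0 0 = m
  adj (u v : Fin n) : 0 < s.idx 2 u v ↔ R.graph.Adj u v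
  len (u v : Fin n) : s.dat 0 u v = R.edgeLen u v
  comp (v : Fin n) : s.idx 5 0 v = comp v
  nxt (x : Node n) : s.idx 6 0 (finProdFinEquiv x) = finProdFinEquiv (nxt x)
  vert (x : Node n) : s.idx 7 0 (finProdFinEquiv x) = vert x

/-- The memory holds the segments `gs`. -/
structure Stored (gs : List (List (Fin n))) (s : Store) : Prop where
  count : s.idx 16 0 0 = gs.length
  length (i : ℕ) (hi : i < gs.length) : s.idx 17 i 0 = gs[i].length
  vertex (i : ℕ) (hi : i < gs.length) (j : ℕ) (hj : j < gs[i].length) : s.idx 18 i j = gs[i][j]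

section Cut

variable {R : Roadmap n} {comp : Fin n → Fin n} {nxt : Equiv.Perm (Node n)} {vert : Node n → Fin n}
  {N : ℕ} {s s' : Store} {gs : List (List (Fin n))} {B : ℝ} {r : Fin n}

theorem Holds.congr (h : Holds R m comp nxt vert s)
    (hi : ∀ a ∈ [0, 1, 2, 5, 6, 7], s'.idx a = s.idx a) (hd : s'.dat 0 = s.dat 0) :
    Holds R m comp nxt vert s' := by
  simp only [List.mem_cons, List.not_mem_nil, or_false, forall_eq_or_imp, forall_eq] at hi
  obtain ⟨h0, h1, h2, h5, h6, h7⟩ := hi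
  exact ⟨h0 ▸ h.count, h1 ▸ h.robots, h2 ▸ h.adj, hd ▸ h.len, h5 ▸ h.comp, h6 ▸ h.nxt, h7 ▸ h.vert⟩

theorem Holds.seti (h : Holds R m comp nxt vert s) {a : ℕ} (ha : a ∉ [0, 1, 2, 5, 6, 7])
    (i j x : ℕ) : Holds R m comp nxt vert (s.seti a i j x) :=
  h.congr (fun _ hb => s.idx_seti_of_ne (ne_of_mem_of_not_mem hb ha) i j x) rfl

theorem Stored.congr (h : Stored gs s) (hi : ∀ a ∈ [16, 17, 18], s'.idx a = s.idx a) :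
    Stored gs s' := by
  simp only [List.mem_cons, List.not_mem_nil, or_false, forall_eq_or_imp, forall_eq] at hi
  obtain ⟨h16, h17, h18⟩ := hi
  exact ⟨h16 ▸ h.count, h17 ▸ h.length, h18 ▸ h.vertex⟩

theorem Stored.seti (h : Stored gs s) {a : ℕ} (ha : a ∉ [16, 17, 18]) (i j x : ℕ) :
    Stored gs (s.seti a i j x) :=
  h.congr fun _ hb => s.idx_seti_of_ne (ne_of_mem_of_not_mem hb ha) i j x

theorem Stored.setd (h : Stored gs s) (a i j : ℕ) (x : ℝ) : Stored gs (s.setd a i j x) :=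
  h.congr fun _ _ => rfl

theorem runs_newSeg (h : Stored gs s) {e : IExp} {w : Fin n} (hw : e.eval s = w) :
    Runs N (newSeg e) s fun s' => Stored (gs ++ [[w]]) s' ∧ s'.dat 2 0 0 = 0 := by
  obtain ⟨hcount, hlength, hvertex⟩ := h
  simp only [newSeg, block, runs_seti_seq, runs_setd, IExp.eval, DExp.eval, Store.idx_seti, hcount,
    hw]
  refine ⟨⟨?_, ?_, ?_⟩, ?_⟩ <;> simp only [Store.idx_setd, Store.dat_setd] <;> grind

theorem runs_appendSeg {g : List (Fin n)} (h : Stored (gs ++ [g]) s) {e : IExp} {w : Fin n}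
    (hw : e.eval s = w) :
    Runs N (appendSeg e) s (Stored (gs ++ [g ++ [w]])) := by
  obtain ⟨hcount, hlength, hvertex⟩ := h
  simp only [appendSeg, block, runs_seti_seq, runs_seti, IExp.eval, Store.idx_seti, hcount, hw]
  constructor <;> grind

theorem runs_extendSeg {c : CutState n} {u v : Fin n} (h : Stored (gs ++ c.segs) s)
    (hB : s.dat 1 0 0 = B) (hcost : s.dat 2 0 0 = c.cost) (hu : curVertex.eval s = u)
    (hv : nextVertex.eval s = v) (huv : s.dat 0 u v = R.edgeLen u v) :
    Runs N extendSeg s fun s' =>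
      Stored (gs ++ (c.step R B u v).segs) s' ∧ s'.dat 2 0 0 = (c.step R B u v).cost := by
  have hstep : stepCost.eval s = R.edgeLen u v := by simp only [stepCost, DExp.eval, hu, hv, huv]
  refine Runs.ite (fun hlt => ?_) fun hle => ?_
  · simp only [Test.holds, DExp.eval, IExp.eval, hB, hcost, hstep] at hlt
    simpa only [CutState.step, if_pos hlt, CutState.segs, List.append_assoc] using runs_newSeg h hv
  · simp only [Test.holds, DExp.eval, IExp.eval, hB, hcost, hstep] at hle
    simp only [CutState.step, if_neg hle, CutState.segs, block, runs_setd_seq]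
    set s₁ := s.setd _ _ _ _
    have hcost₁ : s₁.dat 2 0 0 = c.cost + R.edgeLen u v := by
      simp [s₁, DExp.eval, IExp.eval, hcost, hstep]
    have h₁ : Stored (gs ++ (c.done ++ [c.last])) s₁ := h.setd _ _ _ _
    have hu₁ : curVertex.eval s₁ = u := hu
    have hv₁ : nextVertex.eval s₁ = v := hv
    refine Runs.ite (fun heq => ?_) fun hne => ?_
    · rw [Test.holds_eq, hu₁, hv₁, Fin.val_inj] at heq
      rw [runs_skip, if_pos heq]
      exact ⟨h₁, hcost₁⟩
    · rw [Test.holds_eq, hu₁, hv₁, Fin.val_inj] at hne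
      rw [← List.append_assoc] at h₁
      refine (runs_appendSeg h₁ hv₁).frame.mono fun s' ⟨hs', _, hdat⟩ => ?_
      rw [if_neg hne, ← List.append_assoc, hdat 2 (by decide)]
      exact ⟨hs', hcost₁⟩

/-- The state while the tour through the root `r` is being cut: the segments `gs` of previous tours
and those of `c` are stored, and `x` is the current node. -/
structure Cutting (R : Roadmap n) (m : ℕ) (comp : Fin n → Fin n) (nxt : Equiv.Perm (Node n))
    (vert : Node n → Fin n) (B : ℝ) (r : Fin n) (gs : List (List (Fin n))) (c : CutState n)
    (x : Node n) (s : Store) : Prop where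
  holds : Holds R m comp nxt vert s
  bound : s.dat 1 0 0 = B
  root : s.idx 13 0 0 = r
  node : s.idx 15 0 0 = finProdFinEquiv x
  stored : Stored (gs ++ c.segs) s
  cost : s.dat 2 0 0 = c.cost

theorem runs_cutStep {c : CutState n} {x : Node n}
    (h : Cutting R m comp nxt vert B r gs c x s) :
    Runs N cutStep s
      (Cutting R m comp nxt vert B r gs (c.step R B (vert x) (vert (nxt x))) (nxt x)) := by
  suffices hrun : Runs N cutStep s fun s' => s'.idx 15 0 0 = finProdFinEquiv (nxt x) ∧
      Stored (gs ++ (c.step R B (vert x) (vert (nxt x))).segs) s' ∧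
      s'.dat 2 0 0 = (c.step R B (vert x) (vert (nxt x))).cost by
    refine hrun.frame.mono fun s' ⟨⟨hnode, hstored, hcost⟩, hi, hd⟩ => ?_
    refine ⟨h.holds.congr (fun a ha => hi a (by decide +revert)) (hd 0 (by decide)), ?_, ?_,
      hnode, hstored, hcost⟩
    · rw [hd 1 (by decide), h.bound]
    · rw [hi 13 (by decide), h.root]
  simp only [cutStep, block, runs_seti_seq, IExp.eval, h.node, h.holds.nxt]
  set s₁ := s.seti _ _ _ _
  have hnode : s₁.idx 14 0 0 = finProdFinEquiv (nxt x) := by simp [s₁]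
  have hholds : Holds R m comp nxt vert s₁ := h.holds.seti (by decide) _ _ _
  have hcur : curVertex.eval s₁ = vert x := by
    have hnode₁ : s₁.idx 15 0 0 = finProdFinEquiv x := h.node
    simp only [curVertex, IExp.eval, hnode₁, hholds.vert]
  have hnext : nextVertex.eval s₁ = vert (nxt x) := by
    simp only [nextVertex, IExp.eval, hnode, hholds.vert]
  have hstored : Stored (gs ++ c.segs) s₁ := h.stored.seti (by decide) _ _ _
  refine Runs.seq
    ((runs_extendSeg hstored h.bound h.cost hcur hnext (hholds.len _ _)).frame.mono ?_)
  rintro s₂ ⟨⟨hstored₂, hcost₂⟩, hi, -⟩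
  refine runs_seti.2 ⟨?_, hstored₂.seti (by decide) _ _ _, hcost₂⟩
  simp [IExp.eval, hi 14 (by decide), hnode]

theorem Cutting.holds_neg_eq_root_iff {c : CutState n} {x : Node n}
    (h : Cutting R m comp nxt vert B r gs c x s) :
    (Test.neg (.eq (entry 6 (reg 15)) (reg 13))).holds s ↔ nxt x ≠ (0, r) := by
  have hr : s.idx 13 0 0 = finProdFinEquiv ((0, r) : Node n) := by simpa using h.root
  simp only [Test.holds, Test.holds_eq, IExp.eval, h.node, h.holds.nxt, hr, Fin.val_inj,
    EmbeddingLike.apply_eq_iff_eq, ne_eq]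

theorem runs_cutTour (hN : 3 * n ≤ N) (hT : vert (0, r) = r) (h : Holds R m comp nxt vert s)
    (hbound : s.dat 1 0 0 = B) (hroot : s.idx 13 0 0 = r) (hgs : Stored gs s) :
    Runs N cutTour s (Stored (gs ++ tourSegments R B nxt vert r)) := by
  set x : Node n := (0, r) with hx
  have hperiod := minimalPeriod_pos nxt x
  refine Runs.seq ((runs_newSeg (e := reg 13) hgs hroot).frame.mono ?_)
  rintro s₁ ⟨⟨hstored, hcost⟩, hi, hd⟩
  refine runs_seti_seq.2 (Runs.loop (fun k s => ∃ j, j + k + 1 = Function.minimalPeriod nxt x ∧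
    Cutting R m comp nxt vert B r gs (cut R B (visits nxt vert x) j) (nxt^[j] x) s)
    (k := Function.minimalPeriod nxt x - 1) ?_ ⟨0, by omega, ?_⟩ ?_ ?_)
  · exact (Nat.sub_le _ _).trans ((minimalPeriod_le nxt x).trans hN)
  · have hroot₁ : s₁.idx 13 0 0 = r := by rw [hi 13 (by decide), hroot]
    have hholds₁ := h.congr (fun a ha => hi a (by decide +revert)) (hd 0 (by decide))
    refine ⟨hholds₁.seti (by decide) _ _ _, ?_, ?_, ?_, ?_, ?_⟩
    · simp [hd 1 (by decide), hbound]
    · simp [hroot₁]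
    · simp [IExp.eval, hroot₁, hx]
    · simpa [cut, visits, CutState.segs, hT] using hstored.seti (by decide) _ _ _
    · simpa [cut] using hcost
  · rintro k s₂ ⟨j, hj, hs₂⟩ hb
    rw [hs₂.holds_neg_eq_root_iff] at hb
    have hk : k ≠ 0 := by
      rintro rfl
      rw [← Function.iterate_succ_apply' nxt, show j.succ = _ from hj] at hb
      exact hb Function.iterate_minimalPeriod
    refine ⟨by omega, (runs_cutStep hs₂).mono fun s₃ hs₃ => ⟨j + 1, by omega, ?_⟩⟩
    simpa only [cut, visits, Function.iterate_succ_apply'] using hs₃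
  · rintro k s₂ ⟨j, hj, hs₂⟩ hb
    rw [hs₂.holds_neg_eq_root_iff, not_not, ← Function.iterate_succ_apply' nxt] at hb
    have := Function.IsPeriodicPt.minimalPeriod_le j.succ_pos hb
    rw [tourSegments, show Function.minimalPeriod nxt x - 1 = j by omega]
    exact hs₂.stored

theorem runs_cutAll (hN : 3 * n ≤ N) (hT : ∀ v, vert (0, v) = v) (h : Holds R m comp nxt vert s)
    (hbound : s.dat 1 0 0 = B) :
    Runs N cutAll s (Stored (segments R B comp nxt vert)) := by
  refine runs_seti_seq.2 (Runs.forUpTo (K := n) (fun i s => Holds R m comp nxt vert s ∧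
    s.dat 1 0 0 = B ∧ Stored (((List.finRange n).take i).flatMap fun r =>
      if comp r = r then tourSegments R B nxt vert r else []) s)
    (by omega) (by decide) ?_ ?_ ?_ ?_ ?_)
  · refine ⟨h.seti (by decide) _ _ _, hbound, ?_, ?_, ?_⟩ <;> simp [IExp.eval]
  · rintro i s x ⟨hs, hB, hst⟩
    exact ⟨hs.seti (by decide) _ _ _, hB, hst.seti (by decide) _ _ _⟩
  · rintro i s ⟨hs, -⟩
    exact hs.count
  · rintro i s hi h13 ⟨hs, hB, hst⟩
    suffices hrun : Runs N (.ite (.eq (entry 5 (reg 13)) (reg 13)) cutTour .skip) s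
        (Stored (((List.finRange n).take (i + 1)).flatMap fun r =>
          if comp r = r then tourSegments R B nxt vert r else [])) by
      refine hrun.frame.mono fun s' ⟨hst', hi, hd⟩ =>
        ⟨hs.congr (fun a ha => hi a (by decide +revert)) (hd 0 (by decide)), ?_, hst'⟩
      rw [hd 1 (by decide), hB]
    have hroot : (Test.eq (entry 5 (reg 13)) (reg 13)).holds s ↔ comp ⟨i, hi⟩ = ⟨i, hi⟩ := by
      rw [Test.holds_eq, ← Fin.val_inj, ← hs.comp]
      simp [IExp.eval, h13]
    rw [List.take_succ_eq_append_getElem (by simpa), List.flatMap_append, List.flatMap_singleton,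
      List.getElem_finRange]
    refine Runs.ite (fun hb => ?_) fun hb => ?_ <;> rw [hroot] at hb
    · simpa [hb] using runs_cutTour hN (hT _) hs hB h13 hst
    · simpa [hb] using hst
  · rintro s ⟨-, -, hst⟩
    rwa [List.take_of_length_le (by simp)] at hst

end Cut

/-! ### Running the search for a bound -/

/-- Row `i` of the output is the vertex sequence `g`. -/
def Copied (g : List (Fin n)) (i : ℕ) (s : Store) : Prop :=
  s.idx 3 i 0 = g.length ∧ ∀ (j : ℕ) (hj : j < g.length), s.idx 4 i j = g[j]

theorem outputs_of_copied {s : Store} {p : Fin m → List (Fin n)} (h : ∀ i, Copied (p i) i s) :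
    Outputs s p := by
  intro i
  obtain ⟨hlength, hvertex⟩ := h i
  exact List.ext_getElem (by simp [hlength]) fun j hj _ => by
    simpa using (hvertex j (by simpa using hj)).symm

section Search

variable {R : Roadmap n} {F : List (Fin n × Fin n)} {comp : Fin n → Fin n}
  {nxt : Equiv.Perm (Node n)} {vert : Node n → Fin n} {N : ℕ} {s s' : Store}
  {gs : List (List (Fin n))} {B : ℝ} {S S' : Set ℝ}

theorem runs_copySeg (hst : Stored gs s) {i : ℕ} (hi : i < gs.length) (h20 : s.idx 20 0 0 = i)
    (hN : gs[i].length ≤ N) :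
    Runs N copySeg s fun s' => Copied gs[i] i s' ∧ ∀ k ≠ i, ∀ g : List (Fin n),
      Copied g k s → Copied g k s' := by
  refine runs_seti_seq.2 (Runs.forUpTo (fun j s' => Stored gs s' ∧ s'.idx 20 0 0 = i ∧
    s'.idx 3 i 0 = gs[i].length ∧ (∀ j' (h : j' < gs[i].length), j' < j → s'.idx 4 i j' = gs[i][j'])
      ∧ ∀ k ≠ i, ∀ g : List (Fin n), Copied g k s → Copied g k s') hN (by decide) ?_ ?_ ?_ ?_ ?_)
  · refine ⟨hst.seti (by decide) _ _ _, h20, ?_, by simp, fun k hk g hg => ?_⟩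
    · simp [IExp.eval, h20, hst.length i hi]
    · simpa [Copied, IExp.eval, h20, hk] using hg
  · rintro j s' x ⟨hst', h⟩
    exact ⟨hst'.seti (by decide) _ _ _, by simpa [Copied] using h⟩
  · rintro j s' ⟨hst', h20', -⟩
    simp [IExp.eval, h20', hst'.length i hi]
  · rintro j s' hj h21 ⟨hst', h20', hlength, hvertex, hrest⟩
    simp only [runs_seti, IExp.eval, h20', h21, hst'.vertex i hi j hj]
    refine ⟨hst'.seti (by decide) _ _ _, h20', hlength, by grind, fun k hk g hg => ?_⟩
    simpa [Copied, hk] using hrest k hk g hg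
  · rintro s' ⟨-, -, hlength, hvertex, hrest⟩
    exact ⟨⟨hlength, fun j hj => hvertex j hj hj⟩, hrest⟩

theorem runs_save (hm : m ≤ N) (hn : 0 < n) (hst : Stored gs s) (hgs : ∀ g ∈ gs, g.length ≤ N)
    (h1 : s.idx 1 0 0 = m) :
    Runs N save s fun s' => s'.idx 19 0 0 ≠ 0 ∧ s'.dat 3 0 0 = s.dat 1 0 0 ∧
      Outputs s' fun i : Fin m => gs[(i : ℕ)]?.getD [⟨0, hn⟩] := by
  simp only [save, block, runs_seti_seq, runs_setd_seq]
  refine (Runs.forUpTo (Q := fun s' => Outputs s' fun i : Fin m => gs[(i : ℕ)]?.getD [⟨0, hn⟩])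
    (fun i s' => Stored gs s' ∧ s'.idx 1 0 0 = m ∧ ∀ k < i, Copied (gs[k]?.getD [⟨0, hn⟩]) k s')
    hm (by decide) ?_ ?_ ?_ ?_ ?_).frame.mono ?_
  · exact ⟨(hst.seti (by decide) _ _ _).setd _ _ _ _, h1, by simp⟩
  · rintro i s' x ⟨hst', h1', hcopied⟩
    exact ⟨hst'.seti (by decide) _ _ _, h1', hcopied⟩
  · rintro i s' ⟨-, h1', -⟩
    exact h1'
  · rintro i s' hi h20 ⟨hst', h1', hcopied⟩
    refine Runs.ite (fun hb => ?_) fun hb => ?_ <;>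
      simp only [Test.holds, IExp.eval, h20, hst'.count] at hb
    · refine (runs_copySeg hst' hb h20 (hgs _ (List.getElem_mem hb))).frame.mono ?_
      rintro s'' ⟨⟨hcopied', hrest⟩, hframe, -⟩
      refine ⟨hst'.congr fun a ha => hframe a (by decide +revert), ?_, fun k hk => ?_⟩
      · rw [hframe 1 (by decide), h1']
      · obtain rfl | hne := eq_or_ne k i
        · simpa [hb] using hcopied'
        · exact hrest k hne _ (hcopied k (by omega))
    · simp only [runs_seti_seq, runs_seti, IExp.eval, Store.idx_seti, h20]
      refine ⟨(hst'.seti (by decide) _ _ _).seti (by decide) _ _ _, h1', fun k hk => ?_⟩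
      obtain rfl | hne := eq_or_ne k i
      · simp [Copied, List.getElem?_eq_none (not_lt.1 hb)]
      · simpa [Copied, hne] using hcopied k (by omega)
  · exact fun s' ⟨_, _, hcopied⟩ => outputs_of_copied fun i => hcopied i i.2
  · rintro s' ⟨hout, hi, hd⟩
    rw [hi 19 (by decide), hd 3 (by decide)]
    exact ⟨by simp [IExp.eval], by simp [DExp.eval, IExp.eval], hout⟩

/-- The state during the search for a bound: the output, if there is any, is a path cover by paths
of cost at most `dat 3`, and `S` consists of costs that the output does not exceed. -/
structure Search (R : Roadmap n) (m : ℕ) (comp : Fin n → Fin n) (nxt : Equiv.Perm (Node n))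
    (vert : Node n → Fin n) (S : Set ℝ) (s : Store) : Prop where
  holds : Holds R m comp nxt vert s
  output : s.idx 19 0 0 ≠ 0 → ∃ p : Fin m → List (Fin n), Outputs s p ∧ IsPathCover R p ∧
    ∀ i, pathCost R (p i) ≤ s.dat 3 0 0
  best : ∀ C ∈ S, s.idx 19 0 0 ≠ 0 ∧ s.dat 3 0 0 ≤ C

theorem Search.mono (h : Search R m comp nxt vert S s) (hS : S' ⊆ S) :
    Search R m comp nxt vert S' s :=
  ⟨h.holds, h.output, fun C hC => h.best C (hS hC)⟩

theorem Search.of_holds {comp' : Fin n → Fin n} {nxt' : Equiv.Perm (Node n)}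
    {vert' : Node n → Fin n} (h : Search R m comp nxt vert S s)
    (hs' : Holds R m comp' nxt' vert' s') (hi : ∀ a ∈ [3, 4, 19], s'.idx a = s.idx a)
    (hd : s'.dat 3 = s.dat 3) : Search R m comp' nxt' vert' S s' := by
  refine ⟨hs', ?_, ?_⟩
  · simpa only [Outputs, hi 3 (by decide), hi 4 (by decide), hi 19 (by decide), hd] using h.output
  · simpa only [hi 19 (by decide), hd] using h.best

theorem Search.congr (h : Search R m comp nxt vert S s)
    (hi : ∀ a ∈ [0, 1, 2, 3, 4, 5, 6, 7, 19], s'.idx a = s.idx a)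
    (hd : ∀ a ∈ [0, 3], s'.dat a = s.dat a) : Search R m comp nxt vert S s' :=
  h.of_holds (h.holds.congr (fun a ha => hi a (by decide +revert)) (hd 0 (by decide)))
    (fun a ha => hi a (by decide +revert)) (hd 3 (by decide))

theorem Search.seti (h : Search R m comp nxt vert S s) {a : ℕ}
    (ha : a ∉ [0, 1, 2, 3, 4, 5, 6, 7, 19]) (i j x : ℕ) :
    Search R m comp nxt vert S (s.seti a i j x) :=
  h.congr (fun _ hb => s.idx_seti_of_ne (ne_of_mem_of_not_mem hb ha) i j x) fun _ _ => rfl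

theorem Search.setd (h : Search R m comp nxt vert S s) {a : ℕ} (ha : a ∉ [0, 3]) (i j : ℕ)
    (x : ℝ) : Search R m comp nxt vert S (s.setd a i j x) :=
  h.congr (fun _ _ => rfl) fun _ hb => s.dat_setd_of_ne (ne_of_mem_of_not_mem hb ha) i j x

theorem mem_or_getD_getElem?_eq {α : Type*} (l : List α) (i : ℕ) (a : α) :
    l[i]?.getD a ∈ l ∨ l[i]?.getD a = a := by
  cases h : l[i]? with
  | none => exact Or.inr rfl
  | some b => exact Or.inl (List.mem_of_getElem? h)

theorem isPathCover_getD (hpath : ∀ g ∈ gs, IsPath R g) (hcover : ∀ v, ∃ g ∈ gs, v ∈ g)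
    (hlen : gs.length ≤ m) (v₀ : Fin n) :
    IsPathCover R fun i : Fin m => gs[(i : ℕ)]?.getD [v₀] := by
  refine ⟨fun i => ?_, fun v => ?_⟩
  · obtain hi | hi := mem_or_getD_getElem?_eq gs i [v₀]
    · exact hpath _ hi
    · simp [hi, IsPath]
  · obtain ⟨g, hg, hv⟩ := hcover v
    obtain ⟨i, hi, rfl⟩ := List.getElem_of_mem hg
    exact ⟨⟨i, hi.trans_le hlen⟩, by simpa [hi] using hv⟩

/-- The algorithm accepts the bound `B` if the tours are cut into at most `m` segments. -/
def Accepts (R : Roadmap n) (m : ℕ) (comp : Fin n → Fin n) (nxt : Equiv.Perm (Node n))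
    (vert : Node n → Fin n) (B : ℝ) : Prop :=
  (segments R B comp nxt vert).length ≤ m

theorem runs_save_segments (hN : 3 * n ≤ N) (hm : m ≤ N) (hn : 0 < n) (hK : Kruskal R F comp)
    (hT : Tours F comp nxt vert) (h : Search R m comp nxt vert S s) (hB : 0 ≤ B)
    (hbound : s.dat 1 0 0 = B) (hst : Stored (segments R B comp nxt vert) s)
    (haccepts : Accepts R m comp nxt vert B) (hbetter : s.idx 19 0 0 = 0 ∨ B < s.dat 3 0 0) :
    Runs N save s (Search R m comp nxt vert (insert B S)) := by
  refine (runs_save hm hn hst (fun g hg => (length_le_of_mem_segments hg).trans hN)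
    h.holds.robots).frame.mono fun s' ⟨⟨hflag, hbest, hout⟩, hi, hd⟩ => ?_
  rw [hbound] at hbest
  have hgs {g : List (Fin n)} (hg : g ∈ segments R B comp nxt vert) :=
    isPath_and_pathCost_le_of_mem_segments hB hT hK.adj_of_mem hg
  refine ⟨h.holds.congr (fun a ha => hi a (by decide +revert)) (hd 0 (by decide)), fun _ =>
    ⟨_, hout, isPathCover_getD (fun g hg => (hgs hg).1) (exists_mem_segments hT hK.comp_comp)
      haccepts _, fun i => ?_⟩, fun C hC => ⟨hflag, ?_⟩⟩
  · rw [hbest]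
    obtain hi | hi := mem_or_getD_getElem?_eq (segments R B comp nxt vert) i [⟨0, hn⟩]
    · exact (hgs hi).2
    · rwa [hi]
  · rw [hbest]
    obtain rfl | hC := hC
    · exact le_rfl
    · obtain ⟨hflag₀, hle⟩ := h.best C hC
      exact (hbetter.resolve_left hflag₀).le.trans hle

theorem runs_tryBound (hN : 3 * n ≤ N) (hm : m ≤ N) (hn : 0 < n) (hK : Kruskal R F comp)
    (hT : Tours F comp nxt vert) (h : Search R m comp nxt vert S s) (hB : 0 ≤ B)
    (hbound : s.dat 1 0 0 = B) :
    Runs N tryBound s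
      (Search R m comp nxt vert (S ∪ {C | C = B ∧ Accepts R m comp nxt vert B})) := by
  refine Runs.seq ((runs_cutAll hN hT.vert_base h.holds hbound).frame.mono ?_)
  rintro s₁ ⟨hst, hi, hd⟩
  have h₁ : Search R m comp nxt vert S s₁ :=
    h.congr (fun a ha => hi a (by decide +revert)) fun a ha => hd a (by decide +revert)
  have hbound₁ : s₁.dat 1 0 0 = B := by rw [hd 1 (by decide), hbound]
  refine Runs.ite (fun hb => ?_) fun hb => ?_ <;>
    simp only [Test.holds, Test.holds_or, Test.holds_eq, IExp.eval, DExp.eval, h₁.holds.robots,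
      hst.count, hbound₁, not_lt] at hb
  · refine (runs_save_segments hN hm hn hK hT h₁ hB hbound₁ hst hb.1 hb.2).mono fun s₂ h₂ =>
      h₂.mono ?_
    rintro C (hC | ⟨rfl, -⟩)
    exacts [Or.inr hC, Or.inl rfl]
  · refine runs_skip.2 ⟨h₁.holds, h₁.output, ?_⟩
    rintro C (hC | ⟨rfl, haccepts⟩)
    · exact h₁.best C hC
    · rw [not_and, not_or, not_lt] at hb
      exact hb haccepts

/-- The bounds that are accepted among the costs of the parts of tours in `D`, where a part is given
by its first node and the number of its steps. -/
def acceptedBounds (R : Roadmap n) (m : ℕ) (comp : Fin n → Fin n) (nxt : Equiv.Perm (Node n))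
    (vert : Node n → Fin n) (D : Set (Node n × ℕ)) : Set ℝ :=
  {C | Accepts R m comp nxt vert C ∧ ∃ x ∈ D, C = seqCost R (visits nxt vert x.1) x.2}

theorem runs_tryPart (hN : 3 * n ≤ N) (hm : m ≤ N) (hn : 0 < n) (hK : Kruskal R F comp)
    (hT : Tours F comp nxt vert) {D : Set (Node n × ℕ)} {x : Node n} {j : ℕ}
    (h : Search R m comp nxt vert (S ∪ acceptedBounds R m comp nxt vert D) s)
    (hnode : s.idx 12 0 0 = finProdFinEquiv (nxt^[j] x))
    (hbound : s.dat 1 0 0 = seqCost R (visits nxt vert x) j) :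
    Runs N tryPart s fun s' =>
      Search R m comp nxt vert (S ∪ acceptedBounds R m comp nxt vert (insert (x, j) D)) s' ∧
      s'.idx 12 0 0 = finProdFinEquiv (nxt^[j + 1] x) ∧
      s'.dat 1 0 0 = seqCost R (visits nxt vert x) (j + 1) := by
  refine Runs.seq ((runs_tryBound hN hm hn hK hT h (seqCost_nonneg _ _ _) hbound).frame.mono ?_)
  rintro s₁ ⟨h₁, hi, hd⟩
  have hnode₁ : s₁.idx 12 0 0 = finProdFinEquiv (nxt^[j] x) := by rw [hi 12 (by decide), hnode]
  have hbound₁ : s₁.dat 1 0 0 = seqCost R (visits nxt vert x) j := by rw [hd 1 (by decide), hbound]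
  simp only [block, runs_setd_seq, runs_seti]
  refine ⟨((h₁.mono ?_).setd (by decide) _ _ _).seti (by decide) _ _ _, ?_, ?_⟩
  · rintro C (hC | ⟨haccepts, y, rfl | hy, rfl⟩)
    exacts [Or.inl (Or.inl hC), Or.inr ⟨rfl, haccepts⟩, Or.inl (Or.inr ⟨haccepts, y, hy, rfl⟩)]
  · simp [-finProdFinEquiv_apply_val, IExp.eval, hnode₁, h₁.holds.nxt,
      Function.iterate_succ_apply']
  · simp [-finProdFinEquiv_apply_val, IExp.eval, DExp.eval, hnode₁, hbound₁, h₁.holds.nxt,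
      h₁.holds.vert, h₁.holds.len, seqCost_succ, visits, Function.iterate_succ_apply']

theorem Holds.eval_nodeCount (h : Holds R m comp nxt vert s) : nodeCount.eval s = 3 * n := by
  simp only [nodeCount, IExp.eval, h.count]
  ring

theorem acceptedBounds_mono {D D' : Set (Node n × ℕ)} (hD : D ⊆ D') :
    acceptedBounds R m comp nxt vert D ⊆ acceptedBounds R m comp nxt vert D' :=
  fun _ ⟨haccepts, x, hx, hC⟩ => ⟨haccepts, x, hD hx, hC⟩

theorem runs_tryParts (hN : 3 * n ≤ N) (hm : m ≤ N) (hn : 0 < n) (hK : Kruskal R F comp)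
    (hT : Tours F comp nxt vert) {D : Set (Node n × ℕ)} {x : Node n}
    (h : Search R m comp nxt vert (S ∪ acceptedBounds R m comp nxt vert D) s)
    (hnode : s.idx 12 0 0 = finProdFinEquiv x) (hbound : s.dat 1 0 0 = 0) :
    Runs N (forUpTo 11 nodeCount tryPart) s (Search R m comp nxt vert
      (S ∪ acceptedBounds R m comp nxt vert (D ∪ {y | y.1 = x ∧ y.2 < 3 * n}))) := by
  refine Runs.forUpTo (K := 3 * n) (fun j s' => Search R m comp nxt vert (S ∪ acceptedBounds R m
    comp nxt vert (D ∪ {y | y.1 = x ∧ y.2 < j})) s' ∧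
      s'.idx 12 0 0 = finProdFinEquiv (nxt^[j] x) ∧
      s'.dat 1 0 0 = seqCost R (visits nxt vert x) j) hN (by decide) ?_ ?_
    (fun j s' h' => h'.1.holds.eval_nodeCount) ?_ fun s' h' => h'.1
  · exact ⟨by simpa using h, hnode, by simpa [seqCost] using hbound⟩
  · exact fun j s' y ⟨h', h''⟩ => ⟨h'.seti (by decide) _ _ _, h''⟩
  · rintro j s₁ - - ⟨h₁, hnode₁, hbound₁⟩
    refine (runs_tryPart hN hm hn hK hT h₁ hnode₁ hbound₁).mono fun s₂ ⟨h₂, h₂'⟩ =>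
      ⟨h₂.mono (Set.union_subset_union_right S (acceptedBounds_mono ?_)), h₂'⟩
    rintro ⟨y, k⟩ (hy | ⟨rfl, hk⟩)
    · exact Or.inr (Or.inl hy)
    · grind

theorem runs_tryBounds (hN : 3 * n ≤ N) (hm : m ≤ N) (hn : 0 < n) (hK : Kruskal R F comp)
    (hT : Tours F comp nxt vert) (h : Search R m comp nxt vert S s) :
    Runs N tryBounds s (Search R m comp nxt vert
      (S ∪ acceptedBounds R m comp nxt vert {x | x.2 < 3 * n})) := by
  refine Runs.forUpTo (K := 3 * n) (fun i => Search R m comp nxt vert (S ∪ acceptedBounds R m comp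
    nxt vert {x | (finProdFinEquiv x.1 : ℕ) < i ∧ x.2 < 3 * n})) hN (by decide)
    (h.mono ?_) (fun i s' x h' => h'.seti (by decide) _ _ _)
    (fun i s' h' => h'.holds.eval_nodeCount) ?_ fun s' h' => h'.mono
      (Set.union_subset_union_right S (acceptedBounds_mono fun x hx =>
        ⟨(finProdFinEquiv x.1).2, hx⟩))
  · simp [acceptedBounds]
  · rintro i s₁ hi h10 h₁
    obtain ⟨x, hx⟩ := finProdFinEquiv.surjective (⟨i, hi⟩ : Fin (3 * n))
    obtain rfl : (finProdFinEquiv x : ℕ) = i := by rw [hx]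
    simp only [block, runs_seti_seq, runs_setd_seq]
    refine (runs_tryParts (x := x) hN hm hn hK hT
      ((h₁.seti (by decide) _ _ _).setd (by decide) _ _ _) ?_ ?_).mono fun s₂ h₂ =>
        h₂.mono (Set.union_subset_union_right S (acceptedBounds_mono fun y hy => ?_))
    · simp [IExp.eval, h10]
    · simp [IExp.eval, DExp.eval]
    · obtain hlt | heq := (Nat.lt_succ_iff.1 hy.1).lt_or_eq
      · exact Or.inl ⟨hlt, hy.2⟩
      · exact Or.inr ⟨finProdFinEquiv.injective (Fin.ext heq), hy.2⟩

end Search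

/-! ### Running the joining of components -/

section Merge

variable {R : Roadmap n} {F : List (Fin n × Fin n)} {comp : Fin n → Fin n}
  {nxt : Equiv.Perm (Node n)} {vert : Node n → Fin n} {N : ℕ} {s s' : Store} {a b : Fin n}
  {D D' : Set (Fin n × Fin n)}

/-- The edges between different components. -/
def crossEdges (R : Roadmap n) (comp : Fin n → Fin n) : Set (Fin n × Fin n) :=
  {e | R.graph.Adj e.1 e.2 ∧ comp e.1 ≠ comp e.2}

/-- The state during the search for a shortest edge between different components, after the pairs
in `D` have been examined. -/
def EdgeFound (R : Roadmap n) (comp : Fin n → Fin n) (D : Set (Fin n × Fin n)) (s : Store) : Prop :=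
  (s.idx 24 0 0 = 0 ∧ ∀ e ∈ D, e ∉ crossEdges R comp) ∨
  (s.idx 24 0 0 ≠ 0 ∧ ∃ a b : Fin n, s.idx 22 0 0 = a ∧ s.idx 23 0 0 = b ∧
    (a, b) ∈ crossEdges R comp ∧ ∀ e ∈ D, e ∈ crossEdges R comp → R.len a b ≤ R.len e.1 e.2)

theorem EdgeFound.mono (h : EdgeFound R comp D s) (hD : D' ⊆ D) : EdgeFound R comp D' s :=
  h.imp (fun ⟨hflag, hnone⟩ => ⟨hflag, fun e he => hnone e (hD he)⟩)
    fun ⟨hflag, a, b, ha, hb, hab, hmin⟩ => ⟨hflag, a, b, ha, hb, hab, fun e he => hmin e (hD he)⟩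

theorem EdgeFound.seti (h : EdgeFound R comp D s) {r : ℕ} (hr : r ∉ [22, 23, 24]) (i j x : ℕ) :
    EdgeFound R comp D (s.seti r i j x) := by
  simp only [List.mem_cons, List.not_mem_nil, or_false, not_or] at hr
  simpa only [EdgeFound, s.idx_seti_of_ne (Ne.symm hr.1), s.idx_seti_of_ne (Ne.symm hr.2.1),
    s.idx_seti_of_ne (Ne.symm hr.2.2)] using h

theorem runs_compareEdge {u v : Fin n} (h : Holds R m comp nxt vert s) (hD : EdgeFound R comp D s)
    (hu : s.idx 20 0 0 = u) (hv : s.idx 21 0 0 = v) :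
    Runs N compareEdge s (EdgeFound R comp (insert (u, v) D)) := by
  refine Runs.ite (fun hb => ?_) fun hb => ?_ <;>
    simp only [Test.holds, Test.holds_or, Test.holds_eq, IExp.eval, DExp.eval, hu, hv, h.adj,
      h.comp, h.len, Fin.val_inj] at hb
  · obtain ⟨huv, hshorter⟩ := hb
    simp only [block, runs_seti_seq, runs_seti]
    refine Or.inr ⟨by simp [IExp.eval], u, v, by simp [IExp.eval, hu], by simp [IExp.eval, hv],
      huv, ?_⟩
    rintro e (rfl | he) hcross
    · exact le_rfl
    obtain ⟨-, hnone⟩ | ⟨hflag, a, b, ha, hb, hab, hmin⟩ := hD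
    · exact absurd hcross (hnone e he)
    · have hlt := hshorter.resolve_left hflag
      rw [ha, hb, h.len, R.edgeLen_of_adj huv.1, R.edgeLen_of_adj hab.1] at hlt
      exact hlt.le.trans (hmin e he hcross)
  · rw [runs_skip]
    obtain ⟨hflag, hnone⟩ | ⟨hflag, a, b, ha, hb', hab, hmin⟩ := hD
    · refine Or.inl ⟨hflag, ?_⟩
      rintro e (rfl | he) hcross
      exacts [hb ⟨hcross, Or.inl hflag⟩, hnone e he hcross]
    · refine Or.inr ⟨hflag, a, b, ha, hb', hab, ?_⟩
      rintro e (rfl | he) hcross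
      · by_contra! hlt
        refine hb ⟨hcross, Or.inr ?_⟩
        rwa [ha, hb', h.len, R.edgeLen_of_adj hcross.1, R.edgeLen_of_adj hab.1]
      · exact hmin e he hcross

theorem runs_compareEdges {u : Fin n} (hN : n ≤ N) (h : Holds R m comp nxt vert s)
    (hD : EdgeFound R comp D s) (hu : s.idx 20 0 0 = u) :
    Runs N (forUpTo 21 (reg 0) compareEdge) s fun s' =>
      Holds R m comp nxt vert s' ∧ EdgeFound R comp (D ∪ {e | e.1 = u}) s' := by
  refine Runs.forUpTo (K := n) (fun j s' => Holds R m comp nxt vert s' ∧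
    EdgeFound R comp (D ∪ {e | e.1 = u ∧ (e.2 : ℕ) < j}) s' ∧ s'.idx 20 0 0 = u) hN (by decide)
    ⟨h, by simpa using hD, hu⟩ ?_ (fun j s' h' => h'.1.count) ?_ ?_
  · exact fun j s' x ⟨h', hD', hu'⟩ =>
      ⟨h'.seti (by decide) _ _ _, hD'.seti (by decide) _ _ _, hu'⟩
  · rintro j s' hj hv ⟨h', hD', hu'⟩
    refine (runs_compareEdge (v := ⟨j, hj⟩) h' hD' hu' hv).frame.mono fun s'' ⟨hD'', hi, hd⟩ =>
      ⟨h'.congr (fun a ha => hi a (by decide +revert)) (hd 0 (by decide)), hD''.mono ?_, ?_⟩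
    · grind
    · rw [hi 20 (by decide), hu']
  · exact fun s' ⟨h', hD', _⟩ => ⟨h', hD'.mono (by simp)⟩

theorem runs_findEdge (hN : n ≤ N) (h : Holds R m comp nxt vert s) :
    Runs N findEdge s (EdgeFound R comp Set.univ) := by
  refine runs_seti_seq.2 (Runs.forUpTo (K := n) (fun i s' => Holds R m comp nxt vert s' ∧
    EdgeFound R comp {e | (e.1 : ℕ) < i} s') hN (by decide)
    ⟨h.seti (by decide) _ _ _, Or.inl ⟨by simp [IExp.eval], by simp⟩⟩ ?_
    (fun i s' h' => h'.1.count) ?_ fun s' h' => h'.2.mono (by simp))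
  · exact fun i s' x ⟨h', hD'⟩ => ⟨h'.seti (by decide) _ _ _, hD'.seti (by decide) _ _ _⟩
  · rintro i s' hi hu ⟨h', hD'⟩
    refine (runs_compareEdges (u := ⟨i, hi⟩) hN h' hD' hu).mono fun s'' ⟨h'', hD''⟩ =>
      ⟨h'', hD''.mono ?_⟩
    grind

theorem runs_relabel (hN : n ≤ N) (hcount : s.idx 0 0 0 = n)
    (hcomp : ∀ v : Fin n, s.idx 5 0 v = comp v) (ha : s.idx 25 0 0 = comp a)
    (hb : s.idx 26 0 0 = comp b) :
    Runs N relabel s fun s' => ∀ v : Fin n, s'.idx 5 0 v = mergeLabel comp a b v := by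
  refine Runs.forUpTo (K := n) (fun i s' => s'.idx 0 0 0 = n ∧ s'.idx 25 0 0 = comp a ∧
    s'.idx 26 0 0 = comp b ∧ ∀ v : Fin n, s'.idx 5 0 v =
      if (v : ℕ) < i then mergeLabel comp a b v else comp v) hN (by decide)
    ⟨hcount, ha, hb, by simpa using hcomp⟩ (by simp) (fun i s' h' => h'.1) ?_
    fun s' ⟨_, _, _, hcomp'⟩ v => by simpa using hcomp' v
  rintro i s' hi h20 ⟨hcount', ha', hb', hcomp'⟩
  have hi' : s'.idx 5 0 i = comp ⟨i, hi⟩ := by simpa using hcomp' ⟨i, hi⟩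
  have hstep {v : Fin n} (hv : v ≠ ⟨i, hi⟩) : (v : ℕ) < i + 1 ↔ (v : ℕ) < i := by
    have hvi : (v : ℕ) ≠ i := Fin.val_ne_of_ne hv
    omega
  refine Runs.ite (fun heq => ?_) fun hne => ?_
  · simp only [Test.holds_eq, IExp.eval, h20, hi', hb', Fin.val_inj] at heq
    simp only [runs_seti, IExp.eval, h20, ha']
    refine ⟨hcount', ha', hb', fun v => ?_⟩
    obtain rfl | hv := eq_or_ne v ⟨i, hi⟩
    · simp [mergeLabel, heq]
    · simpa only [Store.idx_seti, hstep hv, Fin.val_ne_of_ne hv, and_false, if_false] using hcomp' v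
  · simp only [Test.holds_eq, IExp.eval, h20, hi', hb', Fin.val_inj] at hne
    refine runs_skip.2 ⟨hcount', ha', hb', fun v => ?_⟩
    obtain rfl | hv := eq_or_ne v ⟨i, hi⟩
    · simp [mergeLabel, hne, hi']
    · simpa only [hstep hv] using hcomp' v

theorem val_node_zero (v : Fin n) : (finProdFinEquiv ((0, v) : Node n) : ℕ) = v := by simp

theorem val_node_one (v : Fin n) : (finProdFinEquiv ((1, v) : Node n) : ℕ) = n + v := by
  simp [add_comm]

theorem val_node_two (v : Fin n) : (finProdFinEquiv ((2, v) : Node n) : ℕ) = n + n + v := by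
  simp [add_comm, mul_two]

theorem runs_spliceTours (h : Holds R m (mergeLabel comp a b) nxt vert s)
    (hT : Tours F comp nxt vert) (hcomp : ∀ v, comp (comp v) = comp v) (hab : a ≠ b)
    (ha : s.idx 22 0 0 = a) (hb : s.idx 23 0 0 = b) (hr : s.idx 26 0 0 = comp b) :
    Runs N spliceTours s
      (Holds R m (mergeLabel comp a b) (mergeNxt comp nxt a b) (mergeVert comp vert a b)) := by
  obtain ⟨hcount, hrobots, hadj, hlen, hcomp', hnxt, hvert⟩ := h
  simp only [spliceTours, nodeOne, nodeTwo, block, runs_seti_seq, runs_seti, IExp.eval,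
    Store.idx_seti, hcount, ha, hb, hr]
  refine ⟨hcount, hrobots, hadj, hlen, hcomp', fun x => ?_, fun x => ?_⟩
  · simp only [Store.idx_seti, ← val_node_zero a, ← val_node_zero b, ← val_node_one,
      ← val_node_two, Fin.val_inj, hnxt,
      EmbeddingLike.apply_eq_iff_eq, Nat.reduceEqDiff, false_and, true_and, if_false, Prod.mk.injEq,
      zero_ne_one, ← apply_ite Fin.val, ← apply_ite finProdFinEquiv, hT.mergeNxt_apply hcomp hab]
    grind
  · simp only [Store.idx_seti, ← val_node_one, ← val_node_two, Fin.val_inj, hvert,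
      EmbeddingLike.apply_eq_iff_eq, Nat.reduceEqDiff, false_and, true_and, if_false,
      ← apply_ite Fin.val, mergeVert, Function.update_apply]

theorem runs_mergeTours (hN : n ≤ N) (h : Holds R m comp nxt vert s) (hT : Tours F comp nxt vert)
    (hcomp : ∀ v, comp (comp v) = comp v) (hab : a ≠ b) (ha : s.idx 22 0 0 = a)
    (hb : s.idx 23 0 0 = b) :
    Runs N mergeTours s
      (Holds R m (mergeLabel comp a b) (mergeNxt comp nxt a b) (mergeVert comp vert a b)) := by
  simp only [mergeTours, block, runs_seti_seq]
  have h' := (h.seti (a := 25) (by decide) 0 0 (comp a)).seti (a := 26) (by decide) 0 0 (comp b)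
  simp only [IExp.eval, ha, hb, h.comp, Store.idx_seti_of_ne, ne_eq, Nat.reduceEqDiff,
    not_false_eq_true]
  refine Runs.seq ((runs_relabel (a := a) (b := b) hN h'.count h'.comp (by simp)
    (by simp)).frame.mono fun s' ⟨hlabel, hi, hd⟩ => ?_)
  have hregs : s'.idx 22 0 0 = a ∧ s'.idx 23 0 0 = b ∧ s'.idx 26 0 0 = comp b := by
    simp [hi 22 (by decide), hi 23 (by decide), hi 26 (by decide), ha, hb]
  exact runs_spliceTours ⟨hi 0 (by decide) ▸ h'.count, hi 1 (by decide) ▸ h'.robots,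
    hi 2 (by decide) ▸ h'.adj, hd 0 (by decide) ▸ h'.len, hlabel, hi 6 (by decide) ▸ h'.nxt,
    hi 7 (by decide) ▸ h'.vert⟩ hT hcomp hab hregs.1 hregs.2.1 hregs.2.2

end Merge

/-! ### The stages of the algorithm -/

section Init

variable {R : Roadmap n} {N : ℕ}

theorem runs_initTours (hN : n ≤ N) :
    Runs N initTours (input R m) (Holds R m id 1 Prod.snd) := by
  suffices hrun : Runs N initTours (input R m) fun s' => (∀ v : Fin n, s'.idx 5 0 v = v) ∧
      ∀ x : Node n, s'.idx 6 0 (finProdFinEquiv x) = finProdFinEquiv x ∧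
        s'.idx 7 0 (finProdFinEquiv x) = x.2 by
    refine hrun.frame.mono fun s' ⟨⟨hcomp, hnode⟩, hi, hd⟩ => ⟨?_, ?_, ?_, ?_, hcomp,
      fun x => (hnode x).1, fun x => (hnode x).2⟩
    · simp [hi 0 (by decide), input]
    · simp [hi 1 (by decide), input]
    · intro u v
      by_cases huv : R.graph.Adj u v <;> simp [hi 2 (by decide), input, huv]
    · intro u v
      by_cases huv : R.graph.Adj u v <;> simp [hd 0 (by decide), input, Roadmap.edgeLen, huv]
  refine Runs.forUpTo (K := n) (fun i s' => s'.idx 0 0 0 = n ∧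
    (∀ v : Fin n, (v : ℕ) < i → s'.idx 5 0 v = v) ∧ ∀ x : Node n, (x.2 : ℕ) < i →
      s'.idx 6 0 (finProdFinEquiv x) = finProdFinEquiv x ∧
      s'.idx 7 0 (finProdFinEquiv x) = x.2) hN (by decide)
    (by simp [input]) (by simp) (fun i s' h' => h'.1) ?_ (by simp)
  rintro i s' hi h20 ⟨hcount, hcomp, hnode⟩
  lift i to Fin n using hi with u
  simp only [nodeOne, nodeTwo, block, runs_seti_seq, runs_seti, IExp.eval, Store.idx_seti, hcount,
    h20]
  simp only [Nat.reduceEqDiff, false_and, if_false, true_and, ← val_node_one, ← val_node_two]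
  refine ⟨fun v hv => by grind, fun x hx => ?_⟩
  rw [← val_node_zero u]
  simp only [Fin.val_inj, EmbeddingLike.apply_eq_iff_eq]
  obtain hxu | hxu := eq_or_ne x.2 u
  · obtain ⟨k, v⟩ := x
    obtain rfl : v = u := hxu
    fin_cases k <;> simp
  · grind

end Init

section Round

variable {R : Roadmap n} {F : List (Fin n × Fin n)} {comp : Fin n → Fin n}
  {nxt : Equiv.Perm (Node n)} {vert : Node n → Fin n} {N t : ℕ} {s : Store} {a b : Fin n}
  {p : Fin m → List (Fin n)}

theorem coverCost_pos (hp : IsPathCover R p) (hmn : m < n) : 0 < coverCost R p := by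
  by_contra! hle
  have hsingleton (i : Fin m) : ∃ v, p i = [v] :=
    (hp.1 i).eq_singleton_or_cost_pos.resolve_right
      (((le_coverCost R p i).trans hle).not_gt)
  choose path hpath using hp.2
  have hinj : Function.Injective path := fun u v huv => by
    obtain ⟨w, hw⟩ := hsingleton (path u)
    have hu : u = w := by simpa [hw] using hpath u
    have hv : v = w := by simpa [← huv, hw] using hpath v
    rw [hu, hv]
  simpa [hmn.not_ge] using Fintype.card_le_of_injective path hinj

theorem exists_acceptedBound_le (hmn : m < n) (hK : Kruskal R F comp) (hT : Tours F comp nxt vert)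
    (hp : IsPathCover R p) (hF : ∀ e ∈ F, R.len e.1 e.2 ≤ coverCost R p)
    (hcross : ∀ e ∈ crossEdges R comp, coverCost R p < R.len e.1 e.2) :
    ∃ C ∈ acceptedBounds R m comp nxt vert {x | x.2 < 3 * n}, C ≤ 4 * coverCost R p := by
  have hpos : 0 < coverCost R p := coverCost_pos hp hmn
  obtain ⟨x, j, hj, hle, hB⟩ := exists_partsLE R (by lia) nxt vert (C := 4 * coverCost R p)
    (by positivity)
  exact ⟨_, ⟨length_segments_le hK hT hF (fun u v huv hne => hcross (u, v) ⟨huv, hne⟩) hp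
    (le_coverCost R p) hpos hB, (x, j), hj, rfl⟩, hle⟩

/-- The costs that the output does not exceed after `t` stages with the forest `F`: four times the
cost of each path cover, if an edge of `F` is longer than this cost or a stage has added no edge. -/
def settledCosts (R : Roadmap n) (m : ℕ) (F : List (Fin n × Fin n)) (t : ℕ) : Set ℝ :=
  {C | ∃ p : Fin m → List (Fin n), IsPathCover R p ∧ C = 4 * coverCost R p ∧
    ¬ (F.length = t ∧ ∀ e ∈ F, R.len e.1 e.2 ≤ coverCost R p)}

theorem exists_settled_or_accepted_le (hmn : m < n) (hK : Kruskal R F comp)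
    (hT : Tours F comp nxt vert) (hp : IsPathCover R p)
    (hcross : F.length = t → (∀ e ∈ F, R.len e.1 e.2 ≤ coverCost R p) →
      ∀ e ∈ crossEdges R comp, coverCost R p < R.len e.1 e.2) :
    ∃ C ∈ settledCosts R m F t ∪ acceptedBounds R m comp nxt vert {x | x.2 < 3 * n},
      C ≤ 4 * coverCost R p := by
  by_cases h : F.length = t ∧ ∀ e ∈ F, R.len e.1 e.2 ≤ coverCost R p
  · obtain ⟨C, hC, hle⟩ := exists_acceptedBound_le hmn hK hT hp h.2 (hcross h.1 h.2)
    exact ⟨C, Or.inr hC, hle⟩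
  · exact ⟨_, Or.inl ⟨p, hp, rfl, h⟩, le_rfl⟩

theorem Search.of_exists_le {S S' : Set ℝ} (h : Search R m comp nxt vert S s)
    (hS : ∀ C ∈ S', ∃ C' ∈ S, C' ≤ C) : Search R m comp nxt vert S' s :=
  ⟨h.holds, h.output, fun C hC =>
    let ⟨C', hC', hle⟩ := hS C hC
    ⟨(h.best C' hC').1, (h.best C' hC').2.trans hle⟩⟩

/-- The state after `t` stages of the algorithm; a stage tries all bounds and then adds an edge, if
there is one, to the forest. -/
def Stage (R : Roadmap n) (m t : ℕ) (s : Store) : Prop :=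
  ∃ F comp nxt vert, Kruskal R F comp ∧ Tours F comp nxt vert ∧
    Search R m comp nxt vert (settledCosts R m F t) s

theorem runs_mergeOrSkip (hN : n ≤ N) (hmn : m < n) (hK : Kruskal R F comp)
    (hT : Tours F comp nxt vert) (hE : EdgeFound R comp Set.univ s)
    (h : Search R m comp nxt vert
      (settledCosts R m F t ∪ acceptedBounds R m comp nxt vert {x | x.2 < 3 * n}) s) :
    Runs N (.ite (.ilt (.lit 0) (reg 24)) mergeTours .skip) s (Stage R m (t + 1)) := by
  obtain ⟨hflag, hnone⟩ | ⟨hflag, a, b, ha, hb, hab, hmin⟩ := hE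
  · refine Runs.ite (fun hb => absurd hflag hb.ne') fun _ => runs_skip.2 ?_
    refine ⟨F, comp, nxt, vert, hK, hT, h.of_exists_le ?_⟩
    rintro _ ⟨p, hp, rfl, -⟩
    exact exists_settled_or_accepted_le hmn hK hT hp
      fun _ _ e he => absurd he (hnone e trivial)
  · refine Runs.ite (fun _ => ?_) fun hb => absurd (Nat.pos_of_ne_zero hflag) hb
    refine (runs_mergeTours hN h.holds hT hK.comp_comp (ne_of_apply_ne comp hab.2) ha
      hb).frame.mono fun s' ⟨hs', hi, hd⟩ => ⟨(a, b) :: F, _, _, _, hK.cons hab.1 hab.2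
        (fun u v huv hne => hmin (u, v) trivial ⟨huv, hne⟩),
        hT.merge hK.comp_eq_of_mem hK.comp_comp hab.2,
        (h.of_exists_le ?_).of_holds hs' (fun c hc => hi c (by decide +revert))
          (hd 3 (by decide))⟩
    rintro _ ⟨p, hp, rfl, hlong⟩
    refine exists_settled_or_accepted_le hmn hK hT hp fun hlength hshort e he => ?_
    have hlt : coverCost R p < R.len a b := by
      by_contra! hle
      exact hlong ⟨congrArg (· + 1) hlength, List.forall_mem_cons.2 ⟨hle, hshort⟩⟩
    exact hlt.trans_le (hmin e trivial he)

theorem runs_pathCoverProg (hmn : m < n) :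
    Runs (3 * n) pathCoverProg (input R m) (Stage R m n) := by
  have hn : 0 < n := by lia
  refine Runs.seq ((runs_initTours (by lia)).frame.mono fun s₀ ⟨hs₀, hi₀, _⟩ => ?_)
  refine Runs.forUpTo (Stage R m) (by lia) (by decide) ?_ ?_ ?_ ?_ fun _ => id
  · refine ⟨[], _, _, _, .nil, Tours.one, hs₀, ?_, ?_⟩
    · simp [hi₀ 19 (by decide), input]
    · rintro _ ⟨p, -, -, h⟩
      exact absurd (by simp) h
  · exact fun i s x ⟨F, comp, nxt, vert, hK, hT, hs⟩ =>
      ⟨F, comp, nxt, vert, hK, hT, hs.seti (by decide) _ _ _⟩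
  · exact fun i s ⟨_, _, _, _, _, _, hs⟩ => hs.holds.count
  · rintro t s - - ⟨F, comp, nxt, vert, hK, hT, hs⟩
    refine Runs.seq ((runs_tryBounds le_rfl (by lia) hn hK hT hs).mono fun s₁ hs₁ =>
      Runs.seq ((runs_findEdge (by lia) hs₁.holds).frame.mono fun s₂ ⟨hE, hi, hd⟩ => ?_))
    exact runs_mergeOrSkip (by lia) hmn hK hT hE
      (hs₁.congr (fun a ha => hi a (by decide +revert)) fun a ha => hd a (by decide +revert))

theorem exists_isPathCover (R : Roadmap n) (hm : 0 < m) (hn : 0 < n) :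
    ∃ p : Fin m → List (Fin n), IsPathCover R p := by
  have hwalk (s : Finset (Fin n)) :
      ∃ v, ∃ w : R.graph.Walk ⟨0, hn⟩ v, ∀ x ∈ s, x ∈ w.support := by
    induction s using Finset.induction_on with
    | empty => exact ⟨_, .nil, by simp⟩
    | insert x s _ ih =>
      obtain ⟨v, w, hw⟩ := ih
      obtain ⟨w'⟩ := R.connected.preconnected v x
      refine ⟨x, w.append w', ?_⟩
      simp only [Finset.forall_mem_insert, SimpleGraph.Walk.mem_support_append_iff]
      exact ⟨Or.inr w'.end_mem_support, fun y hy => Or.inl (hw y hy)⟩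
  obtain ⟨v, w, hw⟩ := hwalk Finset.univ
  exact ⟨fun _ => w.support, fun _ => isPath_support R w, fun x => ⟨⟨0, hm⟩, hw x (by simp)⟩⟩

theorem Stage.exists_outputs (hm : 0 < m) (hn : 0 < n) (h : Stage R m n s) :
    ∃ p : Fin m → List (Fin n), Outputs s p ∧ IsPathCover R p ∧
      ∀ p' : Fin m → List (Fin n), IsPathCover R p' → coverCost R p ≤ 4 * coverCost R p' := by
  obtain ⟨F, comp, nxt, vert, hK, -, hs⟩ := h
  have hbest (p' : Fin m → List (Fin n)) (hp' : IsPathCover R p') :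
      s.idx 19 0 0 ≠ 0 ∧ s.dat 3 0 0 ≤ 4 * coverCost R p' :=
    hs.best _ ⟨p', hp', rfl, fun h => (hK.length_lt hn).ne h.1⟩
  obtain ⟨p₀, hp₀⟩ := exists_isPathCover (m := m) R hm hn
  obtain ⟨p, hout, hp, hle⟩ := hs.output (hbest p₀ hp₀).1
  exact ⟨p, hout, hp, fun p' hp' => (coverCost_le R hm hle).trans (hbest p' hp').2⟩

end Round

end Patrol

theorem lemma9 :
    ∃ (P : Patrol.Prog) (q : Polynomial ℕ),
      ∀ (n m : ℕ) (R : Patrol.Roadmap n), 0 < m → m < n →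
        ∃ (s : Patrol.Store) (c : ℕ) (p : Fin m → List (Fin n)),
          -- the program halts within polynomial time and outputs `p`
          Patrol.Exec P (Patrol.input R m) s c ∧ c ≤ q.eval n ∧ Patrol.Outputs s p ∧
          -- `p` is a 4-approximate min-max path cover
          Patrol.IsPathCover R p ∧
          (∀ p' : Fin m → List (Fin n), Patrol.IsPathCover R p' →
            Patrol.coverCost R p ≤ 4 * Patrol.coverCost R p') ∧
          -- sweeping `p` is an 8-approximate solution, whatever the time horizon
          ∀ T : ℝ, 0 < T →
            Patrol.IsTeamTrajectory R T (Patrol.sweep R p) ∧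
            ∀ Y : Fin m → ℝ → Fin n → ℝ, Patrol.IsTeamTrajectory R T Y →
              Patrol.refreshTime T (Patrol.sweep R p) ≤ 8 * Patrol.refreshTime T Y := by
  refine ⟨Patrol.pathCoverProg, Patrol.pathCoverProg.costPoly.comp (3 * Polynomial.X),
    fun n m R hm hmn => ?_⟩
  obtain ⟨s, c, hexec, hcost, hstage⟩ := Patrol.runs_pathCoverProg (R := R) hmn
  obtain ⟨p, hout, hp, happrox⟩ := hstage.exists_outputs hm (hm.trans hmn)
  have htime : c ≤ (Patrol.pathCoverProg.costPoly.comp (3 * Polynomial.X)).eval n := by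
    simpa [Polynomial.eval_comp] using hcost
  refine ⟨s, c, p, hexec, htime, hout, hp, happrox, fun T hT =>
    ⟨Patrol.isTeamTrajectory_sweep hp.1 T, fun Y hY => ?_⟩⟩
  calc Patrol.refreshTime T (Patrol.sweep R p)
      ≤ 2 * 4 * Patrol.refreshTime T Y :=
        Patrol.refreshTime_sweep_le_mul hm hp (by norm_num) happrox hT.le hY
    _ = 8 * Patrol.refreshTime T Y := by norm_num
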